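/- **The heap.** A heap stores elements with keys from a linear order (ties are broken by the addresses of the nodes). It is a heap-ordered forest; between operations it is at most one tree. Sibling lists, including the list of tree roots, are doubly linked, with cyclic left pointers and acyclic right pointers. A node stores its key, a rank, a subtype $A$, $L_1$, $L_2$ or $N$, and pointers to parent, leftmost child and siblings. The edge to the parent is a rank edge iff the subtype is not $A$; the loss of a node is $0$ for $A$ and $N$, $1$ for $L_1$, and at least $2$ for $L_2$. For each type $X\in\{A,L\}$ (subtypes $L_1,L_2$ have type $L$) there are an array $R_X$ addressed by ranks and a stack $C_X$, and $\Phi_A=|R_A|+2|C_A|$, $\Phi_L=3|R_L|+4|C_L|$, where $|R_X|$ is the number of non-null entries and $|C_L|$ is the number of items of $C_L$ plus $\mathrm{loss}(x)-1$ for each node $x$ of subtype $L_2$. *Private methods.* SetViolationSubtype$(S)$ removes $x$ from $R_X$ ($X$ the old type) if the entry at the rank of $x$ is $x$, sets the subtype to $S$, and, if $S\ne N$, pushes $x$ to the stack of the type of $S$ unless $x$ is known to be there (a violation that is neither in its array nor just taken out by the running reduction is known to be on its stack). DecrementRank changes the subtype by $A\to A$, $N\to L_1$, $L_1\to L_2$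 (a node of subtype $L_2$ only gains loss), then decrements the rank. CutFromParent$(c)$ calls DecrementRank for the parent of $c$ unless $c$ has subtype $A$, and takes $c$ from its sibling list. Link$(x,y)$: let $s$ be the node with the smaller key, $h$ the other one. $h$ is cut from its parent and becomes the leftmost child of $s$. If $\mathrm{rank}(s)\le\mathrm{rank}(h)$ (before the cut), $h$ gets subtype $N$, $s$ changes its subtype by $A\to A$, $L_1\to N$ and its rank is incremented; otherwise $h$ gets subtype $A$. (If $h$ was a rank child of $s$, then $s$ wins the new rank child before it loses the old one.) *Stack reductions.* A reduction of $C_X$ pops $x$. If $x$ is not of type $X$, nothing else happens. If $x$ has subtype $L_2$ (and $X=L$), it gets subtype $A$ and DecrementRank is called for its parent. Otherwise let $r$ be the rank of $x$: if $R_X[r]$ is null, $x$ is stored there; if it is $x$, nothing happens; if it is another node $y$, then $R_X[r]$ is set to null and $x,y$ are linked. *Public methods.* FindMin: (0) all tree roots get parent null and, if not of subtype $A$, are set to $A$; (1) stack reductions; (2) walking left through the cyclic root list, neighbouring roots are linked, each link being followed by a step to the left, until one tree is left; (3) stack reductions; return the root. Insert adds a new root of rank $0$ and subtype $N$ and calls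 FindMin. DecreaseKey$(x,k)$ cuts $x$ from its parent, adds it as a root, sets its key to $k$ and calls FindMin. DeleteMin makes the children of the root the list of roots, sets the old root to $N$, calls FindMin and discards the old root. Reductions of $C_L$ precede reductions of $C_A$. In DeleteMin, phases 1 and 3 empty both stacks. In the other methods they follow one of two worst-case strategies, fixed once and for all. First strategy: reduce $C_X$ while it is nonempty and $\Phi_X$ exceeds its value at the start of the method. Second strategy: a fixed number of reductions (fewer if a stack gets empty): for DecreaseKey $5$ of $C_L$ and $18$ of $C_A$ in phase 1 and $1$ of $C_A$ in phase 3; for Insert $2$ of $C_A$ in phase 1 and $1$ of $C_A$ in phase 3; for FindMin none. *Costs.* Time is the number of elementary steps (reading or writing a field or an array entry, comparing two keys, push, pop). Pointer overhead is the number of pointer changes not reflected in the heap trees: writes to $R_A,R_L$ and pushes to $C_A,C_L$. **Maximal rank.** A binomial tree of rank $r$ with losses arises from the binomial tree of rank $r$ by cutting off some subtrees, none of them at a child of the root; its total loss is the number of children lost by its nodes. Let $R(n)$ be the largest $r$ such that some binomial tree of rank $r$ with losses has total loss at most $r+1$ and at most $n$ nodes (and $R(0)=0$). **Theorem.** (a)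 For all $n\ge 1$: $R(n)<4+1.2\log_2 n$, hence $6R(n)+7\le 7.2\log_2 n+31$ and $\lceil(41R(n)+49)/2\rceil\le 24.6\log_2 n+107$. (b) There is a constant $C$ such that for every linear order of keys, each of the two strategies, and every sequence of Insert, FindMin, DecreaseKey (with a new key not larger than the current one) and DeleteMin, starting with the empty heap, the following holds. When the heap has $n$ elements, all of them have rank at most $R(n)$, and the next operation terminates correctly: - Insert returns a pointer to a new element in time at most $C$, with pointer overhead at most $9$; - FindMin returns an element with the smallest key (null if $n=0$) in time at most $C$, with no pointer overhead; - DecreaseKey takes time at most $C$, with pointer overhead at most $28$ for the first strategy and at most $59$ for the second strategy; - DeleteMin returns and removes an element with the smallest key (null if $n=0$) in time at most $C\,(\lfloor\log_2 n\rfloor+1)$ (at most $C$ if $n=0$), with at most $6R(n)+7$ stack reductions and pointer overhead at most $\lceil(41R(n)+49)/2\rceil$. -/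

import Mathlib

universe u

/-! ## Binomial trees with losses and the maximal rank -/

/-- A binomial tree of rank `r` some of whose edges have been cut (with the subtree below them).
The binomial tree of rank `r + 1` is the binomial tree of rank `r` whose root has got one more
child, the root of another binomial tree of rank `r`; the edge to this child is either kept
or cut. -/
inductive PrunedBinomial : ℕ → Type
  | single : PrunedBinomial 0
  | keep {r : ℕ} (t c : PrunedBinomial r) : PrunedBinomial (r + 1)
  | cut {r : ℕ} (t : PrunedBinomial r) : PrunedBinomial (r + 1)

namespace PrunedBinomial

/-- The number of nodes. -/
def size : {r : ℕ} → PrunedBinomial r → ℕ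
  | _, single => 1
  | _, keep t c => t.size + c.size
  | _, cut t => t.size

/-- The total loss: the number of children that the nodes of the tree have lost. -/
def totalLoss : {r : ℕ} → PrunedBinomial r → ℕ
  | _, single => 0
  | _, keep t c => t.totalLoss + c.totalLoss
  | _, cut t => t.totalLoss + 1

/-- The root has kept all its children, so that `t` is a binomial tree of rank `r` with losses. -/
def RootIntact : {r : ℕ} → PrunedBinomial r → Prop
  | _, single => True
  | _, keep t _ => t.RootIntact
  | _, cut _ => False

end PrunedBinomial

/-- `R(n)`: the largest `r` such that at most `n` nodes suffice for a binomial tree of rank `r` with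
losses whose total loss is at most `r + 1`. -/
noncomputable def maxRank (n : ℕ) : ℕ :=
  sSup {r : ℕ | ∃ t : PrunedBinomial r, t.RootIntact ∧ t.totalLoss ≤ r + 1 ∧ t.size ≤ n}

namespace DKHeap



/-! ## The memory of the heap -/

/-- Violation subtypes. -/
inductive Sub : Type
  | A
  | L1
  | L2
  | N
  deriving DecidableEq

/-- Violation types that have an array and a stack. -/
inductive Kind : Type
  | A
  | L
  deriving DecidableEq

/-- The violation type of a subtype (`none` stands for the type `N`). -/
def Sub.kind : Sub → Option Kind
  | .A => some .A
  | .L1 => some .L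
  | .L2 => some .L
  | .N => none

/-- The loss of a node that has just got the given subtype. -/
def Sub.startLoss : Sub → ℕ
  | .A => 0
  | .L1 => 1
  | .L2 => 2
  | .N => 0

/-- The weight of an array entry in `Φ_A = |R_A| + 2 |C_A|` and `Φ_L = 3 |R_L| + 4 |C_L|`. -/
def Kind.arrWeight : Kind → ℤ
  | .A => 1
  | .L => 3

/-- The weight of a stack item in `Φ_A = |R_A| + 2 |C_A|` and `Φ_L = 3 |R_L| + 4 |C_L|`. -/
def Kind.stkWeight : Kind → ℤ
  | .A => 2
  | .L => 4

/-- The memory. Nodes are addressed by natural numbers. `key x = none` means that `x` is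
not allocated. Sibling lists are doubly linked: `left` is cyclic (`left` of the leftmost node is the
rightmost one), `right` is acyclic (`right` of the rightmost node is null).
`arr X` and `stk X` are the array `R[X]`, addressed by ranks, and the stack `C[X]`.
`phi X` is the current value of `Φ_X`, kept up to date by the instructions below.
The last three fields only count: elementary instructions, changes of pointers outside of the heap
trees (array writes and stack pushes), and stack reductions. -/
structure State (α : Type u) : Type u where
  key : ℕ → Option α
  rank : ℕ → ℕ
  sub : ℕ → Sub
  loss : ℕ → ℕ
  parent : ℕ → Option ℕ
  child : ℕ → Option ℕ
  left : ℕ → ℕ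
  right : ℕ → Option ℕ
  next : ℕ
  roots : Option ℕ
  arr : Kind → ℕ → Option ℕ
  stk : Kind → List ℕ
  phi : Kind → ℤ
  time : ℕ
  overhead : ℕ
  reductions : ℕ

/-- The heap before the first operation. -/
def State.empty (α : Type u) : State α where
  key := fun _ => none
  rank := fun _ => 0
  sub := fun _ => .N
  loss := fun _ => 0
  parent := fun _ => none
  child := fun _ => none
  left := fun x => x
  right := fun _ => none
  next := 0
  roots := none
  arr := fun _ _ => none
  stk := fun _ => []
  phi := fun _ => 0
  time := 0
  overhead := 0
  reductions := 0

/-! ## Programs -/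

/-- Programs that act on the memory and return a `β`. The outcome `none` stands for a crash (null is
dereferenced) and for a run that does not terminate. -/
def Prog (α : Type u) (β : Type) : Type u := State α → Option (β × State α)

instance (α : Type u) : Monad (Prog α) where
  pure b := fun s => some (b, s)
  bind p f := fun s => (p s).bind fun r => f r.1 r.2

variable {α : Type u}

/-- Repeats `step`, which returns `some b` if the loop goes on with `b`, and `none` if it ends. -/
def loop {β : Type} (step : β → Prog α (Option β)) (b : β) (s : State α) :
    Option (Unit × State α) :=
  step b s >>= fun r =>
    match r.1 with
    | none => some ((), r.2)
    | some b' => loop step b' r.2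
  partial_fixpoint

/-- Repeats `body` as long as `guard` returns `true`. -/
def whileLoop (guard : Prog α Bool) (body : Prog α Unit) : Prog α Unit :=
  loop (fun _ : Unit => do
    if ← guard then
      body
      pure (some ())
    else
      pure none) ()

/-- Performs `body` while `guard` returns `true`, but at most `m` times. -/
def upTo (guard : Prog α Bool) (body : Prog α Unit) : ℕ → Prog α Unit
  | 0 => pure ()
  | m + 1 => do
    if ← guard then
      body
      upTo guard body m

/-- Continues with the target of a pointer, crashes if the pointer is null. -/
def target (o : Option ℕ) : Prog α ℕ := fun s => o.map fun x => (x, s)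

/-! ### Elementary instructions: each of them takes one unit of time -/

/-- An instruction that reads. -/
def rd {β : Type} (f : State α → β) : Prog α β :=
  fun s => some (f s, { s with time := s.time + 1 })

/-- An instruction that writes. -/
def wr (f : State α → State α) : Prog α Unit :=
  fun s => some ((), { f s with time := s.time + 1 })

def getRank (x : ℕ) : Prog α ℕ := rd fun s => s.rank x

def getSub (x : ℕ) : Prog α Sub := rd fun s => s.sub x

def getParent (x : ℕ) : Prog α (Option ℕ) := rd fun s => s.parent x

def getChild (x : ℕ) : Prog α (Option ℕ) := rd fun s => s.child x

def getLeft (x : ℕ) : Prog α ℕ := rd fun s => s.left x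

def getRight (x : ℕ) : Prog α (Option ℕ) := rd fun s => s.right x

def getRoots : Prog α (Option ℕ) := rd fun s => s.roots

def getArr (X : Kind) (r : ℕ) : Prog α (Option ℕ) := rd fun s => s.arr X r

def getPhi (X : Kind) : Prog α ℤ := rd fun s => s.phi X

def stkNonempty (X : Kind) : Prog α Bool := rd fun s => !(s.stk X).isEmpty

def setRank (x r : ℕ) : Prog α Unit :=
  wr fun s => { s with rank := Function.update s.rank x r }

def setParent (x : ℕ) (p : Option ℕ) : Prog α Unit :=
  wr fun s => { s with parent := Function.update s.parent x p }

def setChild (x : ℕ) (c : Option ℕ) : Prog α Unit :=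
  wr fun s => { s with child := Function.update s.child x c }

def setLeft (x y : ℕ) : Prog α Unit :=
  wr fun s => { s with left := Function.update s.left x y }

def setRight (x : ℕ) (y : Option ℕ) : Prog α Unit :=
  wr fun s => { s with right := Function.update s.right x y }

def setRoots (c : Option ℕ) : Prog α Unit := wr fun s => { s with roots := c }

def setKey (x : ℕ) (k : α) : Prog α Unit :=
  wr fun s => { s with key := Function.update s.key x (some k) }

/-- Compares the keys of two allocated nodes; ties are broken by the addresses. -/
def keyLt [LinearOrder α] (x y : ℕ) : Prog α Bool := fun s =>
  match s.key x, s.key y with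
  | some a, some b =>
    some (decide (a < b ∨ (a = b ∧ x < y)), { s with time := s.time + 1 })
  | _, _ => none

/-- Creates a node with key `k`, rank `0`, subtype `N`, no parent and no child. -/
def alloc (k : α) : Prog α ℕ := fun s =>
  some (s.next, { s with
    key := Function.update s.key s.next (some k)
    rank := Function.update s.rank s.next 0
    sub := Function.update s.sub s.next .N
    loss := Function.update s.loss s.next 0
    parent := Function.update s.parent s.next none
    child := Function.update s.child s.next none
    next := s.next + 1
    time := s.time + 1 })

/-- Discards a node. -/
def free (x : ℕ) : Prog α Unit :=
  wr fun s => { s with key := Function.update s.key x none }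

/-- `1` for a pointer, `0` for null. -/
def occupied (o : Option ℕ) : ℤ := if o.isSome then 1 else 0

/-- Writes to the array `R[X]`. -/
def setArr (X : Kind) (r : ℕ) (v : Option ℕ) : Prog α Unit :=
  wr fun s => { s with
    arr := Function.update s.arr X (Function.update (s.arr X) r v)
    phi := Function.update s.phi X
      (s.phi X + X.arrWeight * (occupied v - occupied (s.arr X r)))
    overhead := s.overhead + 1 }

/-- Pushes `x` to the stack `C[X]`. -/
def push (X : Kind) (x : ℕ) : Prog α Unit :=
  wr fun s => { s with
    stk := Function.update s.stk X (x :: s.stk X)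
    phi := Function.update s.phi X (s.phi X + X.stkWeight)
    overhead := s.overhead + 1 }

/-- Pops a node from the stack `C[X]`. -/
def pop (X : Kind) : Prog α ℕ := fun s =>
  match s.stk X with
  | [] => none
  | x :: l => some (x, { s with
      stk := Function.update s.stk X l
      phi := Function.update s.phi X (s.phi X - X.stkWeight)
      time := s.time + 1 })

/-- Sets subtype and loss of `x`. In `|C_L|` a node of loss `l ≥ 2` has weight `l` instead of `1`,
so `Φ_L` changes by `4` times the change of `l - 1` (natural subtraction). -/
def setSubLoss (x : ℕ) (S : Sub) (l : ℕ) : Prog α Unit :=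
  wr fun s => { s with
    sub := Function.update s.sub x S
    loss := Function.update s.loss x l
    phi := Function.update s.phi .L
      (s.phi .L + Kind.L.stkWeight * (((l - 1 : ℕ) : ℤ) - ((s.loss x - 1 : ℕ) : ℤ))) }

/-- Increments the loss of a node of subtype `L2`. -/
def incLoss (x : ℕ) : Prog α Unit := fun s => setSubLoss x .L2 (s.loss x + 1) s

/-- Counts a stack reduction. -/
def countReduction : Prog α Unit := wr fun s => { s with reductions := s.reductions + 1 }

/-! ### Sibling lists -/

/-- The leftmost child of a node; the leftmost tree root for `none`. -/
def getHead : Option ℕ → Prog α (Option ℕ)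
  | none => getRoots
  | some p => getChild p

def setHead : Option ℕ → Option ℕ → Prog α Unit
  | none, c => setRoots c
  | some p, c => setChild p c

/-- Removes `c` from the list of the children of `p` (of the tree roots, if `p` is `none`). -/
def removeFrom (p : Option ℕ) (c : ℕ) : Prog α Unit := do
  let l ← getLeft c
  let r ← getRight c
  let head ← getHead p
  if head = some c then
    setHead p r
    match r with
    | none => pure ()
    | some y => setLeft y l
  else
    setRight l r
    match r with
    | none => do
      let h ← target head
      setLeft h l
    | some y => setLeft y l

/-- Adds `c` as the leftmost child of `p` (as the leftmost tree root, if `p` is `none`). -/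
def addLeftmost (p : Option ℕ) (c : ℕ) : Prog α Unit := do
  let head ← getHead p
  match head with
  | none => do
    setLeft c c
    setRight c none
  | some h => do
    let l ← getLeft h
    setLeft c l
    setRight c (some h)
    setLeft h c
  setHead p (some c)

/-! ### Private methods -/

/-- SetViolationSubtype. A violation that is not in its array is known to be on its stack, unless
`taken` says that the running reduction has just taken it from there or from the array. -/
def setViolationSubtype (taken : Bool) (x : ℕ) (S : Sub) : Prog α Unit := do
  let O ← getSub x
  let known ← (match O.kind with
    | none => pure none
    | some X => do
      let r ← getRank x
      let y ← getArr X r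
      if y = some x then
        setArr X r none
        pure none
      else
        pure (if taken then none else some X) : Prog α (Option Kind))
  setSubLoss x S S.startLoss
  match S.kind with
  | none => pure ()
  | some Y => if known = some Y then pure () else push Y x

/-- DecrementRank. -/
def decrementRank (x : ℕ) : Prog α Unit := do
  let O ← getSub x
  match O with
  | .A => setViolationSubtype false x .A
  | .N => setViolationSubtype false x .L1
  | .L1 => setViolationSubtype false x .L2
  | .L2 => incLoss x
  let r ← getRank x
  setRank x (r - 1)

/-- CutFromParent. -/
def cutFromParent (c : ℕ) : Prog α Unit := do
  let O ← getSub c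
  let p ← getParent c
  if O ≠ .A then
    let q ← target p
    decrementRank q
  removeFrom p c
  setParent c none

/-- Link; returns the node that has become the parent. If the nodes have subtype `L1` and
`h` is a child of `s`, then `s` wins a rank child before it loses one. -/
def link [LinearOrder α] (taken : Bool) (x y : ℕ) : Prog α ℕ := do
  let b ← keyLt x y
  let s := if b then x else y
  let h := if b then y else x
  let rs ← getRank s
  let rh ← getRank h
  if rs ≤ rh then
    let O ← getSub s
    setViolationSubtype taken s (if O = .L1 then .N else O)
    setRank s (rs + 1)
  cutFromParent h
  addLeftmost (some s) h
  setParent h (some s)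
  let H : Sub := if rs ≤ rh then .N else .A
  let O ← getSub h
  if O ≠ H then
    setViolationSubtype false h H
  pure s

/-! ### Stack reductions -/

/-- `|C_A|` reduction. -/
def reduceA [LinearOrder α] : Prog α Unit := do
  countReduction
  let x ← pop .A
  let O ← getSub x
  match O with
  | .A => do
    let r ← getRank x
    let e ← getArr .A r
    match e with
    | none => setArr .A r (some x)
    | some y =>
      if y = x then
        pure ()
      else
        setArr .A r none
        let _ ← link true x y
        pure ()
  | _ => pure ()

/-- `|C_L|` reduction. -/
def reduceL [LinearOrder α] : Prog α Unit := do
  countReduction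
  let x ← pop .L
  let O ← getSub x
  match O with
  | .L2 => do
    let q ← getParent x
    let p ← target q
    setViolationSubtype false x .A
    decrementRank p
  | .L1 => do
    let r ← getRank x
    let e ← getArr .L r
    match e with
    | none => setArr .L r (some x)
    | some y =>
      if y = x then
        pure ()
      else
        setArr .L r none
        let _ ← link true x y
        pure ()
  | _ => pure ()

/-- Empties both stacks. -/
def reduceAll [LinearOrder α] : Prog α Unit := do
  whileLoop (stkNonempty .L) reduceL
  whileLoop (stkNonempty .A) reduceA

/-- The stack of kind `X` is nonempty and `Φ_X` exceeds `v`. -/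
def exceeds (X : Kind) (v : ℤ) : Prog α Bool := do
  let b ← stkNonempty X
  let w ← getPhi X
  pure (b && decide (v < w))

/-- Reductions until `Φ_L ≤ vL` or `C[L]` is empty, and `Φ_A ≤ vA` or `C[A]` is empty. -/
def reduceDown [LinearOrder α] (vA vL : ℤ) : Prog α Unit := do
  whileLoop (exceeds .L vL) reduceL
  whileLoop (exceeds .A vA) reduceA

/-- Reductions by a plan: `mL` of the stack `C[L]` and `mA` of `C[A]`, fewer if a stack gets
empty. -/
def reducePlan [LinearOrder α] (mL mA : ℕ) : Prog α Unit := do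
  upTo (stkNonempty .L) reduceL mL
  upTo (stkNonempty .A) reduceA mA

/-! ### Public methods -/

/-- The first strategy makes reductions while a potential exceeds its value at the start of the
method, the second one makes a planned number of reductions. -/
inductive Strategy : Type
  | first
  | second

/-- FindMin with the given stack reductions for the phases 1 and 3. -/
def findMinWith [LinearOrder α] (phase1 phase3 : Prog α Unit) : Prog α (Option ℕ) := do
  let start ← getRoots
  loop (fun cur : Option ℕ => do
    match cur with
    | none => pure none
    | some x => do
      setParent x none
      let O ← getSub x
      if O ≠ .A then
        setViolationSubtype false x .A
      let y ← getRight x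
      pure (some y)) start
  phase1
  let first ← getRoots
  match first with
  | none => pure ()
  | some x0 =>
    loop (fun x : ℕ => do
      let y ← getLeft x
      if y = x then
        pure none
      else
        let s ← link false x y
        let z ← getLeft s
        pure (some z)) x0
  phase3
  getRoots

/-- FindMin with the reductions of a worst-case strategy: `vA` and `vL` are the potentials at the
start of the calling method, the plan of the second strategy is `mL`, `mA` reductions for phase 1
and `mA3` reductions of `C[A]` for phase 3. -/
def findMinBy [LinearOrder α] (σ : Strategy) (vA vL : ℤ) (mL mA mA3 : ℕ) :
    Prog α (Option ℕ) :=
  match σ with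
  | .first => findMinWith (reduceDown vA vL) (reduceDown vA vL)
  | .second => findMinWith (reducePlan mL mA) (reducePlan 0 mA3)

/-- FindMin: returns the element with the smallest key, null for an empty heap. -/
def findMin [LinearOrder α] (σ : Strategy) : Prog α (Option ℕ) := do
  let vA ← getPhi .A
  let vL ← getPhi .L
  findMinBy σ vA vL 0 0 0

/-- Insert: returns a pointer to the new element. -/
def insert [LinearOrder α] (σ : Strategy) (k : α) : Prog α ℕ := do
  let vA ← getPhi .A
  let vL ← getPhi .L
  let x ← alloc k
  addLeftmost none x
  let _ ← findMinBy σ vA vL 0 2 1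
  pure x

/-- DecreaseKey. -/
def decreaseKey [LinearOrder α] (σ : Strategy) (x : ℕ) (k : α) : Prog α Unit := do
  let vA ← getPhi .A
  let vL ← getPhi .L
  cutFromParent x
  addLeftmost none x
  setKey x k
  let _ ← findMinBy σ vA vL 5 18 1
  pure ()

/-- DeleteMin: removes and returns the element with the smallest key, returns null for an
empty heap. -/
def deleteMin [LinearOrder α] : Prog α (Option ℕ) := do
  let root ← getRoots
  match root with
  | none => pure none
  | some ρ => do
    let c ← getChild ρ
    setRoots c
    setViolationSubtype false ρ .N
    let _ ← findMinWith reduceAll reduceAll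
    free ρ
    pure (some ρ)

/-! ## Histories of the heap -/

/-- `Reachable σ s S`: the state `s` arises from the empty heap by a sequence of calls of the public
methods, and `S` consists of the elements (pointer and current key) that these calls have
inserted and not yet removed. DecreaseKey may be called for any element of the heap with a new key
that is not larger than the current one. -/
inductive Reachable [LinearOrder α] (σ : Strategy) : State α → Finset (ℕ × α) → Prop
  | empty : Reachable σ (State.empty α) ∅
  | insert {s s' : State α} {S : Finset (ℕ × α)} {k : α} {x : ℕ} :
      Reachable σ s S → DKHeap.insert σ k s = some (x, s') →
      Reachable σ s' (Insert.insert (x, k) S)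
  | findMin {s s' : State α} {S : Finset (ℕ × α)} {o : Option ℕ} :
      Reachable σ s S → DKHeap.findMin σ s = some (o, s') → Reachable σ s' S
  | decreaseKey {s s' : State α} {S : Finset (ℕ × α)} {x : ℕ} {k₀ k : α} :
      Reachable σ s S → (x, k₀) ∈ S → k ≤ k₀ → DKHeap.decreaseKey σ x k s = some ((), s') →
      Reachable σ s' (Insert.insert (x, k) (S.erase (x, k₀)))
  | deleteMin {s s' : State α} {S : Finset (ℕ × α)} {x : ℕ} {k : α} :
      Reachable σ s S → DKHeap.deleteMin s = some (some x, s') → (x, k) ∈ S →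
      Reachable σ s' (S.erase (x, k))
  | deleteMinNull {s s' : State α} {S : Finset (ℕ × α)} :
      Reachable σ s S → DKHeap.deleteMin s = some (none, s') → Reachable σ s' S

/-- `o` is the answer to a query for an element of `S` with the smallest key. -/
def IsMinOf [LinearOrder α] (S : Finset (ℕ × α)) (o : Option ℕ) : Prop :=
  match o with
  | none => S = ∅
  | some x => ∃ k : α, (x, k) ∈ S ∧ ∀ e ∈ S, k ≤ e.2

/-- The bound for the pointer overhead of DecreaseKey. -/
def Strategy.decreaseKeyOverhead : Strategy → ℕ
  | .first => 28
  | .second => 59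

end DKHeap

/-!
A binomial tree with losses of rank `r` and total loss at most `r + 1` cannot be small. A tree of
rank `k` that has lost `l` children has at least `2 ^ (k - l)` nodes, and this convex function of
`l` lies above its secants (`PrunedBinomial.secant_le_size`). Summation over the children of the
root gives a lower bound that depends on the total loss only
(`PrunedBinomial.RootIntact.secant_le_size`), and a good choice of the secant yields the bound on
`maxRank` (`maxRank_lt`).

The heap satisfies the invariant `Inv`. Besides heap order and correct pointers it says that each
violation is in its array or on its stack (`Viol`), and that the rank children of a node can be
enumerated such that the `i`-th one has rank plus loss at least `i` (`Ranked`); a link adds a child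
at the end of this enumeration. Therefore each tree contains a binomial tree with losses whose rank
is the rank of the root (`Forest.exists_prunedBinomial`). The total loss is at most `Φ_L / 3`, and
`Φ_L ≤ 3 (R + 1)` holds between the operations, where `R` is `maxRank` of the number of elements; so
no rank exceeds `R` (`Inv.rank_le`). Conversely, once `C[L]` is empty, the losses are counted by the
entries of `R[L]`, hence bounded by the largest rank plus one, so that the bound on the ranks and
then the bound on `Φ_L` hold again (`Inv.rank_le_of_stk_nil`). The bound `Φ_A ≤ R + 1` follows in
the same way when `C[A]` is empty. `HeapInv` collects what holds between the operations.

Each reduction of `C[A]` decreases `Φ_A` by at least `1` at an overhead of at most `2`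
(`reduceA_spec`), and each reduction of `C[L]` decreases `Φ_L` and `Φ_A + Φ_L`, where the decrease
of `Φ_L` pays for the overhead and for the increase of `Φ_A` (`reduceL_spec`). The operations
change the potentials by a constant before their reductions, except for DeleteMin. For the first
strategy, `lossCost` bounds the price of an excess of `Φ_L`; for the second one, the number of
reductions bounds the overhead, and one unit is saved because the new root is not in `R[A]`
(`reduceAndLink_first`, `reduceAndLink_second`).

In DeleteMin there are at most `2 R` new roots, since at most `R` children of the old root are rank
children and at most `Φ_A - 1` nodes other than the old root have subtype `A`. The links of
the roots may increase `Φ_A`, but only when a loser of a link stays on `C[A]` as a stale item, which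
can be removed without overhead. So stale items get the weight `1` in the potential `psi`, which
the links do not increase, and which equals `Φ_A` when `C[A]` is empty. This bounds the number of
reductions by `Φ_A + Φ_L` (at the start of phase 1), and `3 * overhead + 6 * psi` increases by at most
`9` with each link (`link_roots_spec`, `reduceAndLink_reduceAll`, `deleteMin_spec`).
-/

/-! ### The maximal rank -/

namespace PrunedBinomial

/-- Each lost child at most halves the size. -/
theorem two_pow_le_size_mul : ∀ {r : ℕ} (t : PrunedBinomial r), 2 ^ r ≤ t.size * 2 ^ t.totalLoss
  | _, single => by simp [size, totalLoss]
  | _, keep (r := r) t c => by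
    have h1 := two_pow_le_size_mul t
    have h2 := two_pow_le_size_mul c
    have h3 : 1 ≤ 2 ^ t.totalLoss := Nat.one_le_two_pow
    have h4 : 1 ≤ 2 ^ c.totalLoss := Nat.one_le_two_pow
    simp only [size, totalLoss, pow_add, pow_one]
    have h5 := Nat.mul_le_mul h1 h4
    have h6 := Nat.mul_le_mul h2 h3
    nlinarith
  | _, cut t => by
    have h1 := two_pow_le_size_mul t
    simp only [size, totalLoss, pow_add, pow_one]
    nlinarith

theorem size_pos {r : ℕ} (t : PrunedBinomial r) : 0 < t.size := by
  have h := two_pow_le_size_mul t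
  have h2 : 0 < 2 ^ r := by positivity
  by_contra h3
  have : t.size = 0 := by omega
  rw [this, zero_mul] at h
  omega

/-- The convex function `2 ^ x` lies above its secant through `c` and `c + 1`; applied to a tree
of rank `c + d` this bounds the size from below by an affine function of the total loss. -/
theorem secant_le_size {c d : ℕ} (t : PrunedBinomial (c + d)) :
    2 ^ c * (1 + d) ≤ t.size + 2 ^ c * t.totalLoss := by
  have h := two_pow_le_size_mul t
  rcases le_or_gt (1 + d) t.totalLoss with hl | hl
  · exact (Nat.mul_le_mul_left _ hl).trans (Nat.le_add_left _ _)
  · obtain ⟨e, he⟩ : ∃ e, d = t.totalLoss + e := ⟨d - t.totalLoss, by omega⟩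
    have hs : 2 ^ c * 2 ^ e ≤ t.size := by
      have h2 : 2 ^ c * 2 ^ e * 2 ^ t.totalLoss ≤ t.size * 2 ^ t.totalLoss := by
        refine le_trans (le_of_eq ?_) h
        rw [← pow_add, ← pow_add]
        have hc : c + e + t.totalLoss = c + d := by omega
        exact congrArg (fun i : ℕ => 2 ^ i) hc
      exact Nat.le_of_mul_le_mul_right h2 (by positivity)
    have h3 : e + 1 ≤ 2 ^ e := Nat.lt_two_pow_self
    calc 2 ^ c * (1 + d) = 2 ^ c * (e + 1) + 2 ^ c * t.totalLoss := by
          have hc' : 1 + d = e + 1 + t.totalLoss := by omega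
          rw [← mul_add, hc']
      _ ≤ _ := Nat.add_le_add_right ((Nat.mul_le_mul_left _ h3).trans hs) _

/-- The sum of the secant bounds over the children of an intact root. -/
theorem RootIntact.secant_le_size (c : ℕ) : ∀ {r : ℕ} (t : PrunedBinomial r), t.RootIntact →
    ∀ d, r = c + d → 2 ^ c * (2 + d * (d + 1)) ≤ 2 * t.size + 2 * (2 ^ c * t.totalLoss)
  | r, t, _, 0, h => by
    obtain rfl : r = c := by simpa using h
    have := PrunedBinomial.secant_le_size (d := 0) t
    simp only [zero_mul, add_zero, mul_one] at this ⊢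
    omega
  | _, keep (r := r) t c', ht, d + 1, h => by
    obtain rfl : r = c + d := by omega
    have h1 := RootIntact.secant_le_size c t ht d rfl
    have h2 := PrunedBinomial.secant_le_size c'
    simp only [size, totalLoss]
    nlinarith

end PrunedBinomial

/-- The choice of `d` in `RootIntact.secant_le_size` for a tree of rank `r = c + d` and total loss at
most `r + 1`: with the first bound the size is at least `2 ^ c`, with the second one at least
`2 ^ (c + 1)`, and `d` is small enough for `c > (5 r - 20) / 6` or `c + 1 > (5 r - 20) / 6`. The
least possible `d` is about `√(2 r)`, which is good enough from `r = 36` on. -/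
theorem exists_triangular_bound {r : ℕ} (hr : 3 ≤ r) :
    ∃ d ≤ r, 2 * (r + 1) ≤ d * (d + 1) ∧
      (6 * d < r + 20 ∨ (2 * (r + 2) ≤ d * (d + 1) ∧ 6 * d < r + 26)) := by
  rcases lt_or_ge r 36 with h | h
  · have : ∀ r < 36, 3 ≤ r → ∃ d ≤ r, 2 * (r + 1) ≤ d * (d + 1) ∧
      (6 * d < r + 20 ∨ (2 * (r + 2) ≤ d * (d + 1) ∧ 6 * d < r + 26)) := by decide
    exact this r h hr
  · have hex : ∃ d, 2 * (r + 1) ≤ d * (d + 1) := ⟨r + 1, by nlinarith⟩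
    obtain ⟨d, hd, hmin⟩ : ∃ d, 2 * (r + 1) ≤ d * (d + 1) ∧
        ∀ m < d, ¬ 2 * (r + 1) ≤ m * (m + 1) :=
      ⟨Nat.find hex, Nat.find_spec hex, fun m hm => Nat.find_min hex hm⟩
    have h9 : 9 ≤ d := by
      by_contra hlt
      have : d ≤ 8 := by omega
      nlinarith
    obtain ⟨e, rfl⟩ : ∃ e, d = e + 1 := ⟨d - 1, by omega⟩
    have := hmin e (by omega)
    have h6 : 6 * (e + 1) < r + 20 := by nlinarith
    exact ⟨e + 1, by nlinarith, hd, Or.inl h6⟩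

theorem PrunedBinomial.RootIntact.two_pow_lt {r n : ℕ} {t : PrunedBinomial r} (ht : t.RootIntact)
    (hl : t.totalLoss ≤ r + 1) (hn : t.size ≤ n) : 2 ^ (5 * r) < 2 ^ 20 * n ^ 6 := by
  have hn1 : 1 ≤ n := t.size_pos.trans_le hn
  rcases lt_or_ge r 3 with hr | hr
  · calc 2 ^ (5 * r) < 2 ^ 20 := Nat.pow_lt_pow_right (by norm_num) (by omega)
      _ ≤ 2 ^ 20 * n ^ 6 := Nat.le_mul_of_pos_right _ (by positivity)
  obtain ⟨d, hdr, hd, h6⟩ := exists_triangular_bound hr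
  obtain ⟨c, rfl⟩ := Nat.exists_eq_add_of_le' hdr
  have hs := RootIntact.secant_le_size c t ht d rfl
  have hp : 0 < 2 ^ c := by positivity
  have hl' := Nat.mul_le_mul_left (2 ^ c) hl
  have key : ∀ e, c * 6 + e * 6 + 20 > 5 * (c + d) → 2 ^ (c + e) ≤ n →
      2 ^ (5 * (c + d)) < 2 ^ 20 * n ^ 6 := by
    intro e he hle
    calc 2 ^ (5 * (c + d)) < 2 ^ (20 + (c + e) * 6) :=
          Nat.pow_lt_pow_right (by norm_num) (by omega)
      _ = 2 ^ 20 * (2 ^ (c + e)) ^ 6 := by rw [pow_add, pow_mul]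
      _ ≤ _ := Nat.mul_le_mul_left _ (Nat.pow_le_pow_left hle 6)
  rcases h6 with h6 | ⟨hd2, h6⟩
  · refine key 0 (by omega) ?_
    have := Nat.mul_le_mul_left (2 ^ c) hd
    simp only [add_zero]
    nlinarith
  · refine key 1 (by omega) ?_
    have := Nat.mul_le_mul_left (2 ^ c) hd2
    rw [pow_succ]
    nlinarith

theorem lt_of_two_pow_lt {r n : ℕ} (hn : 1 ≤ n) (h : 2 ^ (5 * r) < 2 ^ 20 * n ^ 6) :
    (r : ℝ) < 4 + 1.2 * Real.logb 2 n := by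
  have hn0 : (0 : ℝ) < n := by exact_mod_cast hn
  have h1 : (2 : ℝ) ^ (5 * r) < 2 ^ 20 * (n : ℝ) ^ 6 := by exact_mod_cast h
  have h2 := Real.logb_lt_logb (b := 2) (by norm_num) (by positivity) h1
  rw [Real.logb_mul (by positivity) (by positivity), Real.logb_pow, Real.logb_pow, Real.logb_pow,
    Real.logb_self_eq_one (by norm_num)] at h2
  push_cast at h2
  linarith

theorem bddAbove_ranks (n : ℕ) :
    BddAbove {r : ℕ | ∃ t : PrunedBinomial r, t.RootIntact ∧ t.totalLoss ≤ r + 1 ∧ t.size ≤ n} := by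
  refine ⟨2 ^ 20 * n ^ 6, ?_⟩
  rintro r ⟨t, h1, h2, h3⟩
  have h4 : 5 * r < 2 ^ (5 * r) := Nat.lt_two_pow_self
  have := h1.two_pow_lt h2 h3
  omega

theorem le_maxRank {r n : ℕ} (t : PrunedBinomial r) (h1 : t.RootIntact) (h2 : t.totalLoss ≤ r + 1)
    (h3 : t.size ≤ n) : r ≤ maxRank n :=
  le_csSup (bddAbove_ranks n) ⟨t, h1, h2, h3⟩

theorem maxRank_spec {n : ℕ} (hn : 1 ≤ n) :
    ∃ t : PrunedBinomial (maxRank n), t.RootIntact ∧ t.totalLoss ≤ maxRank n + 1 ∧ t.size ≤ n :=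
  Nat.sSup_mem (s := {r : ℕ | ∃ t : PrunedBinomial r, t.RootIntact ∧ t.totalLoss ≤ r + 1 ∧
    t.size ≤ n}) ⟨0, .single, trivial, by simp [PrunedBinomial.totalLoss],
      by simpa [PrunedBinomial.size] using hn⟩ (bddAbove_ranks n)

theorem maxRank_zero : maxRank 0 = 0 := by
  have : {r : ℕ | ∃ t : PrunedBinomial r, t.RootIntact ∧ t.totalLoss ≤ r + 1 ∧ t.size ≤ 0} = ∅ := by
    ext r
    simp only [Set.mem_ofPred_eq, Set.mem_empty_iff_false, iff_false]
    rintro ⟨t, -, -, h⟩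
    have := t.size_pos
    omega
  rw [maxRank, this]
  simp

theorem maxRank_mono : Monotone maxRank := by
  intro m n hmn
  rcases Nat.eq_zero_or_pos m with rfl | hm
  · simp [maxRank_zero]
  · obtain ⟨t, h1, h2, h3⟩ := maxRank_spec hm
    exact le_maxRank t h1 h2 (h3.trans hmn)

theorem maxRank_lt {n : ℕ} (hn : 1 ≤ n) : (maxRank n : ℝ) < 4 + 1.2 * Real.logb 2 n := by
  obtain ⟨t, h1, h2, h3⟩ := maxRank_spec hn
  exact lt_of_two_pow_lt hn (h1.two_pow_lt h2 h3)

theorem maxRank_le_log (n : ℕ) : maxRank n ≤ 6 + 2 * Nat.log 2 n := by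
  rcases Nat.eq_zero_or_pos n with rfl | hn
  · simp [maxRank_zero]
  obtain ⟨t, h1, h2, h3⟩ := maxRank_spec hn
  have h := h1.two_pow_lt h2 h3
  have h4 : n < 2 ^ (Nat.log 2 n + 1) := Nat.lt_pow_succ_log_self (by norm_num) n
  have h5 : 2 ^ (5 * maxRank n) < 2 ^ (20 + (Nat.log 2 n + 1) * 6) := by
    refine h.trans_le ?_
    rw [pow_add, pow_mul 2 (Nat.log 2 n + 1)]
    exact Nat.mul_le_mul_left _ (Nat.pow_le_pow_left h4.le 6)
  have := (Nat.pow_lt_pow_iff_right (by norm_num)).1 h5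
  omega

theorem ceil_overhead_le {R : ℕ} {l : ℝ} (h : (R : ℝ) < 4 + 1.2 * l) :
    (⌈(41 * (R : ℝ) + 49) / 2⌉ : ℝ) ≤ 24.6 * l + 107 := by
  have h1 : ⌈(41 * (R : ℝ) + 49) / 2⌉ ≤ (41 * (R : ℤ) + 50) / 2 := by
    rw [Int.ceil_le]
    have h3 : (41 * (R : ℤ) + 49) ≤ 2 * ((41 * (R : ℤ) + 50) / 2) := by omega
    have h4 : (41 * (R : ℝ) + 49) ≤ 2 * (((41 * (R : ℤ) + 50) / 2 : ℤ) : ℝ) := by exact_mod_cast h3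
    linarith
  have h2 : 2 * ((41 * (R : ℤ) + 50) / 2) ≤ 41 * (R : ℤ) + 50 := by omega
  have h5 : 2 * (((41 * (R : ℤ) + 50) / 2 : ℤ) : ℝ) ≤ 41 * (R : ℝ) + 50 := by exact_mod_cast h2
  have h6 : (⌈(41 * (R : ℝ) + 49) / 2⌉ : ℝ) ≤ (((41 * (R : ℤ) + 50) / 2 : ℤ) : ℝ) := by
    exact_mod_cast h1
  norm_num at h ⊢
  linarith

namespace DKHeap

/-! ### Running programs -/

section

variable {α : Type u}

section Run

variable {β γ : Type}

theorem bind_apply (p : Prog α β) (f : β → Prog α γ) (s : State α) :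
    (p >>= f) s = (p s).bind fun r => f r.1 r.2 := rfl

theorem pure_apply (b : β) (s : State α) : (pure b : Prog α β) s = some (b, s) := rfl

theorem rd_apply (f : State α → β) (s : State α) :
    rd f s = some (f s, { s with time := s.time + 1 }) := rfl

theorem wr_apply (f : State α → State α) (s : State α) :
    wr f s = some ((), { f s with time := s.time + 1 }) := rfl

theorem target_some (x : ℕ) (s : State α) : target (some x) s = some (x, s) := rfl

end Run

/-! ### Sibling lists -/

/-- The leftmost node of the list with owner `p`; `none` owns the list of the tree roots. -/
def head (child : ℕ → Option ℕ) (roots : Option ℕ) : Option ℕ → Option ℕ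
  | none => roots
  | some p => child p

/-- The field `child` after `setHead p v`. -/
def childSetHead (p v : Option ℕ) (child : ℕ → Option ℕ) : ℕ → Option ℕ :=
  match p with
  | none => child
  | some q => Function.update child q v

/-- The field `roots` after `setHead p v`. -/
def rootsSetHead (p v roots : Option ℕ) : Option ℕ :=
  match p with
  | none => v
  | some _ => roots

theorem head_setHead (p v q : Option ℕ) (child : ℕ → Option ℕ) (roots : Option ℕ) :
    head (childSetHead p v child) (rootsSetHead p v roots) q =
      if q = p then v else head child roots q := by
  cases p <;> cases q <;> simp [head, childSetHead, rootsSetHead, Function.update_apply]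

theorem getHead_apply (p : Option ℕ) (s : State α) :
    getHead p s = some (head s.child s.roots p, { s with time := s.time + 1 }) := by
  cases p <;> rfl

theorem setHead_apply (p v : Option ℕ) (s : State α) :
    setHead p v s = some ((), { s with
      child := childSetHead p v s.child
      roots := rootsSetHead p v s.roots
      time := s.time + 1 }) := by
  cases p <;> rfl

/-- `l` is a segment of a sibling list with `p` to the left and `e` to the right of it. -/
def Seg (left : ℕ → ℕ) (right : ℕ → Option ℕ) : ℕ → List ℕ → Option ℕ → Prop
  | _, [], _ => True
  | p, c :: l, e => left c = p ∧ right c = l.head?.or e ∧ Seg left right c l e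

/-- `l` is a whole sibling list: `left` is cyclic and `right` is not. -/
def Ring (left : ℕ → ℕ) (right : ℕ → Option ℕ) (l : List ℕ) : Prop :=
  Seg left right (l.getLastD 0) l none

theorem update_of_mem {β : Type*} {f : ℕ → β} {l : List ℕ} {x y : ℕ} {v : β} (hx : x ∈ l)
    (hy : y ∉ l) : Function.update f y v x = f x :=
  Function.update_of_ne (fun e : x = y => hy (e ▸ hx)) _ _

theorem getLastD_append_cons {c : ℕ} {B : List ℕ} :
    ∀ {A : List ℕ} {p : ℕ}, (A ++ c :: B).getLastD p = B.getLastD c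
  | [], _ => by rw [List.nil_append, List.getLastD_cons]
  | a :: A, _ => by rw [List.cons_append, List.getLastD_cons, getLastD_append_cons]

section Seg

variable {L L' : ℕ → ℕ} {R R' : ℕ → Option ℕ}

theorem seg_append : ∀ {A B : List ℕ} {p : ℕ} {e : Option ℕ},
    Seg L R p (A ++ B) e ↔ Seg L R p A (B.head?.or e) ∧ Seg L R (A.getLastD p) B e
  | [], B, p, e => by simp [Seg]
  | a :: A, B, p, e => by
    have h1 : (A ++ B).head?.or e = A.head?.or (B.head?.or e) := by cases A <;> simp
    simp only [List.cons_append, Seg, h1, seg_append (A := A), List.getLastD_cons]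
    tauto

theorem Seg.congr : ∀ {l : List ℕ} {p : ℕ} {e : Option ℕ}, Seg L R p l e →
    (∀ x ∈ l, L' x = L x ∧ R' x = R x) → Seg L' R' p l e
  | [], _, _, _, _ => trivial
  | c :: l, p, e, h, hc => by
    refine ⟨?_, ?_, h.2.2.congr fun x hx => hc x (by simp [hx])⟩
    · rw [(hc c (by simp)).1, h.1]
    · rw [(hc c (by simp)).2, h.2.1]

theorem Seg.update_left {y p q : ℕ} {B : List ℕ} {e : Option ℕ} (h : Seg L R p (y :: B) e)
    (hy : y ∉ B) : Seg (Function.update L y q) R q (y :: B) e := by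
  refine ⟨by simp, h.2.1, h.2.2.congr fun x hx => ⟨update_of_mem hx hy, rfl⟩⟩

theorem Seg.update_right {a p : ℕ} {A : List ℕ} {e e' : Option ℕ} (h : Seg L R p (A ++ [a]) e)
    (ha : a ∉ A) : Seg L (Function.update R a e') p (A ++ [a]) e' := by
  rw [seg_append] at h ⊢
  refine ⟨?_, h.2.1, by simp, trivial⟩
  refine Seg.congr (p := p) (e := _) ?_ fun x hx => ⟨rfl, update_of_mem hx ha⟩
  simpa using h.1

theorem Seg.left_mem : ∀ {l : List ℕ} {p : ℕ} {e : Option ℕ}, Seg L R p l e →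
    ∀ x ∈ l, L x = p ∨ L x ∈ l
  | c :: l, p, e, h, x, hx => by
    rcases List.mem_cons.1 hx with rfl | hx
    · exact Or.inl h.1
    · rcases h.2.2.left_mem x hx with h1 | h1
      · exact Or.inr (by simp [h1])
      · exact Or.inr (by simp [h1])

theorem getLastD_mem {l : List ℕ} {p : ℕ} (h : l ≠ []) : l.getLastD p ∈ l := by
  rcases List.eq_nil_or_concat l with rfl | ⟨A, a, rfl⟩
  · exact absurd rfl h
  · simp

theorem Ring.left_mem {l : List ℕ} (h : Ring L R l) {x : ℕ} (hx : x ∈ l) : L x ∈ l := by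
  rcases Seg.left_mem h x hx with h1 | h1
  · rw [h1]
    exact getLastD_mem (List.ne_nil_of_mem hx)
  · exact h1

/-- The pointers of a node in the middle of a list. -/
theorem Ring.pointers {A B : List ℕ} {c : ℕ} (h : Ring L R (A ++ c :: B)) :
    L c = A.getLastD (B.getLastD c) ∧ R c = B.head? := by
  rw [Ring, seg_append] at h
  have h2 := h.2
  simp only [Seg, Option.or_none] at h2
  exact ⟨by rw [h2.1, getLastD_append_cons], h2.2.1⟩

theorem Ring.eq_singleton {l : List ℕ} (h : Ring L R l) (hn : l.Nodup) {x : ℕ} (hx : x ∈ l)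
    (hL : L x = x) : l = [x] := by
  obtain ⟨A, B, rfl⟩ := List.append_of_mem hx
  have h1 := h.pointers.1
  rw [hL] at h1
  simp only [List.nodup_append, List.nodup_cons] at hn
  rcases List.eq_nil_or_concat A with rfl | ⟨A, a, rfl⟩
  · rcases List.eq_nil_or_concat B with rfl | ⟨B, b, rfl⟩
    · rfl
    · simp at h1
      simp [h1] at hn
  · simp at h1
    simp [h1] at hn
    exact absurd rfl (hn.2.2 a (Or.inr rfl)).1

end Seg

/-- The pointers `child`, `roots`, `left`, `right` represent the forest in which the set of nodes is
`M` and the parent of `c` is `P c`. Only the lists owned by `none` and by nodes of `V` matter. -/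
def Lists (child : ℕ → Option ℕ) (roots : Option ℕ) (left : ℕ → ℕ) (right : ℕ → Option ℕ)
    (V M : Finset ℕ) (P : ℕ → Option ℕ) : Prop :=
  ∀ p : Option ℕ, (∀ x, p = some x → x ∈ V) → ∃ l : List ℕ,
    head child roots p = l.head? ∧ Ring left right l ∧ l.Nodup ∧ ∀ c, c ∈ l ↔ c ∈ M ∧ P c = p

section Lists

variable {child : ℕ → Option ℕ} {roots : Option ℕ} {left : ℕ → ℕ} {right : ℕ → Option ℕ}
  {V M : Finset ℕ} {P : ℕ → Option ℕ}

/-- Replacing the list of one owner. -/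
theorem Lists.replace (h : Lists child roots left right V M P) (p : Option ℕ) {v : Option ℕ}
    {left' : ℕ → ℕ} {right' : ℕ → Option ℕ} {M' : Finset ℕ} {P' : ℕ → Option ℕ} (l' : List ℕ)
    (hv : v = l'.head?) (hr : Ring left' right' l') (hn : l'.Nodup)
    (hm : ∀ c, c ∈ l' ↔ c ∈ M' ∧ P' c = p)
    (hq : ∀ q ≠ p, ∀ c, (c ∈ M' ∧ P' c = q) ↔ (c ∈ M ∧ P c = q))
    (hf : ∀ c ∈ M, P c ≠ p → left' c = left c ∧ right' c = right c) :
    Lists (childSetHead p v child) (rootsSetHead p v roots) left' right' V M' P' := by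
  intro q hqV
  rw [head_setHead]
  split_ifs with hqp
  · subst hqp
    exact ⟨l', hv, hr, hn, hm⟩
  · obtain ⟨l, h1, h2, h3, h4⟩ := h q hqV
    refine ⟨l, h1, Seg.congr h2 fun x hx => ?_, h3, fun c => by rw [hq q hqp, h4]⟩
    obtain ⟨h5, h6⟩ := (h4 x).1 hx
    exact hf x h5 (h6 ▸ hqp)

theorem setHead_self (p : Option ℕ) (v : Option ℕ) (hv : v = head child roots p) :
    childSetHead p v child = child ∧ rootsSetHead p v roots = roots := by
  subst hv
  cases p <;> simp [childSetHead, rootsSetHead, head]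

theorem removeFrom_spec {s : State α} {c : ℕ} {p : Option ℕ}
    (h : Lists s.child s.roots s.left s.right V M P) (hc : c ∈ M) (hp : P c = p)
    (hpV : ∀ x, p = some x → x ∈ V) :
    ∃ child roots left right t, removeFrom p c s = some ((), { s with
        child := child, roots := roots, left := left, right := right, time := t }) ∧
      t ≤ s.time + 8 ∧ Lists child roots left right V (M.erase c) P := by
  obtain ⟨l, h1, h2, h3, h4⟩ := h p hpV
  obtain ⟨A, B, rfl⟩ := List.append_of_mem ((h4 c).2 ⟨hc, hp⟩)
  obtain ⟨hl, hr⟩ := h2.pointers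
  have hm : ∀ d, d ∈ A ++ B ↔ d ∈ M.erase c ∧ P d = p := by
    intro d
    rw [Finset.mem_erase, and_assoc, ← h4 d]
    simp only [List.mem_append, List.mem_cons]
    have : c ∉ A ∧ c ∉ B := by
      simp only [List.nodup_append, List.nodup_cons, List.mem_cons] at h3
      exact ⟨fun h => h3.2.2 c h c (by simp) rfl, h3.2.1.1⟩
    constructor
    · rintro (h | h)
      · exact ⟨fun e => this.1 (e ▸ h), Or.inl h⟩
      · exact ⟨fun e => this.2 (e ▸ h), Or.inr (Or.inr h)⟩
    · tauto
  have hq : ∀ q ≠ p, ∀ d, (d ∈ M.erase c ∧ P d = q) ↔ (d ∈ M ∧ P d = q) := by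
    intro q hqp d
    rw [Finset.mem_erase]
    constructor
    · tauto
    · rintro ⟨h5, h6⟩
      exact ⟨⟨fun e => hqp (by rw [← h6, e, hp]), h5⟩, h6⟩
  have hn : (A ++ B).Nodup := h3.sublist (by simp)
  have hmem : ∀ {d}, d ∈ A ++ B → P d = p := fun hd => ((hm _).1 hd).2
  have hne : ∀ {d}, d ∈ A ++ B → ∀ e, P e ≠ p → e ≠ d := by
    rintro d hd e he rfl
    exact he (hmem hd)
  rw [Ring, seg_append] at h2
  rcases List.eq_nil_or_concat A with rfl | ⟨A, a, rfl⟩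
  · rcases B with _ | ⟨y, B⟩
    · refine ⟨_, _, _, _, s.time + 1 + 1 + 1 + 1, ?_, ?_, h.replace p [] (v := none) rfl trivial hn hm hq
        fun d _ _ => ⟨rfl, rfl⟩⟩
      · simp only [removeFrom, getLeft, getRight, bind_apply, rd_apply, getHead_apply, hr, hl, h1,
          Option.bind_some, List.nil_append, List.head?_cons, if_true, setHead_apply, pure_apply,
          List.head?_nil]
      · simp
    · refine ⟨_, _, _, _, s.time + 1 + 1 + 1 + 1 + 1, ?_, ?_, h.replace p (y :: B) (v := some y)
        (left' := Function.update s.left y (B.getLastD y)) rfl ?_ hn hm hq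
        fun d _ hd => ⟨Function.update_of_ne (hne (by simp) d hd) _ _, rfl⟩⟩
      · simp only [removeFrom, getLeft, getRight, bind_apply, rd_apply, getHead_apply, hr, hl, h1,
          Option.bind_some, List.nil_append, List.head?_cons, if_true, setHead_apply,
          setLeft, wr_apply, List.getLastD_nil, List.getLastD_cons]
      · simp
      · rw [Ring, List.getLastD_cons]
        exact Seg.update_left h2.2.2.2 (by simpa using (List.nodup_cons.1 hn).1)
  · have hA : head s.child s.roots p ≠ some c := by
      rw [h1]
      intro h5
      have : c ∈ A ++ [a] := by
        rcases A with _ | ⟨b, A⟩ <;> simp_all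
      simp only [List.nodup_append] at h3
      exact h3.2.2 c (by simpa using this) c (by simp) rfl
    have haA : a ∉ A := by
      simp only [List.concat_eq_append, List.nodup_append] at h3
      intro h6
      exact h3.1.2.2 a h6 a (by simp) rfl
    have hl' : s.left c = a := by rw [hl]; simp
    simp only [List.concat_eq_append] at *
    rcases B with _ | ⟨y, B⟩
    · obtain ⟨b, T, hb⟩ : ∃ b T, A ++ [a] = b :: T := by
        rcases A with _ | ⟨b, A⟩ <;> simp
      have hhd : head s.child s.roots p = some b := by rw [h1, hb]; rfl
      obtain ⟨e1, e2⟩ := setHead_self (child := s.child) (roots := s.roots) p _ rfl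
      have hL := h.replace p (v := head s.child s.roots p) (A ++ [a])
        (left' := Function.update s.left b a) (right' := Function.update s.right a none)
        (by rw [hhd, hb]; rfl) ?_ (by simpa using hn) (by simpa using hm) hq
        fun d _ hd => ⟨Function.update_of_ne (hne (by simp [hb]) d hd) _ _,
          Function.update_of_ne (hne (by simp) d hd) _ _⟩
      · rw [e1, e2] at hL
        refine ⟨_, _, _, _, s.time + 1 + 1 + 1 + 1 + 1, ?_, ?_, hL⟩
        · simp only [removeFrom, getLeft, getRight, bind_apply, rd_apply, getHead_apply, hr, hl',
            hhd, Option.bind_some, if_neg (hhd ▸ hA), setRight, setLeft, wr_apply,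
            List.head?_nil, target_some]
        · simp
      · have h5 := Seg.update_right (e' := none) h2.1 haA
        rw [Ring]
        rw [hb] at h5 hn ⊢
        rw [show (b :: T).getLastD 0 = a by rw [← hb]; simp]
        exact h5.update_left (by simpa using (List.nodup_cons.1 hn).1)
    · obtain ⟨e1, e2⟩ := setHead_self (child := s.child) (roots := s.roots) p _ rfl
      have hL := h.replace p (v := head s.child s.roots p) (A ++ [a] ++ y :: B)
        (left' := Function.update s.left y a) (right' := Function.update s.right a (some y))
        (by rw [h1]; simp) ?_ hn hm hq
        fun d _ hd => ⟨Function.update_of_ne (hne (by simp) d hd) _ _,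
          Function.update_of_ne (hne (by simp) d hd) _ _⟩
      · rw [e1, e2] at hL
        refine ⟨_, _, _, _, s.time + 1 + 1 + 1 + 1 + 1, ?_, ?_, hL⟩
        · simp only [removeFrom, getLeft, getRight, bind_apply, rd_apply, getHead_apply, hr, hl',
            Option.bind_some, if_neg hA, setRight, setLeft, wr_apply, List.head?_cons]
        · simp
      · have hn' := hn
        rw [List.nodup_append, List.nodup_cons] at hn'
        have hy : y ∉ A ++ [a] := fun h5 => hn'.2.2 y h5 y (by simp) rfl
        have ha : a ∉ y :: B := fun h5 => hn'.2.2 a (by simp) a h5 rfl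
        rw [Ring, seg_append]
        constructor
        · have h5 := Seg.update_right (e' := some y) h2.1 haA
          refine Seg.congr (L := s.left) (R := Function.update s.right a (some y)) ?_ fun x hx =>
            ⟨update_of_mem hx hy, rfl⟩
          simpa using h5
        · have h5 := h2.2.2.2
          have h6 := Seg.update_left (q := a) h5 hn'.2.1.1
          refine Seg.congr (L := Function.update s.left y a) (R := s.right) ?_ fun x hx =>
            ⟨rfl, update_of_mem hx ha⟩
          simpa using h6

theorem addLeftmost_spec {s : State α} {c : ℕ} {p : Option ℕ}
    (h : Lists s.child s.roots s.left s.right V (M.erase c) P) (hc : c ∈ M)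
    (hpV : ∀ x, p = some x → x ∈ V) :
    ∃ child roots left right t, addLeftmost p c s = some ((), { s with
        child := child, roots := roots, left := left, right := right, time := t }) ∧
      t ≤ s.time + 8 ∧
      Lists child roots left right V M (Function.update P c p) := by
  obtain ⟨l, h1, h2, h3, h4⟩ := h p hpV
  have hcl : c ∉ l := fun h5 => by simpa using ((h4 c).1 h5).1
  have hm : ∀ d, d ∈ c :: l ↔ d ∈ M ∧ Function.update P c p d = p := by
    intro d
    by_cases hd : d = c
    · simp [hc, hd]
    · simp [hd, h4 d]
  have hq : ∀ q ≠ p, ∀ d, (d ∈ M ∧ Function.update P c p d = q) ↔ (d ∈ M.erase c ∧ P d = q) := by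
    intro q hqp d
    by_cases hd : d = c
    · subst hd
      simp [hqp.symm]
    · simp [hd]
  have hn : (c :: l).Nodup := List.nodup_cons.2 ⟨hcl, h3⟩
  have hne : ∀ d ∈ M.erase c, P d ≠ p → d ≠ c ∧ d ∉ l :=
    fun d hd hdp => ⟨Finset.ne_of_mem_erase hd, fun e => hdp ((h4 d).1 e).2⟩
  rcases l with _ | ⟨b, T⟩
  · refine ⟨_, _, _, _, s.time + 1 + 1 + 1 + 1, ?_, ?_, h.replace p [c] (v := some c)
      (left' := Function.update s.left c c) (right' := Function.update s.right c none) rfl ?_ hn hm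
      hq fun d hd hdp => ⟨Function.update_of_ne (hne d hd hdp).1 _ _,
        Function.update_of_ne (hne d hd hdp).1 _ _⟩⟩
    · simp only [addLeftmost, bind_apply, getHead_apply, h1, Option.bind_some, List.head?_nil,
        setHead_apply, setLeft, setRight, wr_apply]
    · simp
    · simp [Ring, Seg]
  · have hcb : b ≠ c := fun e => hcl (by simp [e])
    refine ⟨_, _, _, _, s.time + 1 + 1 + 1 + 1 + 1 + 1, ?_, ?_, h.replace p (c :: b :: T) (v := some c)
      (left' := Function.update (Function.update s.left c (T.getLastD b)) b c)
      (right' := Function.update s.right c (some b)) rfl ?_ hn hm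
      hq fun d hd hdp => ⟨?_, Function.update_of_ne (hne d hd hdp).1 _ _⟩⟩
    · have h5 : s.left b = T.getLastD b := by rw [h2.1, List.getLastD_cons]
      simp only [addLeftmost, bind_apply, getHead_apply, h1, Option.bind_some, List.head?_cons,
        setHead_apply, setLeft, setRight, wr_apply, getLeft, rd_apply, h5]
    · simp
    · refine ⟨?_, by simp, ?_⟩
      · rw [Function.update_of_ne hcb.symm, Function.update_self, List.getLastD_cons,
          List.getLastD_cons]
      refine Seg.update_left (p := T.getLastD b) ?_ (List.nodup_cons.1 h3).1
      refine Seg.congr (L := s.left) (R := s.right) ?_ fun x hx => ⟨?_, ?_⟩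
      · rw [Ring, List.getLastD_cons] at h2
        exact h2
      · exact update_of_mem hx hcl
      · exact update_of_mem hx hcl
    · have h5 := hne d hd hdp
      rw [Function.update_of_ne (fun e => h5.2 (by simp [e])), Function.update_of_ne h5.1]

end Lists

end

/-! ### Violations, arrays and stacks -/

section

variable {α : Type u}

theorem sum_add_of_eq_off {V : Finset ℕ} {x : ℕ} (hx : x ∈ V) {f g : ℕ → ℕ}
    (h : ∀ y ∈ V, y ≠ x → f y = g y) : ∑ y ∈ V, f y + g x = ∑ y ∈ V, g y + f x := by
  rw [← Finset.add_sum_erase V f hx, ← Finset.add_sum_erase V g hx,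
    Finset.sum_congr rfl fun y hy => h y (Finset.mem_of_mem_erase hy) (Finset.ne_of_mem_erase hy)]
  ring

/-- `1` if `x` is the entry of `R[X]` at its rank, and `0` otherwise. -/
def inArr (arr : Kind → ℕ → Option ℕ) (rank : ℕ → ℕ) (X : Kind) (x : ℕ) : ℕ :=
  if arr X (rank x) = some x then 1 else 0

theorem inArr_le_one {arr : Kind → ℕ → Option ℕ} {rank : ℕ → ℕ} {X : Kind} {x : ℕ} :
    inArr arr rank X x ≤ 1 := by
  unfold inArr
  split_ifs <;> simp

theorem inArr_eq_zero {arr : Kind → ℕ → Option ℕ} {rank : ℕ → ℕ} {X : Kind} {x : ℕ}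
    (h : ∀ r, arr X r ≠ some x) : inArr arr rank X x = 0 := if_neg (h _)

/-- The part of `Φ_X` that comes from losses beyond the first one. -/
def excessLoss (loss : ℕ → ℕ) (V : Finset ℕ) : Kind → ℤ
  | .A => 0
  | .L => 4 * ((∑ x ∈ V, (loss x - 1) : ℕ) : ℤ)

/-- The losses that are possible for a node of a given subtype. -/
def LossOK : Sub → ℕ → Prop
  | .A, l => l = 0
  | .L1, l => l = 1
  | .L2, l => 2 ≤ l
  | .N, l => l = 0

theorem lossOK_startLoss (S : Sub) : LossOK S S.startLoss := by
  cases S <;> simp [LossOK, Sub.startLoss]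

/-- The bookkeeping of violations for the nodes in `V`: array entries are up to date, each violation
outside of `T` is in its array or on its stack, and `phi` holds the potentials. Nodes in `T` are
those that a running reduction has taken from their array or stack. -/
structure Viol (rank : ℕ → ℕ) (sub : ℕ → Sub) (loss : ℕ → ℕ) (arr : Kind → ℕ → Option ℕ)
    (stk : Kind → List ℕ) (phi : Kind → ℤ) (V : Finset ℕ) (T : Set ℕ) : Prop where
  arr_spec : ∀ X r x, arr X r = some x →
    x ∈ V ∧ rank x = r ∧ sub x ≠ .L2 ∧ (sub x).kind = some X
  on_stk : ∀ X, ∀ x ∈ V, x ∉ T → (sub x).kind = some X → arr X (rank x) = some x ∨ x ∈ stk X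
  stk_spec : ∀ X, ∀ x ∈ stk X, x ∈ V ∨ sub x = .N
  loss_ok : ∀ x ∈ V, LossOK (sub x) (loss x)
  phi_eq : ∀ X, phi X = X.arrWeight * ((∑ x ∈ V, inArr arr rank X x : ℕ) : ℤ) +
    X.stkWeight * ((stk X).length : ℤ) + excessLoss loss V X

/-- The array after the entry `r` of `R[X]` has been set to `v`. -/
def arrSet (arr : Kind → ℕ → Option ℕ) (X : Kind) (r : ℕ) (v : Option ℕ) : Kind → ℕ → Option ℕ :=
  Function.update arr X (Function.update (arr X) r v)

theorem arrSet_apply (arr : Kind → ℕ → Option ℕ) (X : Kind) (r : ℕ) (v : Option ℕ) (Y : Kind)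
    (r' : ℕ) : arrSet arr X r v Y r' = if Y = X ∧ r' = r then v else arr Y r' := by
  unfold arrSet
  by_cases h : Y = X
  · subst h
    by_cases h' : r' = r <;> simp [h']
  · simp [h]

section Viol

variable {rank : ℕ → ℕ} {sub : ℕ → Sub} {loss : ℕ → ℕ} {arr : Kind → ℕ → Option ℕ}
  {stk : Kind → List ℕ} {phi : Kind → ℤ} {V : Finset ℕ} {T T' : Set ℕ} {X : Kind} {x r : ℕ}

theorem Viol.not_mem_arr (h : Viol rank sub loss arr stk phi V T)
    (hx : ∀ X, (sub x).kind = some X → arr X (rank x) ≠ some x) (X : Kind) (r : ℕ) :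
    arr X r ≠ some x := by
  intro h1
  obtain ⟨-, rfl, -, h2⟩ := h.arr_spec X r x h1
  exact hx X h2 h1

/-- Nodes in `T` that are in their array or on their stack again can be taken out of `T`. -/
theorem Viol.drop (h : Viol rank sub loss arr stk phi V T)
    (hx : ∀ y ∈ T, y ∉ T' → y ∈ V → ∀ X, (sub y).kind = some X → arr X (rank y) = some y ∨ y ∈ stk X) :
    Viol rank sub loss arr stk phi V T' where
  arr_spec := h.arr_spec
  on_stk X y hy hyT hk := by
    by_cases hT : y ∈ T
    · exact hx y hT hyT hy X hk
    · exact h.on_stk X y hy hT hk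
  stk_spec := h.stk_spec
  loss_ok := h.loss_ok
  phi_eq := h.phi_eq

theorem Viol.clearArr (h : Viol rank sub loss arr stk phi V T) (hr : arr X r = some x) :
    Viol rank sub loss (arrSet arr X r none) stk
      (Function.update phi X (phi X + X.arrWeight * (occupied none - occupied (arr X r)))) V
      (Insert.insert x T) where
  arr_spec Y r' y hy := by
    rw [arrSet_apply] at hy
    split_ifs at hy with h1
    exact h.arr_spec Y r' y hy
  on_stk Y y hy hyT hk := by
    rw [Set.mem_insert_iff, not_or] at hyT
    refine (h.on_stk Y y hy hyT.2 hk).imp_left fun h1 => ?_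
    rw [arrSet_apply, if_neg, h1]
    rintro ⟨rfl, h2⟩
    rw [h2, hr] at h1
    exact hyT.1 (Option.some.inj h1).symm
  stk_spec := h.stk_spec
  loss_ok := h.loss_ok
  phi_eq Y := by
    obtain ⟨hxV, hrk, -, hk⟩ := h.arr_spec X r x hr
    by_cases hY : Y = X
    · subst hY
      have h1 := sum_add_of_eq_off hxV (f := inArr (arrSet arr Y r none) rank Y)
        (g := inArr arr rank Y) (by
          intro y _ hyx
          simp only [inArr, arrSet_apply, true_and]
          by_cases h2 : rank y = r
          · simp only [h2, if_true, hr]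
            rw [if_neg (by simp), if_neg (by simpa using hyx.symm)]
          · simp [h2])
      have h2 : inArr arr rank Y x = 1 := by simp [inArr, hrk, hr]
      have h3 : inArr (arrSet arr Y r none) rank Y x = 0 := by simp [inArr, arrSet_apply, hrk]
      have h4 : (∑ y ∈ V, inArr arr rank Y y) =
        ∑ y ∈ V, inArr (arrSet arr Y r none) rank Y y + 1 := by omega
      rw [Function.update_self, h.phi_eq Y, h4, hr]
      simp only [occupied, Option.isSome_none, Option.isSome_some]
      push_cast
      ring
    · rw [Function.update_of_ne hY, h.phi_eq Y]
      simp [inArr, arrSet_apply, hY]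

theorem Viol.store (h : Viol rank sub loss arr stk phi V T) (hx : x ∈ V)
    (hr : arr X (rank x) = none) (hk : (sub x).kind = some X) (hL : sub x ≠ .L2)
    (hT : ∀ y ∈ T, y = x ∨ y ∈ T') :
    Viol rank sub loss (arrSet arr X (rank x) (some x)) stk
      (Function.update phi X
        (phi X + X.arrWeight * (occupied (some x) - occupied (arr X (rank x))))) V T' where
  arr_spec Y r' y hy := by
    rw [arrSet_apply] at hy
    split_ifs at hy with h1
    · obtain ⟨rfl, rfl⟩ := h1
      obtain rfl := Option.some.inj hy
      exact ⟨hx, rfl, hL, hk⟩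
    · exact h.arr_spec Y r' y hy
  on_stk Y y hy hyT hk' := by
    by_cases hyx : y = x
    · subst hyx
      rw [hk] at hk'
      obtain rfl := Option.some.inj hk'
      simp [arrSet_apply]
    · refine (h.on_stk Y y hy (fun h1 => (hT y h1).elim hyx hyT) hk').imp_left fun h1 => ?_
      rw [arrSet_apply, if_neg, h1]
      rintro ⟨rfl, h2⟩
      rw [h2, hr] at h1
      cases h1
  stk_spec := h.stk_spec
  loss_ok := h.loss_ok
  phi_eq Y := by
    by_cases hY : Y = X
    · subst hY
      have h1 := sum_add_of_eq_off hx (f := inArr (arrSet arr Y (rank x) (some x)) rank Y)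
        (g := inArr arr rank Y) (by
          intro y _ hyx
          simp only [inArr, arrSet_apply, true_and]
          by_cases h2 : rank y = rank x
          · simp only [h2, if_true, hr]
            rw [if_neg (by simpa using hyx.symm), if_neg (by simp)]
          · simp [h2])
      have h2 : inArr arr rank Y x = 0 := by simp [inArr, hr]
      have h3 : inArr (arrSet arr Y (rank x) (some x)) rank Y x = 1 := by
        simp [inArr, arrSet_apply]
      have h4 : (∑ y ∈ V, inArr (arrSet arr Y (rank x) (some x)) rank Y y) =
        ∑ y ∈ V, inArr arr rank Y y + 1 := by omega
      rw [Function.update_self, h.phi_eq Y, h4, hr]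
      simp only [occupied, Option.isSome_none, Option.isSome_some]
      push_cast
      ring
    · rw [Function.update_of_ne hY, h.phi_eq Y]
      simp [inArr, arrSet_apply, hY]

theorem Viol.setSub (h : Viol rank sub loss arr stk phi V T) (hx : x ∈ V) {S : Sub} {l : ℕ}
    (hl : LossOK S l) (ha : ∀ X r, arr X r ≠ some x)
    (hS : x ∈ T ∨ ∀ X, S.kind = some X → x ∈ stk X) :
    Viol rank (Function.update sub x S) (Function.update loss x l) arr stk
      (Function.update phi .L (phi .L +
        Kind.L.stkWeight * (((l - 1 : ℕ) : ℤ) - ((loss x - 1 : ℕ) : ℤ)))) V T where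
  arr_spec X r y hy := by
    have hyx : y ≠ x := fun e => ha X r (e ▸ hy)
    rw [Function.update_of_ne hyx]
    exact h.arr_spec X r y hy
  on_stk X y hy hyT hk := by
    by_cases hyx : y = x
    · subst hyx
      rw [Function.update_self] at hk
      exact Or.inr ((hS.resolve_left hyT) X hk)
    · rw [Function.update_of_ne hyx] at hk
      exact h.on_stk X y hy hyT hk
  stk_spec X y hy := by
    by_cases hyx : y = x
    · exact Or.inl (hyx ▸ hx)
    · rw [Function.update_of_ne hyx]
      exact h.stk_spec X y hy
  loss_ok y hy := by
    by_cases hyx : y = x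
    · subst hyx
      simpa using hl
    · rw [Function.update_of_ne hyx, Function.update_of_ne hyx]
      exact h.loss_ok y hy
  phi_eq X := by
    cases X
    · rw [Function.update_of_ne (by simp), h.phi_eq]
      rfl
    · rw [Function.update_self, h.phi_eq]
      have h1 := sum_add_of_eq_off hx (f := fun y => Function.update loss x l y - 1)
        (g := fun y => loss y - 1) (by
          intro y _ hyx
          simp [hyx])
      simp only [Function.update_self] at h1
      simp only [excessLoss, Kind.stkWeight]
      have h2 : ((∑ y ∈ V, (Function.update loss x l y - 1) : ℕ) : ℤ) + ((loss x - 1 : ℕ) : ℤ) =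
        ((∑ y ∈ V, (loss y - 1) : ℕ) : ℤ) + ((l - 1 : ℕ) : ℤ) := by exact_mod_cast h1
      linarith

theorem Viol.push (h : Viol rank sub loss arr stk phi V T) (hx : x ∈ V) :
    Viol rank sub loss arr (Function.update stk X (x :: stk X))
      (Function.update phi X (phi X + X.stkWeight)) V T where
  arr_spec := h.arr_spec
  on_stk Y y hy hyT hk := (h.on_stk Y y hy hyT hk).imp_right fun h1 => by
    by_cases hY : Y = X
    · subst hY
      simp [h1]
    · simpa [hY] using h1
  stk_spec Y y hy := by
    by_cases hY : Y = X
    · subst hY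
      rw [Function.update_self, List.mem_cons] at hy
      rcases hy with rfl | hy
      · exact Or.inl hx
      · exact h.stk_spec Y y hy
    · rw [Function.update_of_ne hY] at hy
      exact h.stk_spec Y y hy
  loss_ok := h.loss_ok
  phi_eq Y := by
    by_cases hY : Y = X
    · subst hY
      rw [Function.update_self, Function.update_self, h.phi_eq]
      simp only [List.length_cons]
      push_cast
      ring
    · rw [Function.update_of_ne hY, Function.update_of_ne hY, h.phi_eq]

theorem Viol.pop (h : Viol rank sub loss arr stk phi V T) {l : List ℕ} (hl : stk X = x :: l)
    (hT : T ⊆ T') (hx : x ∈ T' ∨ (sub x).kind ≠ some X ∨ arr X (rank x) = some x) :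
    Viol rank sub loss arr (Function.update stk X l)
      (Function.update phi X (phi X - X.stkWeight)) V T' where
  arr_spec := h.arr_spec
  on_stk Y y hy hyT hk := by
    by_cases hyx : Y = X ∧ y = x
    · obtain ⟨rfl, rfl⟩ := hyx
      exact Or.inl ((hx.resolve_left hyT).resolve_left (not_not.2 hk))
    · refine (h.on_stk Y y hy (fun h1 => hyT (hT h1)) hk).imp_right fun h1 => ?_
      by_cases hY : Y = X
      · subst hY
        rw [hl, List.mem_cons] at h1
        simpa using h1.resolve_left fun e => hyx ⟨rfl, e⟩
      · simpa [hY] using h1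
  stk_spec Y y hy := by
    refine h.stk_spec Y y ?_
    by_cases hY : Y = X
    · subst hY
      rw [hl]
      simp at hy
      simp [hy]
    · simpa [hY] using hy
  loss_ok := h.loss_ok
  phi_eq Y := by
    by_cases hY : Y = X
    · subst hY
      rw [Function.update_self, Function.update_self, h.phi_eq, hl]
      simp only [List.length_cons]
      push_cast
      ring
    · rw [Function.update_of_ne hY, Function.update_of_ne hY, h.phi_eq]

theorem Viol.setRank (h : Viol rank sub loss arr stk phi V T) (ha : ∀ X r, arr X r ≠ some x)
    (hS : x ∈ T ∨ ∀ X, (sub x).kind = some X → x ∈ stk X) :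
    Viol (Function.update rank x r) sub loss arr stk phi V T where
  arr_spec X r y hy := by
    have hyx : y ≠ x := fun e => ha X r (e ▸ hy)
    rw [Function.update_of_ne hyx]
    exact h.arr_spec X r y hy
  on_stk X y hy hyT hk := by
    by_cases hyx : y = x
    · subst hyx
      exact Or.inr ((hS.resolve_left hyT) X hk)
    · rw [Function.update_of_ne hyx]
      exact h.on_stk X y hy hyT hk
  stk_spec := h.stk_spec
  loss_ok := h.loss_ok
  phi_eq X := by
    rw [h.phi_eq, Finset.sum_congr rfl fun y _ => ?_]
    by_cases hyx : y = x
    · subst hyx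
      simp [inArr, ha]
    · simp [inArr, hyx]

theorem Viol.phi_nonneg (h : Viol rank sub loss arr stk phi V T) (X : Kind) : 0 ≤ phi X := by
  rw [h.phi_eq]
  cases X <;> simp only [Kind.arrWeight, Kind.stkWeight, excessLoss] <;> positivity

end Viol

/-- The first part of `setViolationSubtype`: takes `x` out of its array, and returns the kind of the
stack that is known to contain `x`. -/
def takeFromArray (taken : Bool) (x : ℕ) (O : Sub) : Prog α (Option Kind) :=
  match O.kind with
  | none => pure none
  | some X => do
    let r ← getRank x
    let y ← getArr X r
    if y = some x then
      setArr X r none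
      pure none
    else
      pure (if taken then none else some X)

theorem setViolationSubtype_eq (taken : Bool) (x : ℕ) (S : Sub) (s : State α) :
    setViolationSubtype taken x S s = (takeFromArray taken x (s.sub x)
      { s with time := s.time + 1 }).bind fun r =>
        (setSubLoss x S S.startLoss >>= fun _ => match S.kind with
          | none => pure ()
          | some Y => if r.1 = some Y then pure () else push Y x) r.2 := rfl

section Spec

variable {V : Finset ℕ} {T : Set ℕ} {x : ℕ} {s : State α}

theorem takeFromArray_spec (h : Viol s.rank s.sub s.loss s.arr s.stk s.phi V T) (taken : Bool) :
    ∃ (k : Option Kind) (arr : Kind → ℕ → Option ℕ) (phi : Kind → ℤ) (t o : ℕ),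
      takeFromArray taken x (s.sub x) s = some (k, { s with
        arr := arr, phi := phi, time := t, overhead := o }) ∧ t ≤ s.time + 3 ∧
      Viol s.rank s.sub s.loss arr s.stk phi V (Insert.insert x T) ∧
      (∀ X r z, arr X r = some z ↔ s.arr X r = some z ∧ z ≠ x) ∧
      (∀ X, phi X = s.phi X - X.arrWeight * (inArr s.arr s.rank X x : ℕ)) ∧
      o = s.overhead + inArr s.arr s.rank .A x + inArr s.arr s.rank .L x ∧
      (∀ Y, k = some Y ↔ (s.sub x).kind = some Y ∧ taken = false ∧ inArr s.arr s.rank Y x = 0) := by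
  by_cases hin : ∃ X, (s.sub x).kind = some X ∧ s.arr X (s.rank x) = some x
  · obtain ⟨X, hk, ha⟩ := hin
    have hne : ∀ Y ≠ X, ∀ r, s.arr Y r ≠ some x := by
      intro Y hY r h1
      have h2 := (h.arr_spec Y r x h1).2.2.2
      rw [hk] at h2
      exact hY (Option.some.inj h2).symm
    have h1 : inArr s.arr s.rank X x = 1 := by simp [inArr, ha]
    have h0 : ∀ Y ≠ X, inArr s.arr s.rank Y x = 0 := fun Y hY => inArr_eq_zero (hne Y hY)
    refine ⟨none, arrSet s.arr X (s.rank x) none, _, s.time + 1 + 1 + 1, s.overhead + 1, ?_, le_rfl,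
      h.clearArr ha, ?_, ?_, ?_, ?_⟩
    · simp only [takeFromArray, hk, bind_apply, getRank, getArr, rd_apply, Option.bind_some, ha,
        if_true, setArr, wr_apply, pure_apply]
      rfl
    · intro Y r z
      rw [arrSet_apply]
      split_ifs with h2
      · obtain ⟨rfl, rfl⟩ := h2
        simp only [false_iff, not_and, not_not]
        intro h3
        rw [ha] at h3
        exact (Option.some.inj h3).symm
      · refine ⟨fun h3 => ⟨h3, ?_⟩, And.left⟩
        rintro rfl
        by_cases hY : Y = X
        · subst hY
          exact h2 ⟨rfl, (h.arr_spec Y r z h3).2.1.symm⟩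
        · exact hne Y hY r h3
    · intro Y
      by_cases hY : Y = X
      · subst hY
        rw [Function.update_self, h1, ha]
        simp [occupied]
        ring
      · rw [Function.update_of_ne hY, h0 Y hY]
        simp
    · cases X
      · rw [h1, h0 .L (by simp)]
      · rw [h1, h0 .A (by simp)]
    · intro Y
      simp only [reduceCtorEq, hk, Option.some.injEq, false_iff, not_and]
      rintro rfl -
      omega
  · have hne := h.not_mem_arr (x := x) fun X h1 h2 => hin ⟨X, h1, h2⟩
    have h0 : ∀ X, inArr s.arr s.rank X x = 0 := fun X => inArr_eq_zero (hne X)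
    have hrun : ∃ t, t ≤ s.time + 3 ∧ takeFromArray taken x (s.sub x) s =
        some (if taken then none else (s.sub x).kind, { s with time := t }) := by
      rcases hk : (s.sub x).kind with _ | X
      · refine ⟨s.time, by simp, ?_⟩
        simp [takeFromArray, hk, pure_apply]
      · refine ⟨s.time + 1 + 1, by simp, ?_⟩
        simp only [takeFromArray, hk, bind_apply, getRank, getArr, rd_apply, Option.bind_some,
          if_neg (hne X _), pure_apply]
    obtain ⟨t, ht, hrun⟩ := hrun
    refine ⟨_, s.arr, s.phi, t, s.overhead, hrun, ht, ?_, ?_, ?_, ?_, ?_⟩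
    · exact h.drop fun y hy hyT => absurd (Set.mem_insert_of_mem _ hy) hyT
    · exact fun X r z => ⟨fun h1 => ⟨h1, fun e => hne X r (e ▸ h1)⟩, And.left⟩
    · simp [h0]
    · simp [h0]
    · intro Y
      cases taken <;> simp [h0]

/-- `p` is the number of pushes. It is `0` if `x` is known to be on its stack, and `1` if `x` was in its
array and gets a violation subtype again. -/
theorem setViolationSubtype_spec (h : Viol s.rank s.sub s.loss s.arr s.stk s.phi V T) (hx : x ∈ V)
    {taken : Bool} {S : Sub} (hT : S.kind ≠ none → (s.sub x).kind = S.kind → (taken = true ↔ x ∈ T)) :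
    ∃ (arr : Kind → ℕ → Option ℕ) (stk : Kind → List ℕ) (phi : Kind → ℤ) (t o p : ℕ),
      setViolationSubtype taken x S s = some ((), { s with
        sub := Function.update s.sub x S, loss := Function.update s.loss x S.startLoss,
        arr := arr, stk := stk, phi := phi, time := t, overhead := o }) ∧ t ≤ s.time + 6 ∧
      Viol s.rank (Function.update s.sub x S) (Function.update s.loss x S.startLoss) arr stk phi V
        (T \ {x}) ∧
      (∀ X r z, arr X r = some z ↔ s.arr X r = some z ∧ z ≠ x) ∧
      (∀ X, S.kind = some X → x ∈ stk X) ∧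
      p ≤ 1 ∧
      (S.kind = none → p = 0) ∧
      (∀ X, taken = false → (s.sub x).kind = some X → S.kind = some X →
        inArr s.arr s.rank X x = 0 → p = 0) ∧
      (∀ X, (s.sub x).kind = some X → S.kind ≠ none → inArr s.arr s.rank X x = 1 → p = 1) ∧
      (∀ X, stk X = if S.kind = some X ∧ p = 1 then x :: s.stk X else s.stk X) ∧
      (phi .A = s.phi .A - inArr s.arr s.rank .A x + if S.kind = some .A then 2 * (p : ℤ) else 0) ∧
      (phi .L = s.phi .L - 3 * inArr s.arr s.rank .L x + (if S.kind = some .L then 4 * (p : ℤ) else 0)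
        + 4 * (((S.startLoss - 1 : ℕ) : ℤ) - ((s.loss x - 1 : ℕ) : ℤ))) ∧
      o = s.overhead + inArr s.arr s.rank .A x + inArr s.arr s.rank .L x + p := by
  obtain ⟨k, arr, phi, t, o, hrun, ht, hv, harr, hphi, ho, hk⟩ :=
    takeFromArray_spec (x := x) (s := { s with time := s.time + 1 }) h taken
  dsimp only at hrun ht hv harr hphi ho hk
  have ha : ∀ X r, arr X r ≠ some x := fun X r h1 => ((harr X r x).1 h1).2 rfl
  have hphiA := hphi .A
  have hphiL := hphi .L
  simp only [Kind.arrWeight] at hphiA hphiL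
  have hv2 := hv.setSub hx (lossOK_startLoss S) ha (Or.inl (Set.mem_insert x T))
  rw [setViolationSubtype_eq, hrun]
  simp only [Option.bind_some]
  have hdrop : ∀ y ∈ Insert.insert x T, y ∉ T \ {x} → y = x := by
    intro y h1 h2
    by_contra hyx
    exact h2 ⟨(Set.mem_insert_iff.1 h1).resolve_left hyx, hyx⟩
  rcases hS : S.kind with _ | Y
  · refine ⟨arr, s.stk, _, t + 1, _, 0, ?run, ?_, hv2.drop ?_, harr, by simp, by simp, by simp, by simp,
      by simp, by simp, ?_, ?_, ho⟩
    case run =>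
      simp only [bind_apply, setSubLoss, wr_apply, Option.bind_some, pure_apply]
    · omega
    · intro y h1 h2 h3 X hkX
      rw [hdrop y h1 h2, Function.update_self, hS] at hkX
      cases hkX
    · rw [Function.update_of_ne (by simp), hphiA]
      simp
    · rw [Function.update_self, hphiL]
      simp [Kind.stkWeight]
  · by_cases hkY : k = some Y
    · obtain ⟨hk1, hk2, hk3⟩ := (hk Y).1 hkY
      have hxs : x ∈ s.stk Y := by
        have hxT : x ∉ T := fun h1 => by
          have := (hT (by simp [hS]) (by rw [hS, hk1])).2 h1
          simp [hk2] at this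
        refine (h.on_stk Y x hx hxT hk1).resolve_left fun h1 => ?_
        simp [inArr, h1] at hk3
      refine ⟨arr, s.stk, _, t + 1, _, 0, ?run2, ?_, hv2.drop ?_, harr, ?_, by simp, by simp, by simp,
        ?_, by simp, ?_, ?_, ho⟩
      case run2 =>
        simp only [bind_apply, setSubLoss, wr_apply, Option.bind_some, pure_apply, if_pos hkY]
      · omega
      · intro y h1 h2 h3 X hkX
        rw [hdrop y h1 h2, Function.update_self, hS] at hkX
        obtain rfl := Option.some.inj hkX
        rw [hdrop y h1 h2]
        exact Or.inr hxs
      · rintro X h1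
        obtain rfl := Option.some.inj h1
        exact hxs
      · rintro X h1 - h2
        rw [hk1] at h1
        obtain rfl := Option.some.inj h1
        omega
      · rw [Function.update_of_ne (by simp), hphiA]
        simp
      · rw [Function.update_self, hphiL]
        simp [Kind.stkWeight]
    · have hv3 := hv2.push (X := Y) hx
      refine ⟨arr, _, _, t + 1 + 1, o + 1, 1, ?run3, ?_, hv3.drop ?_, harr, ?_, by simp, by simp, ?_,
        by simp, ?_, ?_, ?_, ?_⟩
      case run3 =>
        simp only [bind_apply, setSubLoss, wr_apply, Option.bind_some, DKHeap.push, if_neg hkY]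
      · omega
      · intro y h1 h2 h3 X hkX
        rw [hdrop y h1 h2, Function.update_self, hS] at hkX
        obtain rfl := Option.some.inj hkX
        rw [hdrop y h1 h2]
        exact Or.inr (by simp)
      · rintro X h1
        obtain rfl := Option.some.inj h1
        simp
      · rintro X h1 h2 h3 h4
        obtain rfl := Option.some.inj h3
        exact absurd ((hk Y).2 ⟨h2, h1, h4⟩) hkY
      · intro X
        by_cases hX : X = Y
        · subst hX
          simp
        · simp [hX, Ne.symm hX]
      · cases Y
        · rw [Function.update_self, Function.update_of_ne (by simp), hphiA]
          simp [Kind.stkWeight]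
        · rw [Function.update_of_ne (by simp), Function.update_of_ne (by simp), hphiA]
          simp
      · cases Y
        · rw [Function.update_of_ne (by simp), Function.update_self, hphiL]
          simp [Kind.stkWeight]
        · rw [Function.update_self, Function.update_self, hphiL]
          simp [Kind.stkWeight]
          ring
      · rw [ho]

/-- The subtype after `decrementRank`. -/
def decSub : Sub → Sub
  | .A => .A
  | .N => .L1
  | .L1 => .L2
  | .L2 => .L2

/-- The loss after `decrementRank`. -/
def decLoss (S : Sub) (l : ℕ) : ℕ := if S = .A then 0 else l + 1

/-- The possible changes of `Φ_A`, `Φ_L` and the overhead in `decrementRank`: a node of subtype `A`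
moves from its array to its stack or stays on the stack, a node of subtype `L1` moves from its array
to its stack, or the node gains loss otherwise. -/
def DecDelta (dA dL : ℤ) (o o' : ℕ) : Prop :=
  (dL = 0 ∧ 0 ≤ dA ∧ dA ≤ 1 ∧ o ≤ o' ∧ (o' : ℤ) ≤ o + 2 * dA) ∨ (dL = 5 ∧ dA = 0 ∧ o' = o + 2) ∨
    (dL = 4 ∧ dA = 0 ∧ o ≤ o' ∧ o' ≤ o + 1)

/-- A node of subtype `L2` is not in an array, hence on the stack, so that its violation needs no
update when it gains loss. -/
theorem decrementRank_spec (h : Viol s.rank s.sub s.loss s.arr s.stk s.phi V T) (hx : x ∈ V)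
    (hT : x ∉ T) :
    ∃ (arr : Kind → ℕ → Option ℕ) (stk : Kind → List ℕ) (phi : Kind → ℤ) (t o : ℕ),
      decrementRank x s = some ((), { s with
        rank := Function.update s.rank x (s.rank x - 1),
        sub := Function.update s.sub x (decSub (s.sub x)),
        loss := Function.update s.loss x (decLoss (s.sub x) (s.loss x)),
        arr := arr, stk := stk, phi := phi, time := t, overhead := o }) ∧ t ≤ s.time + 9 ∧
      Viol (Function.update s.rank x (s.rank x - 1)) (Function.update s.sub x (decSub (s.sub x)))
        (Function.update s.loss x (decLoss (s.sub x) (s.loss x))) arr stk phi V T ∧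
      (∀ X r z, arr X r = some z → s.arr X r = some z) ∧
      (s.sub x ≠ .A → stk .A = s.stk .A) ∧
      DecDelta (phi .A - s.phi .A) (phi .L - s.phi .L) s.overhead o := by
  have hTx : T \ {x} = T := by simp [hT]
  by_cases h2 : s.sub x = .L2
  · have hl := h.loss_ok x hx
    rw [h2] at hl
    have ha := h.not_mem_arr (x := x) fun X _ h3 => (h.arr_spec X _ x h3).2.2.1 h2
    have hst : x ∈ s.stk .L := (h.on_stk .L x hx hT (by simp [h2, Sub.kind])).resolve_left (ha _ _)
    have hS : ∀ X, Sub.L2.kind = some X → x ∈ s.stk X := by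
      rintro X h3
      obtain rfl := Option.some.inj h3
      exact hst
    have hv := (h.setSub hx (S := .L2) (l := s.loss x + 1) (Nat.le_succ_of_le hl) ha
      (Or.inr hS)).setRank (r := s.rank x - 1) ha (Or.inr (by simpa using hS))
    have hl1 : decLoss (s.sub x) (s.loss x) = s.loss x + 1 := by simp [decLoss, h2]
    have hl2 : decSub (s.sub x) = .L2 := by simp [decSub, h2]
    rw [hl1, hl2]
    refine ⟨s.arr, s.stk, _, s.time + 1 + 1 + 1 + 1, s.overhead, ?_, by simp, hv, by simp, by simp,
      ?_⟩
    · simp only [decrementRank, bind_apply, getSub, rd_apply, h2, Option.bind_some, incLoss,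
        setSubLoss, wr_apply, getRank, DKHeap.setRank]
    · right; right
      change 2 ≤ s.loss x at hl
      refine ⟨?_, by simp, le_rfl, by simp⟩
      simp only [Function.update_self, Kind.stkWeight]
      omega
  · have hspec := setViolationSubtype_spec (s := { s with time := s.time + 1 }) h hx
      (taken := false) (S := decSub (s.sub x)) (fun _ _ => by simp [hT])
    obtain ⟨arr, stk, phi, t, o, p, hrun, ht, hv, harr, hst, hp, hp0, hp1, hp2, hstk, hA, hL, ho⟩ := hspec
    dsimp only at hrun ht hv harr hstk hA hL ho hp1 hp2
    have ha : ∀ X r, arr X r ≠ some x := fun X r h1 => ((harr X r x).1 h1).2 rfl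
    rw [hTx] at hv
    have hv2 := hv.setRank (r := s.rank x - 1) ha (Or.inr (by simpa using hst))
    have hlo := h.loss_ok x hx
    have hl1 : (decSub (s.sub x)).startLoss = decLoss (s.sub x) (s.loss x) := by
      cases hs : s.sub x <;> simp_all [decSub, decLoss, Sub.startLoss, LossOK]
    have hrun2 : decrementRank x s = (setViolationSubtype false x (decSub (s.sub x))
        { s with time := s.time + 1 }).bind fun r =>
          (getRank x >>= fun r => setRank x (r - 1)) r.2 := by
      cases hs : s.sub x <;> first | exact absurd hs h2 | simp only [decrementRank, bind_apply,
        getSub, rd_apply, hs, Option.bind_some, decSub]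
    rw [hl1] at hrun hv2 hL
    refine ⟨arr, stk, phi, t + 1 + 1, o, ?_, ?_, hv2, fun X r z h1 => ((harr X r z).1 h1).1, ?_, ?_⟩
    · rw [hrun2, hrun]
      simp only [Option.bind_some, bind_apply, getRank, DKHeap.setRank, rd_apply, wr_apply]
    · omega
    · intro hsA
      rw [hstk, if_neg]
      cases hs : s.sub x <;> simp_all [decSub, Sub.kind]
    · have hi : ∀ X, (s.sub x).kind ≠ some X → inArr s.arr s.rank X x = 0 := fun X hX =>
        inArr_eq_zero fun r h1 => hX (h.arr_spec X r x h1).2.2.2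
      have hA1 : inArr s.arr s.rank .A x ≤ 1 := inArr_le_one
      have hL1 : inArr s.arr s.rank .L x ≤ 1 := inArr_le_one
      unfold DecDelta
      cases hs : s.sub x
      · have h3 := hi .L (by simp [hs, Sub.kind])
        have h4 := hp1 .A rfl (by simp [hs, Sub.kind]) (by simp [hs, decSub, Sub.kind])
        have h5 := hp2 _ (by rw [hs]; rfl) (by simp [hs, decSub, Sub.kind])
        simp [hs, decSub, decLoss, Sub.kind, LossOK] at hA hL hlo
        rw [hlo] at hL
        omega
      · have h3 := hi .A (by simp [hs, Sub.kind])
        have h4 := hp1 .L rfl (by simp [hs, Sub.kind]) (by simp [hs, decSub, Sub.kind])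
        have h5 := hp2 _ (by rw [hs]; rfl) (by simp [hs, decSub, Sub.kind])
        simp [hs, decSub, decLoss, Sub.kind, LossOK] at hA hL hlo
        rw [hlo] at hL
        omega
      · exact absurd hs h2
      · have h3 := hi .A (by simp [hs, Sub.kind])
        have h5 := hi .L (by simp [hs, Sub.kind])
        simp [hs, decSub, decLoss, Sub.kind, LossOK] at hA hL hlo
        rw [hlo] at hL
        omega

end Spec

end

end DKHeap

/-! ### Pruned trees of smaller and larger rank -/

namespace PrunedBinomial

/-- Without its last children, the root of a binomial tree with losses is the root of one of smaller
rank. -/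
theorem RootIntact.exists_of_le {r : ℕ} {t : PrunedBinomial r} (ht : t.RootIntact) {j : ℕ}
    (hj : j ≤ r) : ∃ t' : PrunedBinomial j, t'.RootIntact ∧ t'.size ≤ t.size ∧
      t'.totalLoss ≤ t.totalLoss := by
  induction t with
  | single =>
    obtain rfl := Nat.le_zero.1 hj
    exact ⟨single, trivial, le_rfl, le_rfl⟩
  | @keep r t c iht ihc =>
    rcases Nat.eq_or_lt_of_le hj with rfl | hj
    · exact ⟨_, ht, le_rfl, le_rfl⟩
    · obtain ⟨t', h1, h2, h3⟩ := iht ht (Nat.le_of_lt_succ hj)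
      exact ⟨t', h1, h2.trans (Nat.le_add_right _ _), h3.trans (Nat.le_add_right _ _)⟩
  | cut t => exact ht.elim

/-- A tree of rank `r` is also a tree of rank `r + k` whose root has lost `k` children. -/
theorem exists_cut {r : ℕ} (t : PrunedBinomial r) (k : ℕ) :
    ∃ t' : PrunedBinomial (r + k), t'.size = t.size ∧ t'.totalLoss = t.totalLoss + k := by
  induction k with
  | zero => exact ⟨t, rfl, rfl⟩
  | succ k ih =>
    obtain ⟨t', h1, h2⟩ := ih
    exact ⟨t'.cut, h1, by simp [totalLoss, h2, add_assoc]⟩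

end PrunedBinomial

namespace DKHeap

/-! ### Heap order and ranks -/

section

variable {α : Type u}

/-- The key of `p` is smaller than the key of `x`, where ties are broken by the addresses. -/
def KeyBelow [LinearOrder α] (key : ℕ → Option α) (p x : ℕ) : Prop :=
  ∃ a b, key p = some a ∧ key x = some b ∧ (a < b ∨ a = b ∧ p < x)

section KeyBelow

variable [LinearOrder α] {key : ℕ → Option α} {x y z : ℕ}

theorem KeyBelow.irrefl : ¬ KeyBelow key x x := by
  rintro ⟨a, b, h1, h2, h3⟩
  rw [h1] at h2
  obtain rfl := Option.some.inj h2
  simp at h3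

theorem KeyBelow.trans (h1 : KeyBelow key x y) (h2 : KeyBelow key y z) : KeyBelow key x z := by
  obtain ⟨a, b, ha, hb, hab⟩ := h1
  obtain ⟨b', c, hb', hc, hbc⟩ := h2
  rw [hb] at hb'
  obtain rfl := Option.some.inj hb'
  refine ⟨a, c, ha, hc, ?_⟩
  rcases hab with h | ⟨rfl, h⟩ <;> rcases hbc with h' | ⟨rfl, h'⟩
  · exact Or.inl (h.trans h')
  · exact Or.inl h
  · exact Or.inl h'
  · exact Or.inr ⟨rfl, h.trans h'⟩

theorem KeyBelow.total (hx : ∃ a, key x = some a) (hy : ∃ a, key y = some a) (hxy : x ≠ y) :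
    KeyBelow key x y ∨ KeyBelow key y x := by
  obtain ⟨a, ha⟩ := hx
  obtain ⟨b, hb⟩ := hy
  rcases lt_trichotomy a b with h | rfl | h
  · exact Or.inl ⟨a, b, ha, hb, Or.inl h⟩
  · rcases Nat.lt_or_gt_of_ne hxy with h | h
    · exact Or.inl ⟨a, a, ha, hb, Or.inr ⟨rfl, h⟩⟩
    · exact Or.inr ⟨a, a, hb, ha, Or.inr ⟨rfl, h⟩⟩
  · exact Or.inr ⟨b, a, hb, ha, Or.inl h⟩

end KeyBelow

/-- The parent function `P` makes `V` a heap-ordered forest. -/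
structure Forest [LinearOrder α] (key : ℕ → Option α) (V : Finset ℕ) (P : ℕ → Option ℕ) : Prop where
  key_some : ∀ x ∈ V, ∃ a, key x = some a
  par_mem : ∀ x ∈ V, ∀ p, P x = some p → p ∈ V
  heap : ∀ x ∈ V, ∀ p, P x = some p → KeyBelow key p x

/-- `rp c` is the parent of `c` if the edge to it is a rank edge, and `none` otherwise. The rank of
a node is the number of its rank children, and, for a suitable enumeration of them that starts
with `0`, the value (rank plus loss) of the `i`-th one is at least `i`. The second condition is
expressed by counting: at most `i` rank children have a value below `i`. -/
structure Ranked (rk val : ℕ → ℕ) (V : Finset ℕ) (rp : ℕ → Option ℕ) : Prop where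
  rank_eq : ∀ p ∈ V, rk p = (V.filter fun c => rp c = some p).card
  hall : ∀ p ∈ V, ∀ i, (V.filter fun c => rp c = some p ∧ val c < i).card ≤ i

/-- The rank parent. -/
def rankParent (sub : ℕ → Sub) (P : ℕ → Option ℕ) (c : ℕ) : Option ℕ :=
  if sub c = .A then none else P c

section Ranked

variable {rk val : ℕ → ℕ} {V : Finset ℕ} {rp : ℕ → Option ℕ} {c q : ℕ}

theorem Ranked.pos (h : Ranked rk val V rp) (hc : c ∈ V) (hq : q ∈ V) (hcq : rp c = some q) :
    1 ≤ rk q := by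
  rw [h.rank_eq q hq]
  exact Finset.card_pos.2 ⟨c, by simp [hc, hcq]⟩

/-- After the removal of a rank child the others keep their order and move to smaller indices. -/
theorem Ranked.remove (h : Ranked rk val V rp) (hc : c ∈ V) (hcq : rp c = some q) :
    Ranked (Function.update rk q (rk q - 1)) val V (Function.update rp c none) where
  rank_eq p hp := by
    by_cases hpq : p = q
    · subst hpq
      rw [Function.update_self, h.rank_eq p hp, ← Finset.card_erase_of_mem (a := c) (by simp [hc, hcq])]
      congr 1
      ext d
      by_cases hd : d = c <;> simp [hd]
    · rw [Function.update_of_ne hpq, h.rank_eq p hp]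
      congr 1
      ext d
      by_cases hd : d = c
      · simp [hd, hcq, Ne.symm hpq]
      · simp [hd]
  hall p hp i := by
    refine (Finset.card_le_card ?_).trans (h.hall p hp i)
    intro d
    by_cases hd : d = c <;> simp [hd]

/-- A new rank child of value at least the old rank can be appended to the enumeration. -/
theorem Ranked.add (h : Ranked rk val V rp) {s : ℕ} (hc : c ∈ V) (hcn : rp c = none)
    (hs : s ∈ V) (hv : rk s ≤ val c) :
    Ranked (Function.update rk s (rk s + 1)) val V (Function.update rp c (some s)) where
  rank_eq p hp := by
    by_cases hps : p = s
    · subst hps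
      rw [Function.update_self, h.rank_eq p hp,
        ← Finset.card_insert_of_notMem (a := c) (by simp [hcn])]
      congr 1
      ext d
      by_cases hd : d = c <;> simp [hd, hc]
    · rw [Function.update_of_ne hps, h.rank_eq p hp]
      congr 1
      ext d
      by_cases hd : d = c
      · simp [hd, hcn, Ne.symm hps]
      · simp [hd]
  hall p hp i := by
    by_cases hi : val c < i ∧ p = s
    · obtain ⟨hi, rfl⟩ := hi
      calc _ ≤ (Insert.insert c (V.filter fun d => rp d = some p)).card := by
            refine Finset.card_le_card fun d => ?_
            by_cases hd : d = c <;> simp +contextual [hd]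
        _ ≤ (V.filter fun d => rp d = some p).card + 1 := Finset.card_insert_le _ _
        _ ≤ i := by rw [← h.rank_eq p hp]; omega
    · refine (Finset.card_le_card ?_).trans (h.hall p hp i)
      intro d
      by_cases hd : d = c
      · simp only [hd, Finset.mem_filter, Function.update_self, Option.some.injEq]
        rintro ⟨-, rfl, h2⟩
        exact absurd ⟨h2, rfl⟩ hi
      · simp [hd]

theorem Ranked.congr (h : Ranked rk val V rp) {rk' val' : ℕ → ℕ} {rp' : ℕ → Option ℕ}
    (hrk : ∀ p ∈ V, rk' p = rk p) (hrp : ∀ c ∈ V, rp' c = rp c)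
    (hv : ∀ c ∈ V, rp c ≠ none → val c ≤ val' c) : Ranked rk' val' V rp' where
  rank_eq p hp := by
    rw [hrk p hp, h.rank_eq p hp]
    congr 1
    exact Finset.filter_congr fun c hc => by rw [hrp c hc]
  hall p hp i := by
    refine (Finset.card_le_card ?_).trans (h.hall p hp i)
    intro d
    simp only [Finset.mem_filter]
    rintro ⟨h1, h2, h3⟩
    rw [hrp d h1] at h2
    exact ⟨h1, h2, (hv d h1 (by simp [h2])).trans_lt h3⟩

end Ranked

/-! ### The trees contain binomial trees with losses -/

open Classical in
/-- The descendants of `x`. -/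
noncomputable def descendants (V : Finset ℕ) (P : ℕ → Option ℕ) (x : ℕ) : Finset ℕ :=
  V.filter fun y => Relation.ReflTransGen (fun a b => P a = some b) y x

section Binomial

variable [LinearOrder α] {key : ℕ → Option α} {V : Finset ℕ} {P rp : ℕ → Option ℕ}
  {rank loss : ℕ → ℕ}

theorem mem_descendants {x y : ℕ} : y ∈ descendants V P x ↔
    y ∈ V ∧ Relation.ReflTransGen (fun a b => P a = some b) y x := by
  simp [descendants]

theorem Forest.below_of_reach (h : Forest key V P) {x y : ℕ} (hy : y ∈ V)
    (hyx : Relation.ReflTransGen (fun a b => P a = some b) y x) :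
    x ∈ V ∧ (x = y ∨ KeyBelow key x y) := by
  induction hyx with
  | refl => exact ⟨hy, Or.inl rfl⟩
  | @tail a b _ hab ih =>
    refine ⟨h.par_mem a ih.1 b hab, Or.inr ?_⟩
    have h1 := h.heap a ih.1 b hab
    rcases ih.2 with rfl | h2
    · exact h1
    · exact h1.trans h2

theorem Forest.not_reach (h : Forest key V P) {x c : ℕ} (hc : c ∈ V) (hcx : P c = some x) :
    ¬ Relation.ReflTransGen (fun a b => P a = some b) x c := by
  intro h1
  have h2 := h.heap c hc x hcx
  rcases (h.below_of_reach (h.par_mem c hc x hcx) h1).2 with rfl | h3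
  · exact h2.irrefl
  · exact (h2.trans h3).irrefl

theorem Forest.disjoint_descendants (h : Forest key V P) {x c d : ℕ} (hc : c ∈ V) (hd : d ∈ V)
    (hcx : P c = some x) (hdx : P d = some x) (hcd : c ≠ d) :
    Disjoint (descendants V P c) (descendants V P d) := by
  have key : ∀ {c d : ℕ}, d ∈ V → P c = some x → P d = some x → c ≠ d →
      ¬ Relation.ReflTransGen (fun a b => P a = some b) c d := by
    intro c d hd hcx hdx hcd h1
    rcases h1.cases_head with rfl | ⟨b, hb, h2⟩
    · exact hcd rfl
    · rw [hcx] at hb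
      obtain rfl := Option.some.inj hb
      exact h.not_reach hd hdx h2
  rw [Finset.disjoint_left]
  intro y hy1 hy2
  rw [mem_descendants] at hy1 hy2
  have hu : Relator.RightUnique (fun a b => P a = some b) := by
    intro a b c h1 h2
    rw [h1] at h2
    exact Option.some.inj h2
  rcases Relation.ReflTransGen.total_of_right_unique hu hy1.2 hy2.2 with h1 | h1
  · exact key hd hcx hdx hcd h1
  · exact key hc hdx hcx hcd.symm h1

/-- Hall's condition picks, for each `i` below the rank of a node, another rank child of value at
least `i`; its tree contains a pruned binomial tree of rank `i`, since its loss pays for the ranks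
that it lacks. Joining these trees gives a binomial tree with losses. -/
theorem Forest.exists_prunedBinomial (h : Forest key V P)
    (hR : Ranked rank (fun c => rank c + loss c) V rp) (hrp : ∀ c p, rp c = some p → P c = some p)
    {x : ℕ} (hx : x ∈ V) : ∃ t : PrunedBinomial (rank x), t.RootIntact ∧
      t.size ≤ (descendants V P x).card ∧
      t.totalLoss + loss x ≤ ∑ y ∈ descendants V P x, loss y := by
  induction hn : (descendants V P x).card using Nat.strong_induction_on generalizing x with
  | _ n ih =>
  subst hn
  have hxx : x ∈ descendants V P x := mem_descendants.2 ⟨hx, .refl⟩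
  have hsub : ∀ c ∈ V, P c = some x → descendants V P c ⊆ (descendants V P x).erase x := by
    intro c hc hcx y hy
    rw [mem_descendants] at hy
    rw [Finset.mem_erase, mem_descendants]
    refine ⟨?_, hy.1, hy.2.tail hcx⟩
    rintro rfl
    exact h.not_reach hc hcx hy.2
  have hkid : ∀ c ∈ V, P c = some x → ∀ j ≤ rank c + loss c, ∃ t : PrunedBinomial j,
      t.size ≤ (descendants V P c).card ∧ t.totalLoss ≤ ∑ y ∈ descendants V P c, loss y := by
    intro c hc hcx j hj
    have hlt : (descendants V P c).card < (descendants V P x).card :=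
      (Finset.card_le_card (hsub c hc hcx)).trans_lt (Finset.card_erase_lt_of_mem hxx)
    obtain ⟨t, h1, h2, h3⟩ := ih _ hlt hc rfl
    rcases le_or_gt j (rank c) with hjr | hjr
    · obtain ⟨t', -, h5, h6⟩ := h1.exists_of_le hjr
      exact ⟨t', h5.trans h2, by omega⟩
    · obtain ⟨k, rfl⟩ := Nat.exists_eq_add_of_le hjr.le
      obtain ⟨t', h5, h6⟩ := t.exists_cut k
      exact ⟨t', by omega, by omega⟩
  have hjoin : ∀ j, ∀ F ⊆ V.filter (fun c => rp c = some x), j ≤ F.card →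
      (∀ i, (F.filter fun c => rank c + loss c < i).card ≤ i) →
      ∃ t : PrunedBinomial j, t.RootIntact ∧ t.size ≤ 1 + ∑ c ∈ F, (descendants V P c).card ∧
        t.totalLoss ≤ ∑ c ∈ F, ∑ y ∈ descendants V P c, loss y := by
    intro j
    induction j with
    | zero => exact fun F _ _ _ => ⟨.single, trivial, by simp [PrunedBinomial.size],
        by simp [PrunedBinomial.totalLoss]⟩
    | succ j ihj =>
      intro F hF hcard hall
      -- by Hall's condition, not all of the `j + 1` nodes have a value below `j`
      obtain ⟨c, hcF, hcj⟩ : ∃ c ∈ F, j ≤ rank c + loss c := by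
        by_contra! hcon
        have h1 := hall j
        rw [Finset.filter_true_of_mem hcon] at h1
        omega
      have hcV := Finset.mem_filter.1 (hF hcF)
      obtain ⟨t, h1, h2, h3⟩ := ihj (F.erase c) ((Finset.erase_subset _ _).trans hF)
        (by rw [Finset.card_erase_of_mem hcF]; omega) fun i =>
          (Finset.card_le_card (Finset.filter_subset_filter _ (Finset.erase_subset _ _))).trans
            (hall i)
      obtain ⟨t', h4, h5⟩ := hkid c hcV.1 (hrp c x hcV.2) j hcj
      refine ⟨.keep t t', h1, ?_, ?_⟩
      · rw [← Finset.add_sum_erase F _ hcF]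
        simp only [PrunedBinomial.size]
        omega
      · rw [← Finset.add_sum_erase F _ hcF]
        simp only [PrunedBinomial.totalLoss]
        omega
  obtain ⟨t, h1, h2, h3⟩ := hjoin (rank x) _ subset_rfl (hR.rank_eq x hx).le fun i => by
    rw [Finset.filter_filter]
    exact hR.hall x hx i
  have hdis : (↑(V.filter fun c => rp c = some x) : Set ℕ).PairwiseDisjoint (descendants V P) := by
    intro c hc d hd hcd
    simp only [Finset.coe_filter, Set.mem_ofPred_eq] at hc hd
    exact h.disjoint_descendants hc.1 hd.1 (hrp _ _ hc.2) (hrp _ _ hd.2) hcd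
  have hU : (V.filter fun c => rp c = some x).biUnion (descendants V P) ⊆
      (descendants V P x).erase x := by
    intro y hy
    obtain ⟨c, hc, hy⟩ := Finset.mem_biUnion.1 hy
    have hc := Finset.mem_filter.1 hc
    exact hsub c hc.1 (hrp _ _ hc.2) hy
  refine ⟨t, h1, ?_, ?_⟩
  · rw [← Finset.card_biUnion hdis] at h2
    have h4 := Finset.card_le_card hU
    rw [Finset.card_erase_of_mem hxx] at h4
    have := Finset.card_pos.2 ⟨x, hxx⟩
    omega
  · rw [← Finset.sum_biUnion hdis] at h3
    rw [← Finset.sum_erase_add _ _ hxx]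
    exact Nat.add_le_add_right (h3.trans (Finset.sum_le_sum_of_subset hU)) _

/-- The tree below `x` contains a binomial tree of rank `rank x` with losses. If the total loss in the
heap is at most `rank x + 1`, then this tree counts in the definition of `maxRank`. -/
theorem Forest.rank_le_maxRank (h : Forest key V P)
    (hR : Ranked rank (fun c => rank c + loss c) V rp) (hrp : ∀ c p, rp c = some p → P c = some p)
    {x : ℕ} (hx : x ∈ V) (hl : ∑ y ∈ V, loss y ≤ rank x + 1) : rank x ≤ maxRank V.card := by
  obtain ⟨t, h1, h2, h3⟩ := h.exists_prunedBinomial hR hrp hx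
  have hs : descendants V P x ⊆ V := fun y hy => (mem_descendants.1 hy).1
  refine le_maxRank t h1 ?_ (h2.trans (Finset.card_le_card hs))
  have := Finset.sum_le_sum_of_subset (f := loss) hs
  omega

end Binomial

end

/-! ### The invariant and the bounds that it gives -/

section

variable {α : Type u}

/-- The invariant that holds between the stack reductions of a method. -/
structure Inv [LinearOrder α] (s : State α) (V : Finset ℕ) (T : Set ℕ) : Prop where
  lt_next : ∀ x ∈ V, x < s.next
  forest : Forest s.key V s.parent
  lists : Lists s.child s.roots s.left s.right V V s.parent
  viol : Viol s.rank s.sub s.loss s.arr s.stk s.phi V T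
  ranked : Ranked s.rank (fun c => s.rank c + s.loss c) V (rankParent s.sub s.parent)
  root_sub : ∀ x ∈ V, s.parent x = none → s.sub x = .A

section Bounds

variable {rank : ℕ → ℕ} {sub : ℕ → Sub} {loss : ℕ → ℕ} {arr : Kind → ℕ → Option ℕ}
  {stk : Kind → List ℕ} {phi : Kind → ℤ} {V : Finset ℕ} {X : Kind}

theorem card_filter_mem_le (V : Finset ℕ) (l : List ℕ) : (V.filter (· ∈ l)).card ≤ l.length := by
  refine (Finset.card_le_card (t := l.toFinset) ?_).trans l.toFinset_card_le
  intro x hx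
  simpa using (Finset.mem_filter.1 hx).2

/-- Each violation is in its array or on its stack. -/
theorem Viol.card_kind_le (h : Viol rank sub loss arr stk phi V ∅) (X : Kind) :
    (V.filter fun x => (sub x).kind = some X).card ≤
      ∑ x ∈ V, inArr arr rank X x + (stk X).length := by
  have h1 : (V.filter fun x => (sub x).kind = some X) ⊆
      (V.filter fun x => arr X (rank x) = some x) ∪ V.filter (· ∈ stk X) := by
    intro x hx
    obtain ⟨hx, hk⟩ := Finset.mem_filter.1 hx
    rcases h.on_stk X x hx (by simp) hk with h2 | h2 <;> simp [hx, h2]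
  refine (Finset.card_le_card h1).trans ((Finset.card_union_le _ _).trans ?_)
  refine Nat.add_le_add (le_of_eq ?_) (card_filter_mem_le V _)
  rw [Finset.card_filter]
  rfl

theorem Viol.card_A_le (h : Viol rank sub loss arr stk phi V ∅) :
    ((V.filter fun x => sub x = .A).card : ℤ) ≤ phi .A := by
  have h1 := h.card_kind_le .A
  have h2 : (V.filter fun x => sub x = .A) = V.filter fun x => (sub x).kind = some .A := by
    refine Finset.filter_congr fun x _ => ?_
    cases sub x <;> simp [Sub.kind]
  rw [h.phi_eq, h2]
  simp only [Kind.arrWeight, Kind.stkWeight, excessLoss]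
  omega

/-- An array entry has loss `1` and weight `3`; on the stack each loss counts at least `4`. -/
theorem Viol.sum_loss_le (h : Viol rank sub loss arr stk phi V ∅) :
    3 * ((∑ x ∈ V, loss x : ℕ) : ℤ) ≤ phi .L := by
  have h1 := h.card_kind_le .L
  have h2 : ∑ x ∈ V, loss x = ∑ x ∈ V, ((if (sub x).kind = some .L then 1 else 0) +
      (loss x - 1)) := by
    refine Finset.sum_congr rfl fun x hx => ?_
    have := h.loss_ok x hx
    cases hs : sub x <;> rw [hs] at this <;> simp only [LossOK] at this <;>
      simp [Sub.kind] <;> omega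
  rw [Finset.sum_add_distrib, ← Finset.card_filter] at h2
  rw [h.phi_eq]
  simp only [Kind.arrWeight, Kind.stkWeight, excessLoss]
  omega

/-- The entries of an array are nodes of different ranks. -/
theorem sum_inArr_le {m : ℕ}
    (hm : ∀ x ∈ V, rank x ≤ m) (X : Kind) : ∑ x ∈ V, inArr arr rank X x ≤ m + 1 := by
  have h1 : ∑ x ∈ V, inArr arr rank X x = (V.filter fun x => arr X (rank x) = some x).card := by
    rw [Finset.card_filter]
    rfl
  rw [h1, ← Finset.card_range (m + 1)]
  refine Finset.card_le_card_of_injOn rank ?_ ?_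
  · intro x hx
    have := hm x (Finset.mem_filter.1 hx).1
    simpa using Nat.lt_succ_of_le this
  · intro x hx y hy hxy
    have h2 := (Finset.mem_filter.1 hx).2
    have h3 := (Finset.mem_filter.1 hy).2
    rw [← hxy, h2] at h3
    exact Option.some.inj h3

theorem Viol.phi_A_le (h : Viol rank sub loss arr stk phi V ∅) {m : ℕ}
    (hm : ∀ x ∈ V, rank x ≤ m) (hs : stk .A = []) : phi .A ≤ m + 1 := by
  have := sum_inArr_le (arr := arr) hm .A
  rw [h.phi_eq, hs]
  simp only [Kind.arrWeight, Kind.stkWeight, excessLoss, List.length_nil]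
  omega

/-- If `C[L]` is empty, then no node has subtype `L2`, and `Φ_L` consists of array entries. -/
theorem Viol.phi_L_le (h : Viol rank sub loss arr stk phi V ∅) {m : ℕ}
    (hm : ∀ x ∈ V, rank x ≤ m) (hs : stk .L = []) : phi .L ≤ 3 * (m + 1) := by
  have h1 := sum_inArr_le (arr := arr) hm .L
  rw [h.phi_eq, hs]
  have h2 : ∑ x ∈ V, (loss x - 1) = 0 := by
    refine Finset.sum_eq_zero fun x hx => ?_
    have := h.loss_ok x hx
    cases hsx : sub x <;> rw [hsx] at this <;> simp only [LossOK] at this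
    · simp [this]
    · simp [this]
    · rcases h.on_stk .L x hx (by simp) (by simp [hsx, Sub.kind]) with h3 | h3
      · exact absurd hsx (h.arr_spec _ _ _ h3).2.2.1
      · simp [hs] at h3
    · simp [this]
  simp only [Kind.arrWeight, Kind.stkWeight, excessLoss, List.length_nil, h2]
  omega

end Bounds

section Inv

variable [LinearOrder α] {s : State α} {V : Finset ℕ}

theorem rankParent_eq_some {sub : ℕ → Sub} {P : ℕ → Option ℕ} {c p : ℕ} :
    rankParent sub P c = some p ↔ sub c ≠ .A ∧ P c = some p := by
  unfold rankParent
  split_ifs with h <;> simp [h]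

/-- The total loss is at most `Φ_L / 3 ≤ m + 1`. Hence a node of rank above `m` would have a rank of
at most `maxRank V.card ≤ m`. -/
theorem Inv.rank_le {m : ℕ} (h : Inv s V ∅) (hm : maxRank V.card ≤ m)
    (hL : s.phi .L ≤ 3 * (m + 1)) : ∀ x ∈ V, s.rank x ≤ m := by
  intro x hx
  by_contra! hlt
  have h1 := h.viol.sum_loss_le
  have := h.forest.rank_le_maxRank h.ranked (fun c p hc => (rankParent_eq_some.1 hc).2) hx
    (by omega)
  omega

/-- If the stack `C[L]` is empty, then the total loss is the number of entries of `R[L]`, and this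
number is at most the largest rank plus one. -/
theorem Inv.rank_le_of_stk_nil (h : Inv s V ∅) (hs : s.stk .L = []) :
    ∀ x ∈ V, s.rank x ≤ maxRank V.card := by
  intro x hx
  obtain ⟨y, hy, hmax⟩ := Finset.exists_max_image V s.rank ⟨x, hx⟩
  have h1 := h.viol.phi_L_le hmax hs
  have h2 := h.viol.sum_loss_le
  exact (hmax x hx).trans (h.forest.rank_le_maxRank h.ranked
    (fun c p hc => (rankParent_eq_some.1 hc).2) hy (by omega))

end Inv

/-! ### Cutting and linking -/

section Link

variable {V : Finset ℕ} {T : Set ℕ} {s : State α} {child : ℕ → Option ℕ} {roots : Option ℕ}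
  {left : ℕ → ℕ} {right : ℕ → Option ℕ}

theorem Lists.congr {M : Finset ℕ} {P P' : ℕ → Option ℕ} (h : Lists child roots left right V M P)
    (hP : ∀ c ∈ M, P' c = P c) : Lists child roots left right V M P' := by
  intro p hp
  obtain ⟨l, h1, h2, h3, h4⟩ := h p hp
  refine ⟨l, h1, h2, h3, fun c => ?_⟩
  rw [h4]
  exact and_congr_right fun hc => by rw [hP c hc]

/-- The state with new pointers, where `P` is the new parent function. -/
abbrev State.withTree (s : State α) (P child : ℕ → Option ℕ) (roots : Option ℕ) (left : ℕ → ℕ)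
    (right : ℕ → Option ℕ) (t : ℕ) : State α :=
  { s with
    parent := P, child := child, roots := roots, left := left, right := right, time := t }

/-- The state with new violations, arrays and stacks. -/
abbrev State.withViol (s : State α) (rank : ℕ → ℕ) (sub : ℕ → Sub) (loss : ℕ → ℕ)
    (arr : Kind → ℕ → Option ℕ) (stk : Kind → List ℕ) (phi : Kind → ℤ) (t o : ℕ) : State α :=
  { s with
    rank := rank, sub := sub, loss := loss, arr := arr, stk := stk, phi := phi, time := t
    overhead := o }

theorem cutFromParent_of_A {c : ℕ} (hc : c ∈ V) (hA : s.sub c = .A)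
    (hp : ∀ p, s.parent c = some p → p ∈ V)
    (hl : Lists s.child s.roots s.left s.right V V s.parent) :
    ∃ child roots left right t, cutFromParent c s = some ((), s.withTree
        (Function.update s.parent c none) child roots left right t) ∧ t ≤ s.time + 11 ∧
      Lists child roots left right V (V.erase c) (Function.update s.parent c none) := by
  obtain ⟨child, roots, left, right, t, h1, h2, h3⟩ := removeFrom_spec
    (s := { s with time := s.time + 1 + 1 }) hl hc (p := s.parent c) rfl hp
  refine ⟨child, roots, left, right, t + 1, ?_, ?_, h3.congr fun d hd => ?_⟩
  · simp only [cutFromParent, bind_apply, getSub, getParent, rd_apply, Option.bind_some, hA, ne_eq,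
      not_true, if_false]
    rw [h1]
    rfl
  · dsimp only at h2
    omega
  · exact Function.update_of_ne (Finset.ne_of_mem_erase hd) _ _

theorem cutFromParent_of_ne_A {c q : ℕ} (hc : c ∈ V) (hA : s.sub c ≠ .A)
    (hq : s.parent c = some q) (hqV : q ∈ V) (hqT : q ∉ T)
    (hl : Lists s.child s.roots s.left s.right V V s.parent)
    (hv : Viol s.rank s.sub s.loss s.arr s.stk s.phi V T) :
    ∃ (child : ℕ → Option ℕ) (roots : Option ℕ) (left : ℕ → ℕ) (right : ℕ → Option ℕ)
      (arr : Kind → ℕ → Option ℕ) (stk : Kind → List ℕ) (phi : Kind → ℤ) (t o : ℕ),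
      cutFromParent c s = some ((), (s.withViol (Function.update s.rank q (s.rank q - 1))
        (Function.update s.sub q (decSub (s.sub q)))
        (Function.update s.loss q (decLoss (s.sub q) (s.loss q))) arr stk phi t o).withTree
        (Function.update s.parent c none) child roots left right t) ∧ t ≤ s.time + 20 ∧
      Lists child roots left right V (V.erase c) (Function.update s.parent c none) ∧
      Viol (Function.update s.rank q (s.rank q - 1)) (Function.update s.sub q (decSub (s.sub q)))
        (Function.update s.loss q (decLoss (s.sub q) (s.loss q))) arr stk phi V T ∧
      (∀ X r z, arr X r = some z → s.arr X r = some z) ∧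
      (s.sub q ≠ .A → stk .A = s.stk .A) ∧
      DecDelta (phi .A - s.phi .A) (phi .L - s.phi .L) s.overhead o := by
  obtain ⟨arr, stk, phi, t1, o, g1, g2, g3, g4, g5, g6⟩ := decrementRank_spec
    (s := { s with time := s.time + 1 + 1 }) hv hqV hqT
  obtain ⟨child, roots, left, right, t, h1, h2, h3⟩ := removeFrom_spec
    (s := s.withViol (Function.update s.rank q (s.rank q - 1))
        (Function.update s.sub q (decSub (s.sub q)))
        (Function.update s.loss q (decLoss (s.sub q) (s.loss q))) arr stk phi t1 o) hl hc
    (p := s.parent c) rfl (by rw [hq]; rintro x hx; exact Option.some.inj hx ▸ hqV)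
  refine ⟨child, roots, left, right, arr, stk, phi, t + 1, o, ?_, ?_, h3.congr fun d hd => ?_, g3,
    g4, g5, g6⟩
  · simp only [cutFromParent, bind_apply, getSub, getParent, rd_apply, Option.bind_some, hA, ne_eq,
      not_false_eq_true, if_true, hq, target_some]
    rw [g1]
    simp only [Option.bind_some]
    rw [hq] at h1
    erw [h1]
    rfl
  · dsimp only at g2 h2
    omega
  · exact Function.update_of_ne (Finset.ne_of_mem_erase hd) _ _

/-- Making `h` the leftmost child of `p`. -/
theorem attach_spec {h p : ℕ} (hh : h ∈ V) (hp : p ∈ V)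
    (hl : Lists s.child s.roots s.left s.right V (V.erase h) s.parent) :
    ∃ child roots left right t, (addLeftmost (some p) h >>= fun _ => setParent h (some p)) s =
        some ((), s.withTree (Function.update s.parent h (some p)) child roots left right t) ∧
      t ≤ s.time + 9 ∧
      Lists child roots left right V V (Function.update s.parent h (some p)) := by
  obtain ⟨child, roots, left, right, t, h1, h2, h3⟩ := addLeftmost_spec (p := some p) hl hh
    (by rintro x hx; exact Option.some.inj hx ▸ hp)
  refine ⟨child, roots, left, right, t + 1, ?_, by omega, h3⟩
  rw [bind_apply, h1]
  rfl

/-- `link` after the comparison of the keys: `p` becomes the parent of `h`. -/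
def linkBelow (taken : Bool) (p h : ℕ) : Prog α ℕ := do
  let rs ← getRank p
  let rh ← getRank h
  if rs ≤ rh then
    let O ← getSub p
    setViolationSubtype taken p (if O = .L1 then .N else O)
    setRank p (rs + 1)
  cutFromParent h
  addLeftmost (some p) h
  setParent h (some p)
  let H : Sub := if rs ≤ rh then .N else .A
  let O ← getSub h
  if O ≠ H then
    setViolationSubtype false h H
  pure p

theorem linkBelow_of_le {p h : ℕ} {taken : Bool} (hr : s.rank p ≤ s.rank h) :
    linkBelow taken p h s =
      (setViolationSubtype taken p (if s.sub p = .L1 then .N else s.sub p)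
        { s with time := s.time + 1 + 1 + 1 }).bind fun r =>
      (setRank p (s.rank p + 1) r.2).bind fun r => (cutFromParent h r.2).bind fun r =>
      ((addLeftmost (some p) h >>= fun _ => setParent h (some p)) r.2).bind fun r =>
      (if r.2.sub h ≠ .N then setViolationSubtype false h .N >>= fun _ => pure p else pure p)
        { r.2 with time := r.2.time + 1 } := by
  simp only [linkBelow, bind_apply, getRank, getSub, rd_apply, Option.bind_some, hr, if_true,
    Option.bind_assoc]

theorem linkBelow_of_lt {p h : ℕ} {taken : Bool} (hr : s.rank h < s.rank p) :
    linkBelow taken p h s =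
      (cutFromParent h { s with time := s.time + 1 + 1 }).bind fun r =>
      ((addLeftmost (some p) h >>= fun _ => setParent h (some p)) r.2).bind fun r =>
      (if r.2.sub h ≠ .A then setViolationSubtype false h .A >>= fun _ => pure p else pure p)
        { r.2 with time := r.2.time + 1 } := by
  simp only [linkBelow, bind_apply, getRank, getSub, rd_apply, Option.bind_some, hr.not_ge, if_false,
    Option.bind_assoc]

end Link

end

/-! ### Links -/

section

variable {α : Type u} [LinearOrder α] {V : Finset ℕ} {T : Set ℕ} {s : State α}

theorem link_eq (taken : Bool) (x y : ℕ) :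
    (link taken x y : Prog α ℕ) = keyLt x y >>= fun b =>
      linkBelow taken (if b then x else y) (if b then y else x) := rfl

theorem keyLt_spec {x y : ℕ} (hx : ∃ a, s.key x = some a) (hy : ∃ a, s.key y = some a)
    (hxy : x ≠ y) : ∃ b, keyLt x y s = some (b, { s with time := s.time + 1 }) ∧
      KeyBelow s.key (if b then x else y) (if b then y else x) := by
  obtain ⟨a, ha⟩ := hx
  obtain ⟨b, hb⟩ := hy
  refine ⟨decide (a < b ∨ (a = b ∧ x < y)), by simp [keyLt, ha, hb], ?_⟩
  by_cases h : a < b ∨ (a = b ∧ x < y)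
  · simp only [h, decide_true, if_true]
    exact ⟨a, b, ha, hb, h⟩
  · simp only [h, decide_false, Bool.false_eq_true, if_false]
    rw [not_or, not_and, not_lt, not_lt] at h
    refine ⟨b, a, hb, ha, ?_⟩
    rcases h.1.lt_or_eq with h1 | rfl
    · exact Or.inl h1
    · exact Or.inr ⟨rfl, lt_of_le_of_ne (h.2 rfl) hxy.symm⟩

/-- `link` can be traced back to `linkBelow`. -/
theorem exists_link_of_linkBelow {x y : ℕ} {taken : Bool} {Q : State α → ℕ → ℕ → Prop}
    (hx : ∃ a, s.key x = some a) (hy : ∃ a, s.key y = some a) (hxy : x ≠ y)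
    (h : ∀ p h, (p = x ∧ h = y) ∨ (p = y ∧ h = x) → KeyBelow s.key p h →
      ∃ s', linkBelow taken p h { s with time := s.time + 1 } = some (p, s') ∧ Q s' p h) :
    ∃ p h s', ((p = x ∧ h = y) ∨ (p = y ∧ h = x)) ∧ link taken x y s = some (p, s') ∧ Q s' p h := by
  obtain ⟨b, hb, hk⟩ := keyLt_spec hx hy hxy
  have hph : ((if b then x else y) = x ∧ (if b then y else x) = y) ∨
      ((if b then x else y) = y ∧ (if b then y else x) = x) := by cases b <;> simp
  obtain ⟨s', h1, h2⟩ := h _ _ hph hk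
  refine ⟨_, _, s', hph, ?_, h2⟩
  rw [link_eq, bind_apply, hb]
  exact h1

theorem Forest.attach {key : ℕ → Option α} {P : ℕ → Option ℕ} {p h : ℕ} (hF : Forest key V P)
    (hp : p ∈ V) (hk : KeyBelow key p h) : Forest key V (Function.update P h (some p)) where
  key_some := hF.key_some
  par_mem x hx q hq := by
    by_cases hxh : x = h
    · subst hxh
      rw [Function.update_self] at hq
      exact Option.some.inj hq ▸ hp
    · rw [Function.update_of_ne hxh] at hq
      exact hF.par_mem x hx q hq
  heap x hx q hq := by
    by_cases hxh : x = h
    · subst hxh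
      rw [Function.update_self] at hq
      exact Option.some.inj hq ▸ hk
    · rw [Function.update_of_ne hxh] at hq
      exact hF.heap x hx q hq

theorem inArr_eq_zero_of_sub {rank : ℕ → ℕ} {sub : ℕ → Sub} {loss : ℕ → ℕ}
    {arr : Kind → ℕ → Option ℕ} {stk : Kind → List ℕ} {phi : Kind → ℤ} {X : Kind} {x : ℕ}
    (h : Viol rank sub loss arr stk phi V T) (hx : (sub x).kind ≠ some X) :
    inArr arr rank X x = 0 := inArr_eq_zero fun r h1 => hx (h.arr_spec X r x h1).2.2.2

/-- The changes of `Φ_A`, the overhead, the subtypes and the stack `C[A]` when a node `p` of subtype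
`A` wins a node `h` of subtype `A` as a rank child: both leave their arrays, and `q = 1` if `p` is
pushed. -/
def RankLink (taken : Bool) (s s' : State α) (p h q : ℕ) : Prop :=
  q ≤ 1 ∧ (taken = false → inArr s.arr s.rank .A p = 0 → q = 0) ∧
    (inArr s.arr s.rank .A p = 1 → q = 1) ∧
    s'.phi .A = s.phi .A - inArr s.arr s.rank .A p - inArr s.arr s.rank .A h + 2 * (q : ℤ) ∧
    s'.overhead = s.overhead + inArr s.arr s.rank .A p + inArr s.arr s.rank .A h + q ∧
    s'.sub = Function.update s.sub h .N ∧
    s'.stk .A = if q = 1 then p :: s.stk .A else s.stk .A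

/-- Links of nodes of subtype `A`. Either `h` becomes a child by an edge that is not a rank edge, and
no violation changes, or `p` wins `h` as a rank child. -/
theorem linkBelow_A_spec {p h : ℕ} {taken : Bool} (hI : Inv s V T) (hp : p ∈ V) (hh : h ∈ V)
    (hk : KeyBelow s.key p h) (hpA : s.sub p = .A) (hhA : s.sub h = .A)
    (hT : taken = true ↔ p ∈ T) (hTs : T ⊆ {p, h}) (hr : T.Nonempty → s.rank p ≤ s.rank h) :
    ∃ s', linkBelow taken p h s = some (p, s') ∧ Inv s' V ∅ ∧ s'.key = s.key ∧ s'.next = s.next ∧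
      s'.parent = Function.update s.parent h (some p) ∧ s'.reductions = s.reductions ∧
      s'.stk .L = s.stk .L ∧ s'.phi .L = s.phi .L ∧
      (∀ X r z, s'.arr X r = some z → s.arr X r = some z) ∧ s'.time ≤ s.time + 50 ∧
      ((s'.phi .A = s.phi .A ∧ s'.overhead = s.overhead ∧ s'.sub = s.sub ∧ s'.stk .A = s.stk .A ∧
        s.rank h < s.rank p) ∨ ∃ q, RankLink taken s s' p h q) := by
  have hph : p ≠ h := by
    rintro rfl
    exact hk.irrefl
  rcases le_or_gt (s.rank p) (s.rank h) with hrk | hrk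
  · obtain ⟨arr1, stk1, phi1, t1, o1, q1, a1, a2, a3, a4, a5, a6, -, a7, a8, a9, a10, a11, a12⟩ :=
      setViolationSubtype_spec (s := { s with time := s.time + 1 + 1 + 1 }) (taken := taken) (S := .A)
        hI.viol hp (fun _ _ => hT)
    dsimp only at a1 a2 a3 a4 a5 a6 a7 a8 a9 a10 a11 a12
    have ha1 : ∀ X r, arr1 X r ≠ some p := fun X r h1 => ((a4 X r p).1 h1).2 rfl
    have hsub1 : Function.update s.sub p .A = s.sub := by rw [← hpA, Function.update_eq_self]
    have hlp := hI.viol.loss_ok p hp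
    rw [hpA] at hlp
    have hloss1 : Function.update s.loss p Sub.A.startLoss = s.loss := by
      rw [show Sub.A.startLoss = s.loss p from hlp.symm, Function.update_eq_self]
    rw [hsub1, hloss1] at a1 a3
    have hv2 := a3.setRank (r := s.rank p + 1) ha1 (Or.inr (by rw [hpA]; exact a5))
    obtain ⟨child2, roots2, left2, right2, t2, b1, b2, b3⟩ := cutFromParent_of_A
      (s := s.withViol (Function.update s.rank p (s.rank p + 1)) s.sub s.loss arr1 stk1 phi1 (t1 + 1)
        o1) hh hhA (hI.forest.par_mem h hh) hI.lists
    obtain ⟨child3, roots3, left3, right3, t3, c1, c2, c3⟩ := attach_spec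
      (s := (s.withViol (Function.update s.rank p (s.rank p + 1)) s.sub s.loss arr1 stk1 phi1 (t1 + 1)
        o1).withTree (Function.update s.parent h none) child2 roots2 left2 right2 t2) hh hp b3
    obtain ⟨arr4, stk4, phi4, t4, o4, q4, d1, d2, d3, d4, d5, d6, d7, -, -, d9, d10, d11, d12⟩ :=
      setViolationSubtype_spec (s := (s.withViol (Function.update s.rank p (s.rank p + 1)) s.sub s.loss
        arr1 stk1 phi1 (t1 + 1) o1).withTree (Function.update s.parent h (some p)) child3 roots3 left3
        right3 (t3 + 1)) (taken := false) (S := .N) hv2 hh (by simp [Sub.kind])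
    simp only [Function.update_idem] at c1 c3
    dsimp only at b1 b2 c1 c2 d1 d2 d3 d4 d9 d10 d11 d12
    have hq4 : q4 = 0 := d7 rfl
    have hlh := hI.viol.loss_ok h hh
    rw [hhA] at hlh
    have hloss4 : Function.update s.loss h Sub.N.startLoss = s.loss := by
      rw [show Sub.N.startLoss = s.loss h from hlh.symm, Function.update_eq_self]
    rw [hloss4] at d1 d3
    have hstk4 : stk4 = stk1 := by
      funext X
      simpa [Sub.kind] using d9 X
    have hiL : ∀ x, s.sub x = .A → inArr s.arr s.rank .L x = 0 := fun x hx =>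
      inArr_eq_zero_of_sub hI.viol (by simp [hx, Sub.kind])
    have hih : ∀ X, inArr arr1 (Function.update s.rank p (s.rank p + 1)) X h =
        inArr s.arr s.rank X h := by
      intro X
      simp only [inArr, Function.update_of_ne hph.symm, a4]
      simp [hph.symm]
    rw [hih] at d10 d11 d12
    rw [hih] at d12
    rw [hiL p hpA] at a11 a12
    rw [hiL h hhA] at d11 d12
    rw [hlp] at a11
    rw [hlh] at d11
    simp only [Sub.kind, Sub.startLoss] at a7 a8 a9 a10 a11 d10 d11
    refine ⟨(s.withViol (Function.update s.rank p (s.rank p + 1)) (Function.update s.sub h .N) s.loss arr4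
      stk4 phi4 t4 o4).withTree (Function.update s.parent h (some p)) child3 roots3 left3 right3 t4,
      ?run, ⟨hI.lt_next, hI.forest.attach hp hk, c3, d3.drop ?_, ?_, ?_⟩, rfl, rfl, rfl, rfl,
      ?_, ?_, ?_, ?_, Or.inr ⟨q1, a6, ?_, ?_, ?_, ?_, rfl, ?_⟩⟩
    case run =>
      rw [linkBelow_of_le hrk]
      simp only [hpA, reduceCtorEq, if_false]
      rw [a1]
      simp only [Option.bind_some, setRank, wr_apply]
      erw [b1]
      simp only [Option.bind_some]
      erw [c1]
      simp only [Option.bind_some, hhA, ne_eq, reduceCtorEq, not_false_eq_true, if_true, bind_apply]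
      erw [d1]
      rfl
    · rintro y ⟨⟨h1, h2⟩, h3⟩
      rcases hTs h1 with h4 | h4
      · exact absurd h4 h2
      · exact absurd h4 h3
    · have hrph : rankParent s.sub s.parent h = none := by simp [rankParent, hhA]
      have hR := (hI.ranked.congr (rk' := s.rank) (val' := fun c =>
        Function.update s.rank p (s.rank p + 1) c + s.loss c) (fun _ _ => rfl) (fun _ _ => rfl)
        (by
          intro c _ _
          by_cases hcp : c = p
          · subst hcp; simp
          · simp [hcp])).add hh hrph hp (by simpa [hph.symm] using hrk.trans (Nat.le_add_right _ _))
      refine hR.congr (fun _ _ => rfl) (fun c _ => ?_) (fun _ _ _ => le_rfl)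
      by_cases hch : c = h
      · simp [rankParent, hch]
      · simp [rankParent, hch]
    · intro x hx hpx
      by_cases hxh : x = h
      · simp [hxh] at hpx
      · simp only [Function.update_of_ne hxh] at hpx ⊢
        exact hI.root_sub x hx hpx
    · show stk4 .L = _
      rw [hstk4, a9]
      simp
    · simp at a11 d11 ⊢
      omega
    · intro X r z h1
      exact ((a4 X r z).1 ((d4 X r z).1 h1).1).1
    · dsimp only
      omega
    · exact fun h1 => a7 .A h1 (by rw [hpA]) rfl
    · exact fun h1 => a8 .A (by rw [hpA]) (by simp) h1
    · simp at a10 d10 ⊢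
      omega
    · dsimp only
      omega
    · show stk4 .A = _
      rw [hstk4, a9]
      simp
  · obtain ⟨child2, roots2, left2, right2, t2, b1, b2, b3⟩ := cutFromParent_of_A
      (s := { s with time := s.time + 1 + 1 }) hh hhA (hI.forest.par_mem h hh) hI.lists
    obtain ⟨child3, roots3, left3, right3, t3, c1, c2, c3⟩ := attach_spec
      (s := s.withTree (Function.update s.parent h none) child2 roots2 left2 right2 t2) hh hp b3
    have hT0 : T = ∅ := by
      by_contra hne
      exact absurd (hr (Set.nonempty_iff_ne_empty.2 hne)) hrk.not_ge
    subst hT0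
    simp only [Function.update_idem] at c1 c3
    dsimp only at b1 b2 c1 c2
    refine ⟨s.withTree (Function.update s.parent h (some p)) child3 roots3 left3 right3 (t3 + 1),
      ?run2, ⟨hI.lt_next, hI.forest.attach hp hk, c3, hI.viol, ?_, ?_⟩, rfl, rfl, rfl, rfl,
      rfl, rfl, fun _ _ _ h1 => h1, ?_, Or.inl ⟨rfl, rfl, rfl, rfl, hrk⟩⟩
    case run2 =>
      rw [linkBelow_of_lt hrk]
      erw [b1]
      simp only [Option.bind_some]
      erw [c1]
      simp only [Option.bind_some, hhA, ne_eq, not_true, if_false, pure_apply]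
    · refine hI.ranked.congr (fun _ _ => rfl) (fun c _ => ?_) (fun _ _ _ => le_rfl)
      by_cases hch : c = h
      · simp [rankParent, hch, hhA]
      · simp [rankParent, hch]
    · intro x hx hpx
      by_cases hxh : x = h
      · simp [hxh] at hpx
      · simp only [Function.update_of_ne hxh] at hpx
        exact hI.root_sub x hx hpx
    · dsimp only
      omega

/-- Links in a reduction of `C[L]`, after which neither node is a violation. The old parent of `h`
loses a rank child; it may be `p` itself, which then has won the new child before. -/
theorem linkBelow_L_spec {p h : ℕ} (hI : Inv s V {p, h}) (hp : p ∈ V) (hh : h ∈ V)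
    (hk : KeyBelow s.key p h) (hpL : s.sub p = .L1) (hhL : s.sub h = .L1)
    (hr : s.rank p = s.rank h) (hpa : ∀ r, s.arr .L r ≠ some p) (hha : ∀ r, s.arr .L r ≠ some h) :
    ∃ s', linkBelow true p h s = some (p, s') ∧ Inv s' V ∅ ∧ s'.key = s.key ∧ s'.next = s.next ∧
      s'.parent = Function.update s.parent h (some p) ∧ s'.reductions = s.reductions ∧
      (∀ X r z, s'.arr X r = some z → s.arr X r = some z) ∧ s'.time ≤ s.time + 50 ∧
      DecDelta (s'.phi .A - s.phi .A) (s'.phi .L - s.phi .L) s.overhead s'.overhead := by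
  have hph : p ≠ h := by
    rintro rfl
    exact hk.irrefl
  obtain ⟨q, hq⟩ : ∃ q, s.parent h = some q := by
    rcases hq : s.parent h with _ | q
    · have := hI.root_sub h hh hq
      simp [hhL] at this
    · exact ⟨q, rfl⟩
  have hqV := hI.forest.par_mem h hh q hq
  have hqh : q ≠ h := by
    rintro rfl
    exact (hI.forest.heap q hh q hq).irrefl
  have hlp := hI.viol.loss_ok p hp
  have hlh := hI.viol.loss_ok h hh
  rw [hpL] at hlp
  rw [hhL] at hlh
  change s.loss p = 1 at hlp
  change s.loss h = 1 at hlh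
  obtain ⟨arr1, stk1, phi1, t1, o1, q1, a1, a2, a3, a4, a5, -, a6, -, -, a9, a10, a11, a12⟩ :=
    setViolationSubtype_spec (s := { s with time := s.time + 1 + 1 + 1 }) (taken := true) (S := .N)
      hI.viol hp (by simp [Sub.kind])
  dsimp only at a1 a2 a3 a4 a9 a10 a11 a12
  have hq1 : q1 = 0 := a6 rfl
  have ha1 : ∀ X r, arr1 X r ≠ some p := fun X r h1 => ((a4 X r p).1 h1).2 rfl
  have hv2 := a3.setRank (r := s.rank p + 1) ha1 (Or.inr (by simp [Sub.kind]))
  have hsubh : Function.update s.sub p .N h = .L1 := by simp [hph.symm, hhL]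
  obtain ⟨child2, roots2, left2, right2, arr2, stk2, phi2, t2, o2, b1, b2, b3, b4, b5, -, b7⟩ :=
    cutFromParent_of_ne_A (s := s.withViol (Function.update s.rank p (s.rank p + 1))
      (Function.update s.sub p .N) (Function.update s.loss p Sub.N.startLoss) arr1 stk1 phi1 (t1 + 1)
      o1) hh (by simp [hsubh]) hq hqV (by simp [hqh]) hI.lists hv2
  dsimp only at b1 b2 b4 b5 b7
  set rank2 := Function.update (Function.update s.rank p (s.rank p + 1)) q
    (Function.update s.rank p (s.rank p + 1) q - 1) with hrank2
  set sub2 := Function.update (Function.update s.sub p .N) q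
    (decSub (Function.update s.sub p .N q)) with hsub2
  set loss2 := Function.update (Function.update s.loss p Sub.N.startLoss) q
    (decLoss (Function.update s.sub p .N q) (Function.update s.loss p Sub.N.startLoss q)) with hloss2
  obtain ⟨child3, roots3, left3, right3, t3, c1, c2, c3⟩ := attach_spec
    (s := (s.withViol rank2 sub2 loss2 arr2 stk2 phi2 t2 o2).withTree
      (Function.update s.parent h none) child2 roots2 left2 right2 t2) hh hp b3
  obtain ⟨arr4, stk4, phi4, t4, o4, q4, d1, d2, d3, d4, d5, -, d7, -, -, d9, d10, d11, d12⟩ :=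
    setViolationSubtype_spec (s := (s.withViol rank2 sub2 loss2 arr2 stk2 phi2 t2 o2).withTree
      (Function.update s.parent h (some p)) child3 roots3 left3 right3 (t3 + 1)) (taken := false)
      (S := .N) b4 hh (by simp [Sub.kind])
  simp only [Function.update_idem] at c1 c3
  dsimp only at c1 c2 d1 d2 d3 d4 d9 d10 d11 d12
  have hq4 : q4 = 0 := d7 rfl
  have hsub2h : sub2 h = .L1 := by simp [hsub2, hqh.symm, hph.symm, hhL]
  have hloss2h : loss2 h = 1 := by simp [hloss2, hqh.symm, hph.symm, hlh]
  have hne : ∀ {x}, s.sub x = .L1 → (∀ r, s.arr .L r ≠ some x) → ∀ X r, s.arr X r ≠ some x := by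
    intro x hx hxa X r h1
    cases X
    · have := (hI.viol.arr_spec _ _ _ h1).2.2.2
      simp [hx, Sub.kind] at this
    · exact hxa r h1
  have hip : ∀ X, inArr s.arr s.rank X p = 0 := fun X => inArr_eq_zero (hne hpL hpa X)
  have hih : ∀ X, inArr arr2 rank2 X h = 0 := fun X => inArr_eq_zero fun r h1 =>
    hne hhL hha X r ((a4 X r h).1 (b5 X r h h1)).1
  rw [hip] at a10 a11 a12
  rw [hip, hq1] at a12
  rw [hih] at d10 d11 d12
  rw [hih, hq4] at d12
  rw [hlp] at a11
  rw [hloss2h] at d11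
  simp only [Sub.kind, Sub.startLoss, reduceCtorEq, if_false] at a10 a11 d10 d11
  refine ⟨(s.withViol rank2 (Function.update sub2 h .N) (Function.update loss2 h Sub.N.startLoss) arr4
    stk4 phi4 t4 o4).withTree (Function.update s.parent h (some p)) child3 roots3 left3 right3 t4,
    ?run, ⟨hI.lt_next, hI.forest.attach hp hk, c3, d3.drop ?_, ?_, ?_⟩, rfl, rfl, rfl, rfl,
    ?_, ?_, ?_⟩
  case run =>
    rw [linkBelow_of_le hr.le]
    simp only [hpL, if_true]
    rw [a1]
    simp only [Option.bind_some, setRank, wr_apply]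
    erw [b1]
    simp only [Option.bind_some]
    erw [c1]
    simp only [Option.bind_some, hsub2h, ne_eq, reduceCtorEq, not_false_eq_true, if_true, bind_apply]
    erw [d1]
    rfl
  · rintro y ⟨⟨h1, h2⟩, h3⟩
    rcases h1 with h4 | h4
    · exact absurd h4 h2
    · exact absurd h4 h3
  · have hrph : rankParent s.sub s.parent h = some q := by simp [rankParent, hhL, hq]
    have hpos := hI.ranked.pos hh hqV hrph
    have hR := ((hI.ranked.remove hh hrph).congr (rk' := Function.update s.rank q (s.rank q - 1))
      (val' := fun c => rank2 c + Function.update loss2 h Sub.N.startLoss c) (fun _ _ => rfl)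
      (fun _ _ => rfl) ?_).add hh (by simp) hp ?_
    · refine hR.congr (fun c _ => ?_) (fun c _ => ?_) (fun _ _ _ => le_rfl)
      · by_cases hcp : c = p <;> by_cases hcq : c = q <;> by_cases hpq : p = q <;>
          simp_all [Function.update_apply]
      · by_cases hch : c = h
        · simp [rankParent, hch]
        · simp only [rankParent, hch, ne_eq, not_false_eq_true, Function.update_of_ne]
          congr 1
          by_cases hcq : c = q
          · subst hcq
            simp only [hsub2, Function.update_self, eq_iff_iff]
            by_cases hcp : c = p
            · subst hcp
              simp [decSub, hpL]
            · simp only [Function.update_of_ne hcp]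
              cases s.sub c <;> simp [decSub]
          · by_cases hcp : c = p
            · subst hcp
              simp [hsub2, hcq, hpL]
            · simp [hsub2, hcq, hcp]
    · intro c _ hc
      have hch : c ≠ h := by
        rintro rfl
        simp at hc
      simp only [Function.update_of_ne hch] at hc ⊢
      by_cases hcq : c = q
      · subst hcq
        by_cases hcp : c = p
        · subst hcp
          simp [hrank2, hloss2, decLoss, hlp, Sub.startLoss]
        · have hcA : s.sub c ≠ .A := by
            intro h1
            simp [rankParent, h1] at hc
          simp [hrank2, hloss2, decLoss, hcp, hcA]
          omega
      · by_cases hcp : c = p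
        · subst hcp
          simp [hrank2, hloss2, hcq, hlp, Sub.startLoss]
        · simp [hrank2, hloss2, hcq, hcp]
    · have h1 : rank2 h = s.rank h := by simp [hrank2, hqh.symm, hph.symm]
      simp only [Function.update_self, h1]
      by_cases hpq : p = q
      · subst hpq
        simp
        omega
      · simp [hpq]
        omega
  · intro x hx hpx
    by_cases hxh : x = h
    · simp [hxh] at hpx
    · simp only [Function.update_of_ne hxh] at hpx ⊢
      have hxA := hI.root_sub x hx hpx
      have hxp : x ≠ p := by
        rintro rfl
        simp [hpL] at hxA
      by_cases hxq : x = q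
      · subst hxq
        simp [hsub2, hxp, hxA, decSub]
      · simp [hsub2, hxp, hxA, hxq]
  · intro X r z h1
    exact ((a4 X r z).1 (b5 X r z ((d4 X r z).1 h1).1)).1
  · dsimp only
    omega
  · dsimp only
    simp at a10 a11 d10 d11
    rw [d10, d11, d12, ← a10, ← a11]
    simpa [a12] using b7

end

/-! ### Stack reductions -/

section

variable {α : Type u} {V : Finset ℕ} {T : Set ℕ} {s : State α}

/-- The elements and their keys are kept, and no node becomes a tree root. -/
structure Keeps (V : Finset ℕ) (s s' : State α) : Prop where
  key : s'.key = s.key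
  next : s'.next = s.next
  root : ∀ x ∈ V, s'.parent x = none → s.parent x = none

theorem Keeps.refl (V : Finset ℕ) (s : State α) : Keeps V s s := ⟨rfl, rfl, fun _ _ h => h⟩

theorem Keeps.trans {s₁ s₂ s₃ : State α} (h1 : Keeps V s₁ s₂) (h2 : Keeps V s₂ s₃) :
    Keeps V s₁ s₃ :=
  ⟨h2.key.trans h1.key, h2.next.trans h1.next, fun x hx h => h1.root x hx (h2.root x hx h)⟩

theorem Keeps.of_parent {s' : State α} {p h : ℕ} (h1 : s'.key = s.key) (h2 : s'.next = s.next)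
    (h3 : s'.parent = Function.update s.parent h (some p)) : Keeps V s s' := by
  refine ⟨h1, h2, fun x _ hx => ?_⟩
  rw [h3] at hx
  by_cases hxh : x = h
  · simp [hxh] at hx
  · simpa [hxh] using hx

/-- The number of items of `C[A]` whose node is no longer of subtype `A`. -/
def stale (s : State α) : ℕ := (s.stk .A).countP fun x => s.sub x ≠ .A

/-- `Φ_A`, where stale items of `C[A]` have weight `1` instead of `2`. -/
def psi (s : State α) : ℤ := s.phi .A - stale s

theorem countP_update_le {sub : ℕ → Sub} {h : ℕ} (l : List ℕ) :
    l.countP (fun x => sub x ≠ .A) ≤ l.countP fun x => Function.update sub h .N x ≠ .A := by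
  refine List.countP_mono_left fun x _ hx => ?_
  by_cases hxh : x = h <;> simp_all

theorem countP_update_lt {sub : ℕ → Sub} {h : ℕ} (hA : sub h = .A) :
    ∀ {l : List ℕ}, h ∈ l →
      l.countP (fun x => sub x ≠ .A) + 1 ≤ l.countP fun x => Function.update sub h .N x ≠ .A
  | a :: l, hl => by
    rw [List.countP_cons, List.countP_cons]
    by_cases ha : a = h
    · subst ha
      have := countP_update_le (sub := sub) (h := a) l
      simp [hA] at this ⊢
      omega
    · have := countP_update_lt hA (l := l) ((List.mem_cons.1 hl).resolve_left (Ne.symm ha))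
      simp [ha] at this ⊢
      omega

theorem pop_apply {X : Kind} {x : ℕ} {l : List ℕ} (h : s.stk X = x :: l) :
    pop X s = some (x, { s with
      stk := Function.update s.stk X l
      phi := Function.update s.phi X (s.phi X - X.stkWeight)
      time := s.time + 1 }) := by
  simp [pop, h]

variable [LinearOrder α]

theorem Inv.with_viol (hI : Inv s V T) {arr : Kind → ℕ → Option ℕ} {stk : Kind → List ℕ}
    {phi : Kind → ℤ} {T' : Set ℕ} (t o r : ℕ) (hv : Viol s.rank s.sub s.loss arr stk phi V T') :
    Inv { s with arr := arr, stk := stk, phi := phi, time := t, overhead := o, reductions := r }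
      V T' :=
  ⟨hI.lt_next, hI.forest, hI.lists, hv, hI.ranked, hI.root_sub⟩

/-- By the last conjunct, a reduction that puts a node into `R[A]` has overhead at most `1`. -/
theorem reduceA_spec (hI : Inv s V ∅) (hs : s.stk .A ≠ []) :
    ∃ s', reduceA s = some ((), s') ∧ Inv s' V ∅ ∧ Keeps V s s' ∧
      s'.reductions = s.reductions + 1 ∧ s'.time ≤ s.time + 70 ∧ s'.stk .L = s.stk .L ∧
      s'.phi .L = s.phi .L ∧ s'.phi .A + 1 ≤ s.phi .A ∧ psi s' + 1 ≤ psi s ∧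
      s'.overhead ≤ s.overhead + 2 ∧
      (∀ r z, s'.arr .A r = some z → (∃ r, s.arr .A r = some z) ∨
        s'.overhead ≤ s.overhead + 1) := by
  obtain ⟨x, l, hl⟩ := List.exists_cons_of_ne_nil hs
  have hpop : ∀ t r, pop .A { s with time := t, reductions := r } = some (x, { s with
      stk := Function.update s.stk .A l
      phi := Function.update s.phi .A (s.phi .A - Kind.A.stkWeight)
      time := t + 1, reductions := r }) := fun t r =>
    pop_apply (s := { s with time := t, reductions := r }) hl
  have hst : stale s = l.countP (fun x => s.sub x ≠ .A) + if s.sub x ≠ .A then 1 else 0 := by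
    simp [stale, hl, List.countP_cons]
  by_cases hA : s.sub x = .A
  · have hxV : x ∈ V := (hI.viol.stk_spec .A x (by simp [hl])).resolve_right (by simp [hA])
    rcases he : s.arr .A (s.rank x) with _ | y
    · have hv := (hI.viol.pop hl (T' := {x}) (by simp) (Or.inl rfl)).store (T' := ∅) hxV he
        (by simp [hA, Sub.kind]) (by simp [hA]) (by simp)
      refine ⟨_, ?_, hI.with_viol (s.time + 1 + 1 + 1 + 1 + 1 + 1) (s.overhead + 1)
        (s.reductions + 1) hv,
        ⟨rfl, rfl, fun _ _ h => h⟩, rfl, by simp, by simp, by simp, ?_, ?_, by simp, by simp⟩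
      · simp only [reduceA, countReduction, bind_apply, wr_apply, Option.bind_some, hpop, getSub,
          rd_apply, hA, getRank, getArr, he, setArr]
        rfl
      · simp [he, occupied, Kind.arrWeight, Kind.stkWeight]
        omega
      · simp only [psi, hst]
        simp [stale, he, hA, occupied, Kind.arrWeight, Kind.stkWeight]
        omega
    · by_cases hyx : y = x
      · subst hyx
        have hv := hI.viol.pop hl (T' := ∅) (by simp) (Or.inr (Or.inr he))
        refine ⟨_, ?_, hI.with_viol (s.time + 1 + 1 + 1 + 1 + 1) s.overhead
          (s.reductions + 1) hv,
          ⟨rfl, rfl, fun _ _ h => h⟩, rfl, by simp, by simp, by simp, ?_, ?_, by simp, by simp⟩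
        · simp only [reduceA, countReduction, bind_apply, wr_apply, Option.bind_some, hpop, getSub,
            rd_apply, hA, getRank, getArr, he, if_true, pure_apply]
        · simp [Kind.stkWeight]
        · simp only [psi, hst]
          simp [stale, hA, Kind.stkWeight]
      · obtain ⟨hyV, hyr, -, hyk⟩ := hI.viol.arr_spec _ _ _ he
        have hyA : s.sub y = .A := by
          cases hy : s.sub y <;> rw [hy] at hyk <;> simp [Sub.kind] at hyk ⊢
        have hxa := hI.viol.not_mem_arr (x := x) fun X hX h1 => by
          rw [hA] at hX
          obtain rfl := Option.some.inj hX
          rw [he] at h1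
          exact hyx (Option.some.inj h1)
        have hv := (hI.viol.pop hl (T' := {x}) (by simp) (Or.inl rfl)).clearArr he
        have hI2 := fun t => hI.with_viol t (s.overhead + 1) (s.reductions + 1) hv
        have hya : ∀ r, arrSet s.arr .A (s.rank x) none .A r ≠ some y := by
          intro r h1
          rw [arrSet_apply] at h1
          split_ifs at h1 with h2
          have h3 := (hI.viol.arr_spec _ _ _ h1).2.1
          exact h2 ⟨rfl, by omega⟩
        have hxa' : ∀ r, arrSet s.arr .A (s.rank x) none .A r ≠ some x := by
          intro r h1
          rw [arrSet_apply] at h1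
          split_ifs at h1 with h2
          exact hxa _ _ h1
        have hmono : ∀ r z, arrSet s.arr .A (s.rank x) none .A r = some z → s.arr .A r = some z := by
          intro r z h1
          rw [arrSet_apply] at h1
          split_ifs at h1
          exact h1
        obtain ⟨p, h, s', hph, hlink, hI', h1, h2, h3, h4, h5, h6, h7, h8, h9⟩ :=
          exists_link_of_linkBelow (taken := true)
          (s := { s with
            stk := Function.update s.stk .A l
            phi := Function.update (Function.update s.phi .A (s.phi .A - Kind.A.stkWeight)) .A
              (Function.update s.phi .A (s.phi .A - Kind.A.stkWeight) .A +
                Kind.A.arrWeight * (occupied none - occupied (s.arr .A (s.rank x))))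
            arr := arrSet s.arr .A (s.rank x) none
            time := s.time + 1 + 1 + 1 + 1 + 1 + 1
            overhead := s.overhead + 1, reductions := s.reductions + 1 })
          (hI.forest.key_some x hxV) (hI.forest.key_some y hyV) (Ne.symm hyx)
          (fun p h hph hk => linkBelow_A_spec (taken := true)
            (hI2 _) (by rcases hph with ⟨rfl, rfl⟩ | ⟨rfl, rfl⟩ <;> assumption)
            (by rcases hph with ⟨rfl, rfl⟩ | ⟨rfl, rfl⟩ <;> assumption) hk
            (by rcases hph with ⟨rfl, rfl⟩ | ⟨rfl, rfl⟩ <;> assumption)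
            (by rcases hph with ⟨rfl, rfl⟩ | ⟨rfl, rfl⟩ <;> assumption)
            (by rcases hph with ⟨rfl, rfl⟩ | ⟨rfl, rfl⟩ <;> simp)
            (by rcases hph with ⟨rfl, rfl⟩ | ⟨rfl, rfl⟩ <;> simp [Set.pair_comm])
            (by rcases hph with ⟨rfl, rfl⟩ | ⟨rfl, rfl⟩ <;> simp [hyr]))
        have hrk : ¬ s.rank h < s.rank p := by
          rcases hph with ⟨rfl, rfl⟩ | ⟨rfl, rfl⟩ <;> simp [hyr]
        obtain ⟨q, k1, -, -, k2, k3, k4, k5⟩ := h9.resolve_left fun h => hrk h.2.2.2.2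
        have hi : ∀ z, z = p ∨ z = h → inArr (arrSet s.arr .A (s.rank x) none) s.rank .A z = 0 := by
          intro z hz
          refine inArr_eq_zero ?_
          rcases hph with ⟨rfl, rfl⟩ | ⟨rfl, rfl⟩ <;> rcases hz with rfl | rfl <;> assumption
        dsimp only at h1 h2 h3 h4 h5 h6 h7 h8 k2 k3 k4 k5
        rw [hi p (Or.inl rfl), hi h (Or.inr rfl)] at k2 k3
        simp [he, occupied, Kind.arrWeight, Kind.stkWeight] at k2
        refine ⟨s', ?_, hI', Keeps.of_parent h1 h2 h3, h4, by omega, by simpa using h5,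
          by simpa using h6, by omega, ?_, by omega, ?_⟩
        · simp only [reduceA, countReduction, bind_apply, wr_apply, Option.bind_some, hpop, getSub,
            rd_apply, hA, getRank, getArr, he, setArr, if_neg hyx]
          have hlink' := hlink
          simp only [he] at hlink'
          erw [hlink']
          rfl
        · have hle : l.countP (fun x => s.sub x ≠ .A) ≤ stale s' := by
            rw [stale, k4, k5]
            refine (countP_update_le (h := h) l).trans ?_
            rw [Function.update_self]
            split_ifs
            · rw [List.countP_cons]
              omega
            · exact le_rfl
          simp only [hA, ne_eq, not_true, if_false] at hst hle
          simp only [psi, hst]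
          omega
        · intro r z h10
          exact Or.inl ⟨r, hmono r z (h7 .A r z h10)⟩
  · have hk : (s.sub x).kind ≠ some .A := by
      cases hx : s.sub x <;> simp [Sub.kind] <;> exact hA hx
    have hv := hI.viol.pop hl (T' := ∅) (by simp) (Or.inr (Or.inl hk))
    refine ⟨_, ?_, hI.with_viol (s.time + 1 + 1 + 1) s.overhead (s.reductions + 1) hv,
      ⟨rfl, rfl, fun _ _ h => h⟩, rfl, by simp, by simp, by simp, ?_, ?_, by simp, by simp⟩
    · cases hx : s.sub x
      · exact absurd hx hA
      all_goals simp only [reduceA, countReduction, bind_apply, wr_apply, Option.bind_some, hpop,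
        getSub, rd_apply, hx, pure_apply]
    · simp [Kind.stkWeight]
    · simp only [psi, hst]
      simp [stale, hA, Kind.stkWeight]
      omega

/-- The changes of `Φ_A`, `Φ_L` and the overhead in a reduction of `C[L]`. The disjunction lists
the cost (the overhead, and `2` per unit of `Φ_A`, which is what the reductions of `C[A]` will pay
for it) by the decrease of `Φ_L`. -/
def ReduceLDelta (s s' : State α) : Prop :=
  s.phi .A ≤ s'.phi .A ∧ s'.phi .A ≤ s.phi .A + 3 ∧ s'.overhead ≤ s.overhead + 3 ∧
    s'.phi .A + s'.phi .L + 1 ≤ s.phi .A + s.phi .L ∧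
    ((s'.phi .L + 1 ≤ s.phi .L ∧ s'.overhead + 2 * s'.phi .A ≤ s.overhead + 2 * s.phi .A + 1) ∨
      (s'.phi .L + 2 ≤ s.phi .L ∧ s'.overhead + 2 * s'.phi .A ≤ s.overhead + 2 * s.phi .A + 3) ∨
      (s'.phi .L + 3 ≤ s.phi .L ∧ s'.overhead + 2 * s'.phi .A ≤ s.overhead + 2 * s.phi .A + 7) ∨
      (s'.phi .L + 7 ≤ s.phi .L ∧ s'.overhead + 2 * s'.phi .A ≤ s.overhead + 2 * s.phi .A + 9))

theorem reduceL_spec (hI : Inv s V ∅) (hs : s.stk .L ≠ []) :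
    ∃ s', reduceL s = some ((), s') ∧ Inv s' V ∅ ∧ Keeps V s s' ∧
      s'.reductions = s.reductions + 1 ∧ s'.time ≤ s.time + 70 ∧ ReduceLDelta s s' ∧
      (∀ r z, s'.arr .A r = some z → s.arr .A r = some z) := by
  obtain ⟨x, l, hl⟩ := List.exists_cons_of_ne_nil hs
  have hpop : ∀ t r, pop .L { s with time := t, reductions := r } = some (x, { s with
      stk := Function.update s.stk .L l
      phi := Function.update s.phi .L (s.phi .L - Kind.L.stkWeight)
      time := t + 1, reductions := r }) := fun t r =>
    pop_apply (s := { s with time := t, reductions := r }) hl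
  have hxV : (s.sub x).kind = some .L → x ∈ V := fun h =>
    (hI.viol.stk_spec .L x (by simp [hl])).resolve_right fun h2 => by simp [h2, Sub.kind] at h
  by_cases h1 : s.sub x = .L1
  · have hxV := hxV (by simp [h1, Sub.kind])
    rcases he : s.arr .L (s.rank x) with _ | y
    · have hv := (hI.viol.pop hl (T' := {x}) (by simp) (Or.inl rfl)).store (T' := ∅) hxV he
        (by simp [h1, Sub.kind]) (by simp [h1]) (by simp)
      refine ⟨_, ?_, hI.with_viol (s.time + 1 + 1 + 1 + 1 + 1 + 1) (s.overhead + 1)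
        (s.reductions + 1) hv,
        ⟨rfl, rfl, fun _ _ h => h⟩, rfl, by simp, ?_, ?_⟩
      · simp only [reduceL, countReduction, bind_apply, wr_apply, Option.bind_some, hpop, getSub,
          rd_apply, h1, getRank, getArr, he, setArr]
        rfl
      · simp [ReduceLDelta, he, occupied, Kind.arrWeight, Kind.stkWeight]
        omega
      · intro r z h2
        simpa [arrSet_apply] using h2
    · by_cases hyx : y = x
      · subst hyx
        have hv := hI.viol.pop hl (T' := ∅) (by simp) (Or.inr (Or.inr he))
        refine ⟨_, ?_, hI.with_viol (s.time + 1 + 1 + 1 + 1 + 1) s.overhead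
          (s.reductions + 1) hv,
          ⟨rfl, rfl, fun _ _ h => h⟩, rfl, by simp, ?_, fun _ _ h => h⟩
        · simp only [reduceL, countReduction, bind_apply, wr_apply, Option.bind_some, hpop, getSub,
            rd_apply, h1, getRank, getArr, he, if_true, pure_apply]
        · simp [ReduceLDelta, Kind.stkWeight]
      · obtain ⟨hyV, hyr, hy2, hyk⟩ := hI.viol.arr_spec _ _ _ he
        have hy1 : s.sub y = .L1 := by
          cases hy : s.sub y <;> rw [hy] at hyk hy2 <;> simp [Sub.kind] at hyk hy2 ⊢
        have hxa := hI.viol.not_mem_arr (x := x) fun X hX h2 => by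
          rw [h1] at hX
          obtain rfl := Option.some.inj hX
          rw [he] at h2
          exact hyx (Option.some.inj h2)
        have hv := (hI.viol.pop hl (T' := {x}) (by simp) (Or.inl rfl)).clearArr he
        have hya : ∀ r, arrSet s.arr .L (s.rank x) none .L r ≠ some y := by
          intro r h1
          rw [arrSet_apply] at h1
          split_ifs at h1 with h2
          have h3 := (hI.viol.arr_spec _ _ _ h1).2.1
          exact h2 ⟨rfl, by omega⟩
        have hxa' : ∀ r, arrSet s.arr .L (s.rank x) none .L r ≠ some x := by
          intro r h1
          rw [arrSet_apply] at h1
          split_ifs at h1 with h2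
          exact hxa _ _ h1
        have hI2 := fun t => hI.with_viol t (s.overhead + 1) (s.reductions + 1) hv
        obtain ⟨p, h, s', hph, hlink, hI', g1, g2, g3, g4, g5, g6, g7⟩ :=
          exists_link_of_linkBelow (taken := true)
          (s := { s with
            stk := Function.update s.stk .L l
            phi := Function.update (Function.update s.phi .L (s.phi .L - Kind.L.stkWeight)) .L
              (Function.update s.phi .L (s.phi .L - Kind.L.stkWeight) .L +
                Kind.L.arrWeight * (occupied none - occupied (s.arr .L (s.rank x))))
            arr := arrSet s.arr .L (s.rank x) none
            time := s.time + 1 + 1 + 1 + 1 + 1 + 1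
            overhead := s.overhead + 1, reductions := s.reductions + 1 })
          (hI.forest.key_some x hxV) (hI.forest.key_some y hyV) (Ne.symm hyx)
          (fun p h hph hk => by
            have hT : (Insert.insert y {x} : Set ℕ) = {p, h} := by
              rcases hph with ⟨rfl, rfl⟩ | ⟨rfl, rfl⟩
              · exact Set.pair_comm _ _
              · rfl
            have hI3 := hI2 (s.time + 1 + 1 + 1 + 1 + 1 + 1 + 1)
            rw [hT] at hI3
            exact linkBelow_L_spec hI3 (by rcases hph with ⟨rfl, rfl⟩ | ⟨rfl, rfl⟩ <;> assumption)
              (by rcases hph with ⟨rfl, rfl⟩ | ⟨rfl, rfl⟩ <;> assumption) hk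
              (by rcases hph with ⟨rfl, rfl⟩ | ⟨rfl, rfl⟩ <;> assumption)
              (by rcases hph with ⟨rfl, rfl⟩ | ⟨rfl, rfl⟩ <;> assumption)
              (by rcases hph with ⟨rfl, rfl⟩ | ⟨rfl, rfl⟩ <;> simp [hyr])
              (by rcases hph with ⟨rfl, rfl⟩ | ⟨rfl, rfl⟩ <;> assumption)
              (by rcases hph with ⟨rfl, rfl⟩ | ⟨rfl, rfl⟩ <;> assumption))
        dsimp only at g1 g2 g3 g4 g5 g6 g7
        simp [DecDelta, he, occupied, Kind.arrWeight, Kind.stkWeight] at g7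
        refine ⟨s', ?_, hI', Keeps.of_parent g1 g2 g3, g4, by omega, ?_, ?_⟩
        · simp only [reduceL, countReduction, bind_apply, wr_apply, Option.bind_some, hpop, getSub,
            rd_apply, h1, getRank, getArr, he, setArr, if_neg hyx]
          have hlink' := hlink
          simp only [he] at hlink'
          erw [hlink']
          rfl
        · simp only [ReduceLDelta]
          omega
        · intro r z h2
          have := g5 .A r z h2
          simpa [arrSet_apply] using this
  by_cases h2 : s.sub x = .L2
  · have hxV := hxV (by simp [h2, Sub.kind])
    obtain ⟨p, hp⟩ : ∃ p, s.parent x = some p := by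
      rcases hq : s.parent x with _ | q
      · have := hI.root_sub x hxV hq
        simp [h2] at this
      · exact ⟨q, rfl⟩
    have hpV := hI.forest.par_mem x hxV p hp
    have hpx : p ≠ x := by
      rintro rfl
      exact (hI.forest.heap p hxV p hp).irrefl
    have hlo := hI.viol.loss_ok x hxV
    rw [h2] at hlo
    change 2 ≤ s.loss x at hlo
    have hv := hI.viol.pop hl (T' := {x}) (by simp) (Or.inl rfl)
    obtain ⟨arr1, stk1, phi1, t1, o1, q1, a1, a2, a3, a4, a5, a6, -, -, -, -, a10, a11, a12⟩ :=
      setViolationSubtype_spec (s := { s with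
        stk := Function.update s.stk .L l
        phi := Function.update s.phi .L (s.phi .L - Kind.L.stkWeight)
        time := s.time + 1 + 1 + 1 + 1, reductions := s.reductions + 1 }) (taken := false) (S := .A)
        hv hxV (by simp [h2, Sub.kind])
    dsimp only at a1 a2 a3 a4 a10 a11 a12
    simp only [Set.sdiff_self] at a3
    obtain ⟨arr2, stk2, phi2, t2, o2, b1, b2, b3, b4, -, b6⟩ := decrementRank_spec
      (s := { s with
        sub := Function.update s.sub x .A
        loss := Function.update s.loss x Sub.A.startLoss
        stk := stk1, phi := phi1, arr := arr1, time := t1, overhead := o1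
        reductions := s.reductions + 1 }) a3 hpV (by simp)
    dsimp only at b1 b2 b3 b4 b6
    have hiA := inArr_eq_zero_of_sub hI.viol (X := .A) (x := x) (by simp [h2, Sub.kind])
    have hiL : inArr s.arr s.rank .L x = 0 := inArr_eq_zero fun r h3 =>
      (hI.viol.arr_spec _ _ _ h3).2.2.1 h2
    rw [hiA] at a10
    rw [hiL] at a11
    rw [hiA, hiL] at a12
    simp [Sub.kind, Kind.stkWeight, Sub.startLoss] at a10 a11
    simp only [Function.update_of_ne hpx] at b1 b3
    refine ⟨{ s with
        rank := Function.update s.rank p (s.rank p - 1)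
        sub := Function.update (Function.update s.sub x .A) p (decSub (s.sub p))
        loss := Function.update (Function.update s.loss x Sub.A.startLoss) p
          (decLoss (s.sub p) (s.loss p))
        arr := arr2, stk := stk2, phi := phi2, time := t2, overhead := o2
        reductions := s.reductions + 1 }, ?_, ⟨hI.lt_next, hI.forest, hI.lists, b3, ?_, ?_⟩,
        ⟨rfl, rfl, fun _ _ h => h⟩, rfl, ?_, ?_, ?_⟩
    · simp only [reduceL, countReduction, bind_apply, wr_apply, Option.bind_some, hpop, getSub,
        rd_apply, h2, getParent, hp, target_some]
      erw [a1]
      simp only [Option.bind_some]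
      exact b1
    · have hrpx : rankParent s.sub s.parent x = some p := by simp [rankParent, h2, hp]
      have hpos := hI.ranked.pos hxV hpV hrpx
      refine (hI.ranked.remove hxV hrpx).congr (fun _ _ => rfl) (fun c _ => ?_) fun c _ hc => ?_
      · by_cases hcx : c = x
        · simp [rankParent, hcx, hpx.symm]
        · simp only [rankParent, hcx, ne_eq, not_false_eq_true, Function.update_of_ne]
          congr 1
          by_cases hcp : c = p
          · subst hcp
            simp only [Function.update_self, eq_iff_iff]
            cases s.sub c <;> simp [decSub]
          · simp [hcp, hcx]
      · have hcx : c ≠ x := by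
          rintro rfl
          simp at hc
        simp only [Function.update_of_ne hcx] at hc
        by_cases hcp : c = p
        · subst hcp
          have hcA : s.sub c ≠ .A := by
            intro h1
            simp [rankParent, h1] at hc
          simp [decLoss, hcA]
          omega
        · simp [hcp, hcx]
    · intro z hz hzr
      have hzA := hI.root_sub z hz hzr
      have hzx : z ≠ x := by
        rintro rfl
        simp [h2] at hzA
      by_cases hzp : z = p
      · subst hzp
        simp [hzA, decSub]
      · simp [hzp, hzx, hzA]
    · dsimp only
      omega
    · simp only [ReduceLDelta]
      simp only [DecDelta] at b6
      omega
    · intro r z h3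
      exact ((a4 .A r z).1 (b4 .A r z h3)).1
  · have hk : (s.sub x).kind ≠ some .L := by
      cases hx : s.sub x <;> simp [Sub.kind] <;> first | exact h1 hx | exact h2 hx
    have hv := hI.viol.pop hl (T' := ∅) (by simp) (Or.inr (Or.inl hk))
    refine ⟨_, ?_, hI.with_viol (s.time + 1 + 1 + 1) s.overhead (s.reductions + 1) hv,
      ⟨rfl, rfl, fun _ _ h => h⟩, rfl, by simp, ?_, fun _ _ h => h⟩
    · cases hx : s.sub x
      case L1 => exact absurd hx h1
      case L2 => exact absurd hx h2
      all_goals simp only [reduceL, countReduction, bind_apply, wr_apply, Option.bind_some, hpop,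
        getSub, rd_apply, hx, pure_apply]
    · simp [ReduceLDelta, Kind.stkWeight]

end

/-! ### Loops -/

section

variable {α : Type u}

theorem loop_eq {β : Type} (step : β → Prog α (Option β)) (b : β) (s : State α) :
    loop step b s = (step b s).bind fun r =>
      match r.1 with
      | none => some ((), r.2)
      | some b' => loop step b' r.2 := by
  rw [loop]
  rfl

/-- A loop with an invariant `I`, a measure `m` that decreases, and a postcondition `Q`. -/
theorem whileLoop_spec {guard : Prog α Bool} {body : Prog α Unit} {I Q : State α → Prop}
    (m : State α → ℕ)
    (h : ∀ s, I s → (∃ s', guard s = some (false, s') ∧ Q s') ∨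
      ∃ s₁ s₂, guard s = some (true, s₁) ∧ body s₁ = some ((), s₂) ∧ I s₂ ∧ m s₂ < m s)
    (s : State α) (hs : I s) : ∃ s', whileLoop guard body s = some ((), s') ∧ Q s' := by
  induction hn : m s using Nat.strong_induction_on generalizing s with
  | _ n ih =>
    rcases h s hs with ⟨s', h1, h2⟩ | ⟨s₁, s₂, h1, h2, h3, h4⟩
    · refine ⟨s', ?_, h2⟩
      rw [whileLoop, loop_eq]
      simp only [bind_apply, h1, Option.bind_some, Bool.false_eq_true, if_false, pure_apply]
    · obtain ⟨s', h5, h6⟩ := ih (m s₂) (hn ▸ h4) s₂ h3 rfl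
      refine ⟨s', ?_, h6⟩
      rw [whileLoop, loop_eq]
      simp only [bind_apply, h1, h2, Option.bind_some, if_true, pure_apply]
      exact h5

/-- In the invariant `I k` and in the postcondition `Q k`, `k` is the number of repetitions
so far. -/
theorem upTo_spec {guard : Prog α Bool} {body : Prog α Unit} {I Q : ℕ → State α → Prop}
    (h : ∀ k s, I k s → (∃ s', guard s = some (false, s') ∧ Q k s') ∨
      ∃ s₁ s₂, guard s = some (true, s₁) ∧ body s₁ = some ((), s₂) ∧ I (k + 1) s₂) :
    ∀ (m k : ℕ) (s : State α), I k s →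
      ∃ s', upTo guard body m s = some ((), s') ∧ (I (k + m) s' ∨ ∃ j ≤ k + m, Q j s')
  | 0, _, s, hs => ⟨s, rfl, Or.inl hs⟩
  | m + 1, k, s, hs => by
    rcases h k s hs with ⟨s', h1, h2⟩ | ⟨s₁, s₂, h1, h2, h3⟩
    · refine ⟨s', ?_, Or.inr ⟨k, Nat.le_add_right _ _, h2⟩⟩
      simp only [upTo, bind_apply, h1, Option.bind_some, Bool.false_eq_true, if_false, pure_apply]
    · obtain ⟨s', h5, h6⟩ := upTo_spec h m (k + 1) s₂ h3
      refine ⟨s', ?_, ?_⟩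
      · simp only [upTo, bind_apply, h1, h2, Option.bind_some, if_true]
        exact h5
      · rwa [Nat.add_right_comm, Nat.add_assoc] at h6

variable [LinearOrder α] {V : Finset ℕ} {s : State α}

theorem Forest.exists_min {key : ℕ → Option α} (hk : ∀ x ∈ V, ∃ a, key x = some a)
    (hV : V.Nonempty) : ∃ x ∈ V, ∀ y ∈ V, y ≠ x → KeyBelow key x y := by
  induction hV using Finset.Nonempty.cons_induction with
  | singleton a => exact ⟨a, by simp, by simp⟩
  | cons a W ha hW ih =>
    obtain ⟨x, hx, h1⟩ := ih fun y hy => hk y (by simp [hy])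
    have hxa : x ≠ a := by
      rintro rfl
      exact ha hx
    rcases KeyBelow.total (hk x (by simp [hx])) (hk a (by simp)) hxa with h2 | h2
    · refine ⟨x, by simp [hx], fun y hy hyx => ?_⟩
      rcases Finset.mem_cons.1 hy with rfl | hy
      · exact h2
      · exact h1 y hy hyx
    · refine ⟨a, by simp, fun y hy hya => ?_⟩
      have hy := (Finset.mem_cons.1 hy).resolve_left hya
      by_cases hyx : y = x
      · exact hyx ▸ h2
      · exact h2.trans (h1 y hy hyx)

/-- The node with the smallest key is a tree root. -/
theorem Forest.exists_min_root {key : ℕ → Option α} {P : ℕ → Option ℕ} (hF : Forest key V P)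
    (hV : V.Nonempty) : ∃ x ∈ V, P x = none ∧ ∀ y ∈ V, y ≠ x → KeyBelow key x y := by
  obtain ⟨x, hx, h1⟩ := Forest.exists_min hF.key_some hV
  refine ⟨x, hx, ?_, h1⟩
  rcases hp : P x with _ | p
  · rfl
  · have h2 := hF.heap x hx p hp
    have hpx : p ≠ x := by
      rintro rfl
      exact h2.irrefl
    exact absurd (h2.trans (h1 p (hF.par_mem x hx p hp) hpx)) KeyBelow.irrefl

/-! ### The tree roots get subtype `A` -/

/-- The invariant `Inv` before phase 0 of FindMin, when subtypes and parent pointers of the tree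
roots may be out of date. The forest is given by the parent function `P`. -/
structure PreInv (s : State α) (V : Finset ℕ) (P : ℕ → Option ℕ) : Prop where
  lt_next : ∀ x ∈ V, x < s.next
  forest : Forest s.key V P
  lists : Lists s.child s.roots s.left s.right V V P
  viol : Viol s.rank s.sub s.loss s.arr s.stk s.phi V ∅
  ranked : Ranked s.rank (fun c => s.rank c + s.loss c) V (rankParent s.sub P)
  parent_eq : ∀ x ∈ V, P x ≠ none → s.parent x = P x

/-- Phase 0 of FindMin. -/
def clearRoots (start : Option ℕ) : Prog α Unit :=
  loop (fun cur : Option ℕ => do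
    match cur with
    | none => pure none
    | some x => do
      setParent x none
      let O ← getSub x
      if O ≠ .A then
        setViolationSubtype false x .A
      let y ← getRight x
      pure (some y)) start

/-- The changes in phase 0 of FindMin, if `k` roots do not have subtype `A`. -/
def ClearDelta (s s' : State α) (k : ℕ) : Prop :=
  s'.phi .A ≤ s.phi .A + 2 * k ∧ s'.phi .L ≤ s.phi .L ∧
    3 * (s'.overhead : ℤ) + s'.phi .L ≤ 3 * s.overhead + s.phi .L + 3 * k ∧
    s'.overhead ≤ s.overhead + 2 * k

theorem clearRoots_step {P : ℕ → Option ℕ} (h : PreInv s V P) {x : ℕ} (hx : x ∈ V)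
    (hxP : P x = none) (start : Option ℕ) (hR : s.right x = start) :
    ∃ s', (∀ s'', clearRoots start s' = some ((), s'') → clearRoots (some x) s = some ((), s'')) ∧
      PreInv s' V P ∧ s'.key = s.key ∧ s'.next = s.next ∧ s'.reductions = s.reductions ∧
      s'.left = s.left ∧ s'.right = s.right ∧
      s'.parent = Function.update s.parent x none ∧ s'.sub = Function.update s.sub x .A ∧
      s'.time ≤ s.time + 9 ∧ (∀ r z, s'.arr .A r = some z → s.arr .A r = some z) ∧
      ClearDelta s s' (if s.sub x ≠ .A then 1 else 0) ∧
      (s.sub x = .A ∨ s.sub x = .N → s'.phi .L = s.phi .L) := by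
  have hpar : ∀ y ∈ V, P y ≠ none → Function.update s.parent x none y = P y := by
    intro y hy hyP
    have hyx : y ≠ x := by
      rintro rfl
      exact hyP hxP
    rw [Function.update_of_ne hyx, h.parent_eq y hy hyP]
  by_cases hA : s.sub x = .A
  · refine ⟨{ s with parent := Function.update s.parent x none, time := s.time + 1 + 1 + 1 }, ?_,
      ⟨h.lt_next, h.forest, h.lists, h.viol, h.ranked, hpar⟩, rfl, rfl, rfl, rfl, rfl, rfl, ?_,
      by simp, fun _ _ h => h, by simp [ClearDelta, hA], by simp⟩
    · intro s'' h1
      rw [clearRoots, loop_eq]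
      simp only [setParent, wr_apply, bind_apply, getSub, rd_apply, hA, ne_eq, not_true, if_false,
        Option.bind_some, getRight, hR, pure_apply]
      exact h1
    · rw [← hA, Function.update_eq_self]
  · obtain ⟨arr1, stk1, phi1, t1, o1, q1, a1, a2, a3, a4, -, a6, -, -, -, -, a10, a11, a12⟩ :=
      setViolationSubtype_spec (s := { s with
        parent := Function.update s.parent x none, time := s.time + 1 + 1 }) (taken := false)
        (S := .A) h.viol hx (by simp)
    dsimp only at a1 a2 a3 a4 a10 a11 a12
    have hiA : inArr s.arr s.rank .A x = 0 := inArr_eq_zero_of_sub h.viol (by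
      cases hs : s.sub x <;> simp_all [Sub.kind])
    have hL1 : 1 ≤ inArr s.arr s.rank .L x → s.sub x = .L1 := by
      intro h1
      by_contra h2
      have h3 : inArr s.arr s.rank .L x = 0 := inArr_eq_zero fun r h4 => by
        have := h.viol.arr_spec _ _ _ h4
        cases hs : s.sub x <;> simp_all [Sub.kind]
      omega
    have hle := inArr_le_one (arr := s.arr) (rank := s.rank) (X := .L) (x := x)
    rw [hiA] at a10 a12
    simp [Sub.kind, Sub.startLoss] at a10 a11
    refine ⟨{ s with
        parent := Function.update s.parent x none
        sub := Function.update s.sub x .A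
        loss := Function.update s.loss x Sub.A.startLoss
        arr := arr1, stk := stk1, phi := phi1, time := t1 + 1, overhead := o1 }, ?_,
      ⟨h.lt_next, h.forest, h.lists, by simpa using a3, ?_, hpar⟩, rfl, rfl, rfl, rfl, rfl, rfl, rfl,
      ?_, ?_, ?_, ?_⟩
    · intro s'' h1
      rw [clearRoots, loop_eq]
      simp only [setParent, wr_apply, bind_apply, getSub, rd_apply, hA, ne_eq, not_false_eq_true,
        if_true, Option.bind_some]
      erw [a1]
      simp only [Option.bind_some, getRight, rd_apply, hR, pure_apply]
      exact h1
    · refine h.ranked.congr (fun _ _ => rfl) (fun c _ => ?_) fun c _ hc => ?_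
      · by_cases hcx : c = x
        · simp [rankParent, hcx, hxP]
        · simp [rankParent, hcx]
      · have hcx : c ≠ x := by
          rintro rfl
          simp [rankParent, hxP] at hc
        simp [hcx]
    · dsimp only
      omega
    · exact fun r z h1 => ((a4 .A r z).1 h1).1
    · simp only [ClearDelta, hA, ne_eq, not_false_eq_true, if_true]
      omega
    · intro h1
      have h2 := h1.resolve_left hA
      have hlo := h.viol.loss_ok x hx
      rw [h2] at hlo
      change s.loss x = 0 at hlo
      have h3 : ¬ 1 ≤ inArr s.arr s.rank .L x := fun h3 => by simp [h2] at hL1; omega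
      dsimp only
      rw [hlo] at a11
      simp at a11
      omega

theorem clearRoots_spec_aux {P : ℕ → Option ℕ} : ∀ (B : List ℕ) (s : State α), PreInv s V P →
    (∀ x ∈ B, x ∈ V ∧ P x = none) → (∀ A x B', B = A ++ x :: B' → s.right x = B'.head?) → B.Nodup →
    (∀ x ∈ V, P x = none → x ∉ B → s.parent x = none ∧ s.sub x = .A) →
    ∃ s', clearRoots B.head? s = some ((), s') ∧ Inv s' V ∅ ∧ s'.key = s.key ∧ s'.next = s.next ∧
      s'.reductions = s.reductions ∧ (∀ x ∈ V, s'.parent x = P x) ∧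
      s'.time ≤ s.time + 9 * B.length + 1 ∧
      (∀ r z, s'.arr .A r = some z → s.arr .A r = some z) ∧
      ClearDelta s s' (B.countP fun x => s.sub x ≠ .A) ∧
      ((∀ x ∈ B, s.sub x = .A ∨ s.sub x = .N) → s'.phi .L = s.phi .L)
  | [], s, h, _, _, _, hA => by
    have hpar : ∀ x ∈ V, s.parent x = P x := by
      intro x hx
      rcases hP : P x with _ | p
      · exact (hA x hx hP (by simp)).1
      · rw [h.parent_eq x hx (by simp [hP]), hP]
    refine ⟨s, ?_, ⟨h.lt_next, ?_, h.lists.congr hpar, h.viol, ?_, ?_⟩, rfl, rfl, rfl, hpar,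
      by simp, fun _ _ h => h, by simp [ClearDelta], fun _ => rfl⟩
    · rw [clearRoots, loop_eq]
      rfl
    · exact ⟨h.forest.key_some, fun x hx p hp => h.forest.par_mem x hx p (hpar x hx ▸ hp),
        fun x hx p hp => h.forest.heap x hx p (hpar x hx ▸ hp)⟩
    · exact h.ranked.congr (fun _ _ => rfl) (fun c hc => by simp [rankParent, hpar c hc])
        fun _ _ _ => le_rfl
    · exact fun x hx hxp => (hA x hx (hpar x hx ▸ hxp) (by simp)).2
  | x :: B, s, h, hB, hR, hn, hA => by
    obtain ⟨hxV, hxP⟩ := hB x (by simp)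
    obtain ⟨s1, a1, a2, a3, a4, a5, -, a7, a8, a9, a10, a11, a12, a13⟩ :=
      clearRoots_step h hxV hxP B.head? (hR [] x B rfl)
    have hxB := (List.nodup_cons.1 hn).1
    have hsub : ∀ y ∈ B, s1.sub y = s.sub y := fun y hy => by
      rw [a9]
      exact update_of_mem hy hxB
    obtain ⟨s2, b1, b2, b3, b4, b5, b6, b7, b8, b9, b10⟩ := clearRoots_spec_aux B s1 a2
      (fun y hy => hB y (by simp [hy]))
      (fun A y B' hy => by rw [a7]; exact hR (x :: A) y B' (by simp [hy])) (List.nodup_cons.1 hn).2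
      (fun y hy hyP hyB => by
        rw [a8, a9]
        by_cases hyx : y = x
        · simp [hyx]
        · simpa [hyx] using hA y hy hyP (by simp [hyx, hyB]))
    refine ⟨s2, a1 s2 b1, b2, b3.trans a3, b4.trans a4, b5.trans a5, b6, ?_,
      fun r z h1 => a11 r z (b8 r z h1), ?_, ?_⟩
    · simp only [List.length_cons]
      omega
    · have hc : (B.countP fun y => decide (s1.sub y ≠ .A)) = B.countP fun y => decide (s.sub y ≠ .A) :=
        List.countP_congr fun y hy => by rw [hsub y hy]
      rw [hc] at b9
      simp only [ClearDelta, List.countP_cons, decide_eq_true_eq] at a12 b9 ⊢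
      push_cast at *
      omega
    · intro h1
      rw [b10 fun y hy => by rw [hsub y hy]; exact h1 y (by simp [hy]), a13 (h1 x (by simp))]

theorem clearRoots_spec {P : ℕ → Option ℕ} (h : PreInv s V P) :
    ∃ s', clearRoots s.roots s = some ((), s') ∧ Inv s' V ∅ ∧ s'.key = s.key ∧ s'.next = s.next ∧
      s'.reductions = s.reductions ∧ (∀ x ∈ V, s'.parent x = P x) ∧
      s'.time ≤ s.time + 9 * (V.filter fun x => P x = none).card + 1 ∧
      (∀ r z, s'.arr .A r = some z → s.arr .A r = some z) ∧
      ClearDelta s s' (V.filter fun x => P x = none ∧ s.sub x ≠ .A).card ∧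
      ((∀ x ∈ V, P x = none → s.sub x = .A ∨ s.sub x = .N) → s'.phi .L = s.phi .L) := by
  obtain ⟨l, h1, h2, h3, h4⟩ := h.lists none (by simp)
  obtain ⟨s', a1, a2, a3, a4, a5, a6, a7, a8, a9, a10⟩ := clearRoots_spec_aux l s h
    (fun x hx => (h4 x).1 hx) (fun A x B hl => (hl ▸ h2).pointers.2) h3
    (fun x hx hP hl => absurd ((h4 x).2 ⟨hx, hP⟩) hl)
  have hl1 : (V.filter fun x => P x = none).card = l.length := by
    rw [← List.toFinset_card_of_nodup h3]
    congr 1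
    ext x
    simp [h4]
  have hl2 : (V.filter fun x => P x = none ∧ s.sub x ≠ .A).card =
      l.countP fun x => decide (s.sub x ≠ .A) := by
    rw [List.countP_eq_length_filter, ← List.toFinset_card_of_nodup (h3.filter _)]
    congr 1
    ext x
    simp [h4, and_assoc]
  rw [hl1, hl2]
  exact ⟨s', by rw [show s.roots = l.head? from h1]; exact a1, a2, a3, a4, a5, a6, a7, a8, a9,
    fun h5 => a10 fun x hx => h5 x ((h4 x).1 hx).1 ((h4 x).1 hx).2⟩

end

/-! ### Linking the tree roots -/

section

variable {α : Type u} {V : Finset ℕ} {s : State α}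

/-- The tree roots. -/
def State.rootSet (s : State α) (V : Finset ℕ) : Finset ℕ := V.filter fun x => s.parent x = none

theorem mem_rootSet {x : ℕ} : x ∈ s.rootSet V ↔ x ∈ V ∧ s.parent x = none := Finset.mem_filter

theorem Keeps.rootSet_subset {s' : State α} (h : Keeps V s s') : s'.rootSet V ⊆ s.rootSet V :=
  fun x hx => mem_rootSet.2 ⟨(mem_rootSet.1 hx).1, h.root x (mem_rootSet.1 hx).1 (mem_rootSet.1 hx).2⟩

theorem psi_with_time (s : State α) (t : ℕ) : psi { s with time := t } = psi s := rfl

theorem rootSet_with_time (s : State α) (t : ℕ) :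
    State.rootSet { s with time := t } V = s.rootSet V := rfl

theorem rootSet_eq_filter {P : ℕ → Option ℕ} (h : ∀ x ∈ V, s.parent x = P x) :
    s.rootSet V = V.filter fun x => P x = none :=
  Finset.filter_congr fun x hx => by rw [h x hx]

variable [LinearOrder α]

/-- Phase 2 of FindMin. -/
def linkRoots (first : Option ℕ) : Prog α Unit :=
  match first with
  | none => pure ()
  | some x0 =>
    loop (fun x : ℕ => do
      let y ← getLeft x
      if y = x then
        pure none
      else
        let s ← link false x y
        let z ← getLeft s
        pure (some z)) x0

/-- The changes of `Φ_A` and the overhead in the link of two roots. If each of the two is in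
`R[A]`, then the overhead is `3`. -/
def RootLinkDelta (V : Finset ℕ) (s s' : State α) : Prop :=
  s'.phi .A ≤ s.phi .A + 1 ∧ s'.overhead ≤ s.overhead + 3 ∧
    s'.overhead + s'.phi .A ≤ s.overhead + s.phi .A + 3 ∧
    ((∃ x ∈ s.rootSet V, ∀ r, s.arr .A r ≠ some x) → s'.overhead ≤ s.overhead + 2)

/-- If the loser of the link becomes a rank child and is not in `R[A]`, then it is on `C[A]`, where it
becomes a stale item; this is why `psi` does not increase. -/
theorem link_roots_spec (hI : Inv s V ∅) {x y : ℕ} (hx : x ∈ s.rootSet V) (hy : y ∈ s.rootSet V)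
    (hxy : x ≠ y) :
    ∃ p s', link false x y s = some (p, s') ∧ p ∈ s'.rootSet V ∧ Inv s' V ∅ ∧ Keeps V s s' ∧
      (s'.rootSet V).card + 1 = (s.rootSet V).card ∧ s'.reductions = s.reductions ∧
      s'.stk .L = s.stk .L ∧ s'.phi .L = s.phi .L ∧ s'.time ≤ s.time + 51 ∧ psi s' ≤ psi s ∧
      3 * s'.overhead + 6 * psi s' ≤ 3 * s.overhead + 6 * psi s + 9 ∧
      ((s.rootSet V).card = 2 → RootLinkDelta V s s') := by
  obtain ⟨hxV, hxr⟩ := mem_rootSet.1 hx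
  obtain ⟨hyV, hyr⟩ := mem_rootSet.1 hy
  have hxA := hI.root_sub x hxV hxr
  have hyA := hI.root_sub y hyV hyr
  obtain ⟨p, h, s', hph, hlink, ⟨hI', h1, h2, h3, h4, h5, h6, h7, h8, h9⟩, hk⟩ :=
    exists_link_of_linkBelow (s := s) (taken := false)
    (hI.forest.key_some x hxV) (hI.forest.key_some y hyV) hxy
    (Q := fun s' p h => (Inv s' V ∅ ∧ s'.key = s.key ∧ s'.next = s.next ∧
      s'.parent = Function.update s.parent h (some p) ∧ s'.reductions = s.reductions ∧
      s'.stk .L = s.stk .L ∧ s'.phi .L = s.phi .L ∧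
      (∀ X r z, s'.arr X r = some z → s.arr X r = some z) ∧ s'.time ≤ s.time + 1 + 50 ∧
      ((s'.phi .A = s.phi .A ∧ s'.overhead = s.overhead ∧ s'.sub = s.sub ∧ s'.stk .A = s.stk .A ∧
        s.rank h < s.rank p) ∨ ∃ q, RankLink false s s' p h q)) ∧ KeyBelow s.key p h)
    (fun p h hph hk => by
      obtain ⟨s', g1, g2⟩ := linkBelow_A_spec (taken := false) (p := p) (h := h)
        (s := { s with time := s.time + 1 }) (V := V) (T := ∅)
        ⟨hI.lt_next, hI.forest, hI.lists, hI.viol, hI.ranked, hI.root_sub⟩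
        (by rcases hph with ⟨rfl, rfl⟩ | ⟨rfl, rfl⟩ <;> assumption)
        (by rcases hph with ⟨rfl, rfl⟩ | ⟨rfl, rfl⟩ <;> assumption) hk
        (by rcases hph with ⟨rfl, rfl⟩ | ⟨rfl, rfl⟩ <;> assumption)
        (by rcases hph with ⟨rfl, rfl⟩ | ⟨rfl, rfl⟩ <;> assumption)
        (by simp) (by simp) (by simp)
      exact ⟨s', g1, g2, hk⟩)
  have hp : p ∈ s.rootSet V ∧ h ∈ s.rootSet V ∧ p ≠ h := by
    rcases hph with ⟨rfl, rfl⟩ | ⟨rfl, rfl⟩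
    · exact ⟨hx, hy, hxy⟩
    · exact ⟨hy, hx, hxy.symm⟩
  obtain ⟨hp, hh, hne⟩ := hp
  have hroot : s'.rootSet V = (s.rootSet V).erase h := by
    ext z
    rw [Finset.mem_erase, mem_rootSet, mem_rootSet, h3]
    by_cases hz : z = h <;> simp [hz]
  have hhA := hI.root_sub h (mem_rootSet.1 hh).1 (mem_rootSet.1 hh).2
  have hpA := hI.root_sub p (mem_rootSet.1 hp).1 (mem_rootSet.1 hp).2
  have hip := inArr_le_one (arr := s.arr) (rank := s.rank) (X := .A) (x := p)
  have hih := inArr_le_one (arr := s.arr) (rank := s.rank) (X := .A) (x := h)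
  have hhs : inArr s.arr s.rank .A h = 1 ∨ h ∈ s.stk .A :=
    (hI.viol.on_stk .A h (mem_rootSet.1 hh).1 (by simp) (by simp [hhA, Sub.kind])).imp_left
      fun h => if_pos h
  have hpsi : psi s' ≤ psi s ∧ 3 * s'.overhead + 6 * psi s' ≤ 3 * s.overhead + 6 * psi s + 9 := by
    rcases h9 with ⟨g1, g2, g3, g4, -⟩ | ⟨q, k1, k2, k3, k4, k5, k6, k7⟩
    · have : psi s' = psi s := by rw [psi, psi, stale, stale, g1, g3, g4]
      omega
    · have hq : q = inArr s.arr s.rank .A p := by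
        rcases Nat.le_one_iff_eq_zero_or_eq_one.1 hip with h0 | h0
        · rw [h0, k2 rfl h0]
        · rw [h0, k3 h0]
      have hst : stale s' = (s.stk .A).countP fun x => Function.update s.sub h .N x ≠ .A := by
        rw [stale, k7, k6]
        split_ifs
        · rw [List.countP_cons]
          simp [hne, hpA]
        · rfl
      have hle := countP_update_le (sub := s.sub) (h := h) (s.stk .A)
      rw [← hst] at hle
      have hlt : h ∈ s.stk .A → stale s + 1 ≤ stale s' := fun hm => by
        rw [hst]
        exact countP_update_lt hhA hm
      change stale s ≤ stale s' at hle
      simp only [psi]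
      rcases hhs with h10 | h10
      · omega
      · have := hlt h10
        omega
  refine ⟨p, s', hlink, ?_, hI', Keeps.of_parent h1 h2 h3, ?_, h4, h5, h6, h8, hpsi.1, hpsi.2, ?_⟩
  · rw [hroot]
    exact Finset.mem_erase.2 ⟨hne, hp⟩
  · rw [hroot]
    exact Finset.card_erase_add_one hh
  · intro hc
    have hx2 : (∃ x ∈ s.rootSet V, ∀ r, s.arr .A r ≠ some x) →
        inArr s.arr s.rank .A p = 0 ∨ inArr s.arr s.rank .A h = 0 := by
      rintro ⟨z, hz, hza⟩
      have h10 : {p, h} = s.rootSet V := Finset.eq_of_subset_of_card_le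
        (by simp [Finset.insert_subset_iff, hp, hh]) (by rw [hc, Finset.card_pair hne])
      rw [← h10, Finset.mem_insert, Finset.mem_singleton] at hz
      rcases hz with rfl | rfl
      · exact Or.inl (inArr_eq_zero hza)
      · exact Or.inr (inArr_eq_zero hza)
    rcases h9 with ⟨g1, g2, g3, g4, -⟩ | ⟨q, k1, k2, k3, k4, k5, k6, k7⟩
    · refine ⟨?_, ?_, ?_, ?_⟩ <;> intros <;> omega
    · have hq : q = inArr s.arr s.rank .A p := by
        rcases Nat.le_one_iff_eq_zero_or_eq_one.1 hip with h0 | h0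
        · rw [h0, k2 rfl h0]
        · rw [h0, k3 h0]
      refine ⟨by omega, by omega, by omega, fun h10 => ?_⟩
      have := hx2 h10
      omega

theorem linkRoots_spec_aux : ∀ (k : ℕ) (s : State α), Inv s V ∅ → (s.rootSet V).card = k + 1 →
    ∀ x ∈ s.rootSet V, ∃ s', linkRoots (some x) s = some ((), s') ∧ Inv s' V ∅ ∧ Keeps V s s' ∧
      (s'.rootSet V).card = 1 ∧ s'.reductions = s.reductions ∧
      s'.stk .L = s.stk .L ∧ s'.phi .L = s.phi .L ∧ s'.time ≤ s.time + 53 * k + 1 ∧ psi s' ≤ psi s ∧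
      3 * s'.overhead + 6 * psi s' ≤ 3 * s.overhead + 6 * psi s + 9 * k ∧
      (k = 0 → s' = { s with time := s.time + 1 }) ∧ (k = 1 → RootLinkDelta V s s') := by
  intro k
  induction k with
  | zero =>
    intro s hI hc x hx
    obtain ⟨l, h1, h2, h3, h4⟩ := hI.lists none (by simp)
    have hlx : s.left x = x := by
      have h5 := (h4 x).2 (mem_rootSet.1 hx)
      obtain ⟨z, hz⟩ := Finset.card_eq_one.1 hc
      have h6 := mem_rootSet.2 ((h4 _).1 (h2.left_mem h5))
      rw [hz, Finset.mem_singleton] at h6 hx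
      rw [h6, hx]
    refine ⟨_, ?_, hI.with_viol (s.time + 1) s.overhead s.reductions hI.viol, ⟨rfl, rfl, fun _ _ h => h⟩,
      hc, rfl, rfl, rfl, by simp, le_rfl, le_of_eq (by simp; rfl), fun _ => rfl, by simp⟩
    rw [linkRoots, loop_eq]
    simp only [getLeft, bind_apply, rd_apply, Option.bind_some, hlx, if_true, pure_apply]
  | succ k ih =>
    intro s hI hc x hx
    obtain ⟨l, h1, h2, h3, h4⟩ := hI.lists none (by simp)
    have hl : ∀ z, z ∈ l ↔ z ∈ s.rootSet V := fun z => by rw [h4, mem_rootSet]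
    have hy := (hl _).1 (h2.left_mem ((hl x).2 hx))
    have hyx : s.left x ≠ x := by
      intro h5
      have h6 := h2.eq_singleton h3 ((hl x).2 hx) h5
      have h7 : s.rootSet V ⊆ {x} := fun z hz => by simpa [h6] using (hl z).2 hz
      have := Finset.card_le_card h7
      simp at this
      omega
    obtain ⟨p, s1, a1, a2, a3, a4, a5, a6, a7, a8, a9, a10, a11, a12⟩ := link_roots_spec
      (s := { s with time := s.time + 1 })
      (hI.with_viol (s.time + 1) s.overhead s.reductions hI.viol) hx hy hyx.symm
    dsimp only at a6 a7 a8 a9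
    obtain ⟨l', c1, c2, c3, c4⟩ := a3.lists none (by simp)
    have hz : s1.left p ∈ s1.rootSet V := by
      rw [mem_rootSet, ← c4]
      exact c2.left_mem ((c4 p).2 (mem_rootSet.1 a2))
    obtain ⟨s2, b1, b2, b3, b4, b5, b6, b7, b8, b9, b10, b11, -⟩ := ih { s1 with time := s1.time + 1 }
      (a3.with_viol (s1.time + 1) s1.overhead s1.reductions a3.viol)
      (by change (s.rootSet V).card = _ at hc
          change (s1.rootSet V).card + 1 = (s.rootSet V).card at a5
          change (s1.rootSet V).card = _
          omega) (s1.left p) hz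
    dsimp only at b5 b6 b7 b8
    change psi s2 ≤ psi s1 at b9
    change 3 * s2.overhead + 6 * psi s2 ≤ 3 * s1.overhead + 6 * psi s1 + 9 * k at b10
    change psi s1 ≤ psi s at a10
    change 3 * s1.overhead + 6 * psi s1 ≤ 3 * s.overhead + 6 * psi s + 9 at a11
    refine ⟨s2, ?_, b2, ⟨b3.key.trans a4.key, b3.next.trans a4.next,
      fun z hz hz2 => a4.root z hz (b3.root z hz hz2)⟩, b4, b5.trans a6, b6.trans a7, b7.trans a8,
      by grind, b9.trans a10, by push_cast; omega, by simp, fun hk => ?_⟩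
    · rw [linkRoots, loop_eq]
      simp only [getLeft, bind_apply, rd_apply, Option.bind_some, if_neg hyx]
      erw [a1]
      simp only [Option.bind_some, pure_apply]
      exact b1
    · have h5 := a12 (by change (s.rootSet V).card = 2; omega)
      have h6 := b11 (by omega)
      subst h6
      exact h5

end

/-! ### Phases of stack reductions -/

section

variable {α : Type u}

/-- `guard` evaluates a condition `B` on the stack `C[X]` and the potential `Φ_X`. -/
def IsGuard (X : Kind) (guard : Prog α Bool) (B : List ℕ → ℤ → Bool) : Prop :=
  (∀ s, ∃ t ≤ 2, guard s = some (B (s.stk X) (s.phi X), { s with time := s.time + t })) ∧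
    ∀ l v, B l v = true → l ≠ []

theorem isGuard_stkNonempty (X : Kind) :
    IsGuard (α := α) X (stkNonempty X) fun l _ => !l.isEmpty :=
  ⟨fun _ => ⟨1, by simp, rfl⟩, by simp⟩

theorem isGuard_exceeds (X : Kind) (v : ℤ) :
    IsGuard (α := α) X (exceeds X v) fun l w => !l.isEmpty && decide (v < w) :=
  ⟨fun _ => ⟨2, le_rfl, rfl⟩, by simp +contextual⟩

theorem IsGuard.whileLoop_skip {X : Kind} {guard : Prog α Bool} {B : List ℕ → ℤ → Bool}
    {s : State α} (hg : IsGuard X guard B) (hB : B (s.stk X) (s.phi X) = false)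
    (body : Prog α Unit) :
    ∃ t ≤ 2, whileLoop guard body s = some ((), { s with time := s.time + t }) := by
  obtain ⟨t, ht, h⟩ := hg.1 s
  refine ⟨t, ht, ?_⟩
  rw [whileLoop, loop_eq]
  simp only [bind_apply, h, hB, Option.bind_some, Bool.false_eq_true, if_false, pure_apply]

/-- What the reductions of `C[L]` cost at most in the first strategy, if `Φ_L` exceeds its value at
the start of the method by `e ≤ 5`; the reductions of `C[A]` that they cause are included. For
positive `e`, the value is the largest one of `1 + lossCost (e - 1)`, `3 + lossCost (e - 2)`,
`7 + lossCost (e - 3)` and `9 + lossCost (e - 7)`, as `ReduceLDelta` requires. -/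
def lossCost (e : ℤ) : ℤ :=
  if e ≤ 0 then 0 else if e = 1 then 9 else if e = 2 then 10 else if e = 3 then 12 else
    if e = 4 then 16 else 17

theorem ReduceLDelta.lossCost_le {s s' : State α} (h : ReduceLDelta s s') {v : ℤ} (w : ℤ)
    (hv : v < s.phi .L) (hv5 : s.phi .L ≤ v + 5) :
    s'.overhead + 2 * max (s'.phi .A - w) 0 + lossCost (s'.phi .L - v) ≤
      s.overhead + 2 * max (s.phi .A - w) 0 + lossCost (s.phi .L - v) := by
  obtain ⟨h1, -, -, -, h2⟩ := h
  have h3 : s'.overhead + 2 * max (s'.phi .A - w) 0 + lossCost (s'.phi .L - v) ≤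
      s.overhead + 2 * max (s.phi .A - w) 0 + ((s'.overhead + 2 * s'.phi .A) -
        (s.overhead + 2 * s.phi .A)) + lossCost (s'.phi .L - v) := by omega
  refine h3.trans ?_
  generalize (s'.overhead : ℤ) + 2 * s'.phi .A = a at *
  unfold lossCost
  split_ifs <;> omega

variable [LinearOrder α] {V : Finset ℕ} {s : State α}

/-- The changes in a sequence of reductions of `C[L]`. -/
structure ReducesL (V : Finset ℕ) (s s' : State α) : Prop where
  inv : Inv s' V ∅
  keeps : Keeps V s s'
  arr : ∀ r z, s'.arr .A r = some z → s.arr .A r = some z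
  red : s.reductions ≤ s'.reductions
  time : s'.time + 72 * s.reductions ≤ s.time + 72 * s'.reductions
  phi : s'.reductions + s'.phi .A + s'.phi .L ≤ s.reductions + s.phi .A + s.phi .L
  phi_A : s'.phi .A + 3 * s.reductions ≤ s.phi .A + 3 * s'.reductions
  phi_L : s'.phi .L + s'.reductions ≤ s.phi .L + s.reductions
  ovh : s'.overhead + 3 * s.reductions ≤ s.overhead + 3 * s'.reductions
  ovh_phi : 3 * s'.overhead + 7 * s'.phi .L + 6 * s'.phi .A ≤
    3 * s.overhead + 7 * s.phi .L + 6 * s.phi .A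

theorem ReducesL.refl (h : Inv s V ∅) : ReducesL V s s :=
  ⟨h, Keeps.refl V s, fun _ _ h => h, le_rfl, le_rfl, le_rfl, le_rfl, le_rfl, le_rfl, le_rfl⟩

theorem reduceL_step {s' : State α} (h : ReducesL V s s') {t : ℕ} (ht : t ≤ 2)
    (hs : s'.stk .L ≠ []) : ∃ s'', reduceL { s' with time := s'.time + t } = some ((), s'') ∧
      ReducesL V s s'' ∧ s''.reductions = s'.reductions + 1 ∧ ReduceLDelta s' s'' := by
  obtain ⟨s'', h1, h2, h3, h4, h5, h6, h7⟩ := reduceL_spec (s := { s' with time := s'.time + t })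
    (h.inv.with_viol _ s'.overhead s'.reductions h.inv.viol) hs
  change ReduceLDelta s' s'' at h6
  dsimp only at h4 h5 h7
  have h8 := h.phi
  have h9 := h.phi_A
  have h10 := h.phi_L
  have h11 := h.ovh
  have h12 := h.ovh_phi
  have h13 := h.time
  have h14 := h.red
  have h15 := h6
  unfold ReduceLDelta at h15
  refine ⟨s'', h1, ⟨h2, h.keeps.trans ⟨h3.key, h3.next, h3.root⟩, fun r z hz => h.arr r z (h7 r z hz),
    ?_, ?_, ?_, ?_, ?_, ?_, ?_⟩, h4, h6⟩ <;> omega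

/-- `v` is a bound that `Φ_L` exceeds as long as the loop goes on. -/
theorem reduceL_loop {guard : Prog α Bool} {B : List ℕ → ℤ → Bool} (hg : IsGuard .L guard B) {v : ℤ}
    (hv : ∀ s : State α, Inv s V ∅ → B (s.stk .L) (s.phi .L) = true → v < s.phi .L) (hI : Inv s V ∅) :
    ∃ s' t, whileLoop guard reduceL s = some ((), { s' with time := t }) ∧ t ≤ s'.time + 2 ∧
      ReducesL V s s' ∧ B (s'.stk .L) (s'.phi .L) = false ∧
      s'.reductions + max (s'.phi .L - v) 0 ≤ s.reductions + max (s.phi .L - v) 0 ∧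
      (s.phi .L ≤ v + 5 → ∀ w, s'.overhead + 2 * max (s'.phi .A - w) 0 ≤
        s.overhead + 2 * max (s.phi .A - w) 0 + lossCost (s.phi .L - v)) := by
  obtain ⟨s₁, h1, s', t, rfl, h2, h3⟩ := whileLoop_spec (guard := guard) (body := reduceL)
    (I := fun s' : State α => ReducesL V s s' ∧
      s'.reductions + max (s'.phi .L - v) 0 ≤ s.reductions + max (s.phi .L - v) 0 ∧
      (s.phi .L ≤ v + 5 → ∀ w, s'.overhead + 2 * max (s'.phi .A - w) 0 + lossCost (s'.phi .L - v) ≤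
        s.overhead + 2 * max (s.phi .A - w) 0 + lossCost (s.phi .L - v)))
    (Q := fun s₁ => ∃ (s' : State α) (t : ℕ), s₁ = { s' with time := t } ∧ t ≤ s'.time + 2 ∧ ReducesL V s s' ∧
      B (s'.stk .L) (s'.phi .L) = false ∧
      s'.reductions + max (s'.phi .L - v) 0 ≤ s.reductions + max (s.phi .L - v) 0 ∧
      (s.phi .L ≤ v + 5 → ∀ w, s'.overhead + 2 * max (s'.phi .A - w) 0 + lossCost (s'.phi .L - v) ≤
        s.overhead + 2 * max (s.phi .A - w) 0 + lossCost (s.phi .L - v)))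
    (fun s : State α => (s.phi .L).toNat) (by
      intro s' ⟨h1, h2, h3⟩
      obtain ⟨t, ht, h4⟩ := hg.1 s'
      rcases hB : B (s'.stk .L) (s'.phi .L) with _ | _
      · exact Or.inl ⟨_, hB ▸ h4, s', s'.time + t, rfl, by omega, h1, hB, h2, h3⟩
      · obtain ⟨s'', h5, h6, h7, h8⟩ := reduceL_step h1 ht (hg.2 _ _ hB)
        have h9 := hv s' h1.inv hB
        have h10 := h6.inv.viol.phi_nonneg .L
        have h11 := h1.phi_L
        have h12 := h1.red
        have h13 := h8
        unfold ReduceLDelta at h13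
        refine Or.inr ⟨_, s'', hB ▸ h4, h5, ⟨h6, by omega, fun h w => ?_⟩, by omega⟩
        exact (h8.lossCost_le w h9 (by omega)).trans (h3 h w))
    s ⟨ReducesL.refl hI, le_rfl, fun _ _ => le_rfl⟩
  obtain ⟨h4, h5, h6, h7⟩ := h3
  refine ⟨s', t, h1, h2, h4, h5, h6, fun h w => ?_⟩
  have := h7 h w
  have h8 : 0 ≤ lossCost (s'.phi .L - v) := by
    unfold lossCost
    split_ifs <;> omega
  omega

/-- The changes in a sequence of reductions of `C[A]`. -/
structure ReducesA (V : Finset ℕ) (s s' : State α) : Prop where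
  inv : Inv s' V ∅
  keeps : Keeps V s s'
  stk_L : s'.stk .L = s.stk .L
  phi_L : s'.phi .L = s.phi .L
  red : s.reductions ≤ s'.reductions
  time : s'.time + 72 * s.reductions ≤ s.time + 72 * s'.reductions
  phi : s'.reductions + s'.phi .A ≤ s.reductions + s.phi .A
  psi_le : s'.reductions + psi s' ≤ s.reductions + psi s
  ovh : s'.overhead + 2 * s.reductions ≤ s.overhead + 2 * s'.reductions
  ovh_psi : 3 * s'.overhead + 6 * psi s' ≤ 3 * s.overhead + 6 * psi s
  arr : ∀ r z, s'.arr .A r = some z → (∃ r, s.arr .A r = some z) ∨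
    s'.overhead + 1 + 2 * s.reductions ≤ s.overhead + 2 * s'.reductions

theorem ReducesA.refl (h : Inv s V ∅) : ReducesA V s s :=
  ⟨h, Keeps.refl V s, rfl, rfl, le_rfl, le_rfl, le_rfl, le_rfl, le_rfl, le_rfl,
    fun r _ h => Or.inl ⟨r, h⟩⟩

theorem reduceA_step {s' : State α} (h : ReducesA V s s') {t : ℕ} (ht : t ≤ 2)
    (hs : s'.stk .A ≠ []) : ∃ s'', reduceA { s' with time := s'.time + t } = some ((), s'') ∧
      ReducesA V s s'' ∧ s''.reductions = s'.reductions + 1 ∧ s''.phi .A + 1 ≤ s'.phi .A ∧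
      s''.overhead ≤ s'.overhead + 2 := by
  obtain ⟨s'', h1, h2, h3, h4, h5, h6, h7, h8, h9, h10, h11⟩ :=
    reduceA_spec (s := { s' with time := s'.time + t })
    (h.inv.with_viol _ s'.overhead s'.reductions h.inv.viol) hs
  change psi s'' + 1 ≤ psi s' at h9
  dsimp only at h4 h5 h6 h7 h8 h10 h11
  obtain ⟨-, k2, k3, k4, k5, k6, k7, k8, k9, k10, k11⟩ := h
  refine ⟨s'', h1, ⟨h2, k2.trans ⟨h3.key, h3.next, h3.root⟩, h6.trans k3, h7.trans k4, by omega,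
    by omega, by omega, by omega, by omega, by omega, fun r z h => ?_⟩, h4, h8, h10⟩
  rcases h11 r z h with ⟨r', h12⟩ | h12
  · rcases k11 r' z h12 with h13 | h13
    · exact Or.inl h13
    · right
      omega
  · right
    omega

/-- `v` is a bound that `Φ_A` exceeds as long as the loop goes on. -/
theorem reduceA_loop {guard : Prog α Bool} {B : List ℕ → ℤ → Bool} (hg : IsGuard .A guard B) {v : ℤ}
    (hv : ∀ s : State α, Inv s V ∅ → B (s.stk .A) (s.phi .A) = true → v < s.phi .A) (hI : Inv s V ∅) :
    ∃ s' t, whileLoop guard reduceA s = some ((), { s' with time := t }) ∧ t ≤ s'.time + 2 ∧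
      ReducesA V s s' ∧ B (s'.stk .A) (s'.phi .A) = false ∧
      s'.reductions + max (s'.phi .A - v) 0 ≤ s.reductions + max (s.phi .A - v) 0 ∧
      s'.overhead + 2 * max (s'.phi .A - v) 0 ≤ s.overhead + 2 * max (s.phi .A - v) 0 := by
  obtain ⟨s₁, h1, s', t, rfl, h2⟩ := whileLoop_spec (guard := guard) (body := reduceA)
    (I := fun s' : State α => ReducesA V s s' ∧
      s'.reductions + max (s'.phi .A - v) 0 ≤ s.reductions + max (s.phi .A - v) 0 ∧
      s'.overhead + 2 * max (s'.phi .A - v) 0 ≤ s.overhead + 2 * max (s.phi .A - v) 0)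
    (Q := fun s₁ => ∃ (s' : State α) (t : ℕ), s₁ = { s' with time := t } ∧ t ≤ s'.time + 2 ∧ ReducesA V s s' ∧
      B (s'.stk .A) (s'.phi .A) = false ∧
      s'.reductions + max (s'.phi .A - v) 0 ≤ s.reductions + max (s.phi .A - v) 0 ∧
      s'.overhead + 2 * max (s'.phi .A - v) 0 ≤ s.overhead + 2 * max (s.phi .A - v) 0)
    (fun s : State α => (s.phi .A).toNat) (by
      intro s' ⟨h1, h2, h3⟩
      obtain ⟨t, ht, h4⟩ := hg.1 s'
      rcases hB : B (s'.stk .A) (s'.phi .A) with _ | _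
      · exact Or.inl ⟨_, hB ▸ h4, s', s'.time + t, rfl, by omega, h1, hB, h2, h3⟩
      · obtain ⟨s'', h5, h6, h7, h8, h9⟩ := reduceA_step h1 ht (hg.2 _ _ hB)
        have h10 := hv s' h1.inv hB
        have h11 := h6.inv.viol.phi_nonneg .A
        exact Or.inr ⟨_, s'', hB ▸ h4, h5, ⟨h6, by omega, by omega⟩, by omega⟩)
    s ⟨ReducesA.refl hI, le_rfl, le_rfl⟩
  exact ⟨s', t, h1, h2⟩

theorem reduceL_upTo (hI : Inv s V ∅) (m : ℕ) :
    ∃ s' t, upTo (stkNonempty .L) reduceL m s = some ((), { s' with time := t }) ∧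
      t ≤ s'.time + 2 ∧ ReducesL V s s' ∧ s'.reductions ≤ s.reductions + m ∧
      (s'.reductions = s.reductions + m ∨ s'.stk .L = []) := by
  have hg := isGuard_stkNonempty (α := α) .L
  obtain ⟨s₁, h1, h2⟩ := upTo_spec (guard := stkNonempty .L) (body := reduceL)
    (I := fun k s' => ReducesL V s s' ∧ s'.reductions = s.reductions + k)
    (Q := fun k s₁ => ∃ (s' : State α) (t : ℕ), s₁ = { s' with time := t } ∧ t ≤ s'.time + 2 ∧
      ReducesL V s s' ∧ s'.reductions = s.reductions + k ∧ s'.stk .L = []) (by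
      intro k s' ⟨h1, h2⟩
      obtain ⟨t, ht, h4⟩ := hg.1 s'
      rcases hB : (s'.stk .L).isEmpty with _ | _
      · obtain ⟨s'', h5, h6, h7, -⟩ := reduceL_step h1 ht (by simpa using hB)
        exact Or.inr ⟨_, s'', by simpa [hB] using h4, h5, h6, by omega⟩
      · exact Or.inl ⟨_, by simpa [hB] using h4, s', s'.time + t, rfl, by omega, h1, h2, by simpa using hB⟩)
    m 0 s ⟨ReducesL.refl hI, rfl⟩
  rw [Nat.zero_add] at h2
  rcases h2 with ⟨h2, h3⟩ | ⟨k, hk, s', t, rfl, h2, h3, h4, h5⟩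
  · exact ⟨s₁, s₁.time, h1, by omega, h2, by omega, Or.inl h3⟩
  · exact ⟨s', t, h1, h2, h3, by omega, Or.inr h5⟩

theorem reduceA_upTo (hI : Inv s V ∅) (m : ℕ) :
    ∃ s' t, upTo (stkNonempty .A) reduceA m s = some ((), { s' with time := t }) ∧
      t ≤ s'.time + 2 ∧ ReducesA V s s' ∧ s'.reductions ≤ s.reductions + m ∧
      (s'.reductions = s.reductions + m ∨ s'.stk .A = []) := by
  have hg := isGuard_stkNonempty (α := α) .A
  obtain ⟨s₁, h1, h2⟩ := upTo_spec (guard := stkNonempty .A) (body := reduceA)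
    (I := fun k s' => ReducesA V s s' ∧ s'.reductions = s.reductions + k)
    (Q := fun k s₁ => ∃ (s' : State α) (t : ℕ), s₁ = { s' with time := t } ∧ t ≤ s'.time + 2 ∧
      ReducesA V s s' ∧ s'.reductions = s.reductions + k ∧ s'.stk .A = []) (by
      intro k s' ⟨h1, h2⟩
      obtain ⟨t, ht, h4⟩ := hg.1 s'
      rcases hB : (s'.stk .A).isEmpty with _ | _
      · obtain ⟨s'', h5, h6, h7, -⟩ := reduceA_step h1 ht (by simpa using hB)
        exact Or.inr ⟨_, s'', by simpa [hB] using h4, h5, h6, by omega⟩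
      · exact Or.inl ⟨_, by simpa [hB] using h4, s', s'.time + t, rfl, by omega, h1, h2, by simpa using hB⟩)
    m 0 s ⟨ReducesA.refl hI, rfl⟩
  rw [Nat.zero_add] at h2
  rcases h2 with ⟨h2, h3⟩ | ⟨k, hk, s', t, rfl, h2, h3, h4, h5⟩
  · exact ⟨s₁, s₁.time, h1, by omega, h2, by omega, Or.inl h3⟩
  · exact ⟨s', t, h1, h2, h3, by omega, Or.inr h5⟩

end

/-! ### The invariant between the operations -/

section

variable {α : Type u} [LinearOrder α] {V : Finset ℕ} {s : State α}

/-- The invariant that holds between the operations. -/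
structure HeapInv (s : State α) (V : Finset ℕ) : Prop where
  inv : Inv s V ∅
  root : ∀ x ∈ V, s.parent x = none → s.roots = some x
  phi_A : s.phi .A ≤ maxRank V.card + 1
  phi_L : s.phi .L ≤ 3 * (maxRank V.card + 1)

theorem Inv.mem_rootSet_of_roots (h : Inv s V ∅) {x : ℕ} (hx : s.roots = some x) :
    x ∈ s.rootSet V := by
  obtain ⟨l, h1, h2, h3, h4⟩ := h.lists none (by simp)
  rw [mem_rootSet, ← h4]
  exact List.mem_of_mem_head? (by rw [← h1]; exact hx)

theorem Inv.rootSet_eq_empty (h : Inv s V ∅) (hs : s.roots = none) : s.rootSet V = ∅ := by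
  obtain ⟨l, h1, h2, h3, h4⟩ := h.lists none (by simp)
  have h5 : l = [] := by
    change s.roots = _ at h1
    rw [hs] at h1
    exact List.head?_eq_none_iff.1 h1.symm
  ext x
  rw [mem_rootSet, ← h4, h5]
  simp

theorem Inv.roots_eq (h : Inv s V ∅) (hc : (s.rootSet V).card ≤ 1) {x : ℕ} (hx : x ∈ V)
    (hr : s.parent x = none) : s.roots = some x := by
  have hx := mem_rootSet.2 ⟨hx, hr⟩
  rcases h1 : s.roots with _ | y
  · simp [h.rootSet_eq_empty h1] at hx
  · rw [Finset.card_le_one.1 hc y (h.mem_rootSet_of_roots h1) x hx]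

theorem Inv.phi_L_le (h : Inv s V ∅) (hL : s.stk .L = [] ∨ s.phi .L ≤ 3 * (maxRank V.card + 1)) :
    s.phi .L ≤ 3 * (maxRank V.card + 1) := by
  rcases hL with hL | hL
  · exact h.viol.phi_L_le (h.rank_le_of_stk_nil hL) hL
  · exact hL

theorem Inv.phi_A_le (h : Inv s V ∅) (hL : s.stk .L = [] ∨ s.phi .L ≤ 3 * (maxRank V.card + 1))
    (hA : s.stk .A = [] ∨ s.phi .A ≤ maxRank V.card + 1) : s.phi .A ≤ maxRank V.card + 1 := by
  rcases hA with hA | hA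
  · exact h.viol.phi_A_le (h.rank_le le_rfl (h.phi_L_le hL)) hA
  · exact hA

theorem Inv.heapInv (h : Inv s V ∅) (hc : (s.rootSet V).card ≤ 1)
    (hL : s.stk .L = [] ∨ s.phi .L ≤ 3 * (maxRank V.card + 1))
    (hA : s.stk .A = [] ∨ s.phi .A ≤ maxRank V.card + 1) : HeapInv s V :=
  ⟨h, fun _ => h.roots_eq hc, h.phi_A_le hL hA, h.phi_L_le hL⟩

/-- The only tree root is the node with the smallest key. -/
theorem HeapInv.keyBelow (h : HeapInv s V) {x y : ℕ} (hx : s.roots = some x) (hy : y ∈ V)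
    (hyx : y ≠ x) : KeyBelow s.key x y := by
  obtain ⟨z, hz, hzr, h1⟩ := h.inv.forest.exists_min_root ⟨y, hy⟩
  have h2 := h.root z hz hzr
  rw [hx] at h2
  obtain rfl := Option.some.inj h2
  exact h1 y hy hyx

theorem HeapInv.eq_empty (h : HeapInv s V) (hs : s.roots = none) : V = ∅ := by
  by_contra hV
  obtain ⟨z, hz, hzr, -⟩ := h.inv.forest.exists_min_root (Finset.nonempty_iff_ne_empty.2 hV)
  rw [h.root z hz hzr] at hs
  simp at hs

/-! ### The phases of FindMin -/

theorem linkRoots_spec (hI : Inv s V ∅) : ∃ s', linkRoots s.roots s = some ((), s') ∧ Inv s' V ∅ ∧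
      Keeps V s s' ∧ (s'.rootSet V).card ≤ 1 ∧ s'.reductions = s.reductions ∧
      s'.stk .L = s.stk .L ∧ s'.phi .L = s.phi .L ∧ s'.time ≤ s.time + 53 * (s.rootSet V).card + 1 ∧
      psi s' ≤ psi s ∧
      3 * s'.overhead + 6 * psi s' ≤ 3 * s.overhead + 6 * psi s + 9 * (s.rootSet V).card ∧
      ((s.rootSet V).card ≤ 1 → s'.overhead = s.overhead) ∧
      ((s.rootSet V).card ≤ 2 → RootLinkDelta V s s') := by
  have hrefl : RootLinkDelta V s s := by
    refine ⟨?_, ?_, ?_, ?_⟩ <;> intros <;> omega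
  rcases h : s.roots with _ | x
  · have h1 := hI.rootSet_eq_empty h
    refine ⟨s, rfl, hI, Keeps.refl V s, by simp [h1], rfl, rfl, rfl, by omega, le_rfl, by simp,
      fun _ => rfl, fun _ => hrefl⟩
  · have hx := hI.mem_rootSet_of_roots h
    have h0 := Finset.card_pos.2 ⟨x, hx⟩
    obtain ⟨s', a1, a2, a3, a4, a5, a6, a7, a8, a9, a10, a11, a12⟩ :=
      linkRoots_spec_aux ((s.rootSet V).card - 1) s hI (by omega) x hx
    refine ⟨s', a1, a2, a3, a4.le, a5, a6, a7, by omega, a9, by omega, fun h1 => ?_, fun h1 => ?_⟩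
    · rw [a11 (by omega)]
    · by_cases h2 : (s.rootSet V).card ≤ 1
      · rw [a11 (by omega)]
        exact hrefl
      · exact a12 (by omega)

/-- The phases 1, 2 and 3 of FindMin. -/
def reduceAndLink (phase1 phase3 : Prog α Unit) : Prog α (Option ℕ) := do
  phase1
  let first ← getRoots
  linkRoots first
  phase3
  getRoots

theorem findMinWith_eq (phase1 phase3 : Prog α Unit) : findMinWith phase1 phase3 =
    getRoots >>= fun start => clearRoots start >>= fun _ => reduceAndLink phase1 phase3 := by
  unfold findMinWith
  congr 1
  funext start
  congr 1
  funext _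
  unfold reduceAndLink
  congr 1
  funext _
  congr 1
  funext first
  cases first
  · rfl
  · rfl

theorem reduceAndLink_run {phase1 phase3 : Prog α Unit} {s₁ s₂ s₃ : State α}
    (h1 : phase1 s = some ((), s₁))
    (h2 : linkRoots s₁.roots { s₁ with time := s₁.time + 1 } = some ((), s₂))
    (h3 : phase3 s₂ = some ((), s₃)) :
    reduceAndLink phase1 phase3 s = some (s₃.roots, { s₃ with time := s₃.time + 1 }) := by
  simp only [reduceAndLink, bind_apply, h1, Option.bind_some, getRoots, rd_apply, h2, h3]

theorem Inv.with_time (h : Inv s V ∅) (t : ℕ) : Inv { s with time := t } V ∅ :=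
  h.with_viol t s.overhead s.reductions h.viol

/-- With empty stacks `psi` equals `Φ_A`. The weight `7` of `Φ_L` is the least one for which
`3 * overhead + 6 * Φ_A + 7 * Φ_L` does not increase in the reductions of `C[L]`. -/
theorem reduceAndLink_reduceAll (hI : Inv s V ∅) :
    ∃ s', reduceAndLink reduceAll reduceAll s = some (s'.roots, s') ∧ Inv s' V ∅ ∧ Keeps V s s' ∧
      (s'.rootSet V).card ≤ 1 ∧ s'.stk .A = [] ∧ s'.stk .L = [] ∧
      (s'.reductions : ℤ) ≤ s.reductions + s.phi .A + s.phi .L ∧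
      3 * (s'.overhead : ℤ) ≤ 3 * s.overhead + 6 * s.phi .A + 7 * s.phi .L +
        9 * (s.rootSet V).card ∧
      s'.time + 72 * s.reductions ≤ s.time + 72 * s'.reductions + 53 * (s.rootSet V).card + 20 := by
  have hg := fun X => isGuard_stkNonempty (α := α) X
  have hv : ∀ X (s : State α), Inv s V ∅ → (!(s.stk X).isEmpty) = true → -1 < s.phi X :=
    fun X s h _ => by have := h.viol.phi_nonneg X; omega
  obtain ⟨s1, t1, a1, a2, a3, a4, -, -⟩ := reduceL_loop (hg .L) (hv .L) hI
  obtain ⟨s2, t2, b1, b2, b3, b4, -, -⟩ := reduceA_loop (hg .A) (hv .A) (a3.inv.with_time t1)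
  obtain ⟨s3, c1, c2, c3, c4, c5, c6, c7, c8, c9, c10, -, -⟩ :=
    linkRoots_spec (b3.inv.with_time (t2 + 1))
  have hL : (fun (l : List ℕ) (_ : ℤ) => !l.isEmpty) (s3.stk .L) (s3.phi .L) = false := by
    rw [c6]
    change (fun (l : List ℕ) (_ : ℤ) => !l.isEmpty) (s2.stk .L) 0 = _
    rw [b3.stk_L]
    exact a4
  obtain ⟨t4, ht4, d1⟩ := (hg .L).whileLoop_skip hL reduceL
  obtain ⟨s5, t5, e1, e2, e3, e4, -, -⟩ := reduceA_loop (hg .A) (hv .A)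
    (c2.with_time (s3.time + t4))
  have hLs : s1.stk .L = [] := by simpa using a4
  have hAs : s2.stk .A = [] := by simpa using b4
  have hAs5 : s5.stk .A = [] := by simpa using e4
  have hLs5 : s5.stk .L = [] := e3.stk_L.trans (c6.trans (b3.stk_L.trans hLs))
  have hps2 : psi s2 = s2.phi .A := by simp [psi, stale, hAs]
  have hps5 : psi s5 = s5.phi .A := by simp [psi, stale, hAs5]
  have f1 := a3.phi
  have f2 := a3.ovh_phi
  have f3 := a3.time
  have f4 := b3.phi
  have f5 := b3.ovh
  have f6 := b3.time
  have f7 := e3.psi_le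
  have f8 := e3.ovh_psi
  have f9 := e3.time
  have f10 := e3.phi_L
  have f11 := e3.inv.viol.phi_nonneg .A
  have f12 := a3.inv.viol.phi_nonneg .L
  have f13 := b3.red
  have f14 := e3.red
  have f15 := a3.red
  have f16 := Finset.card_le_card (a3.keeps.rootSet_subset)
  have f17 := Finset.card_le_card (b3.keeps.rootSet_subset)
  have f18 := Finset.card_le_card (e3.keeps.rootSet_subset)
  simp only [psi_with_time, rootSet_with_time] at *
  refine ⟨{ s5 with time := t5 + 1 }, ?_, e3.inv.with_time _, ?_, ?_, hAs5, hLs5, ?_, ?_, ?_⟩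
  · refine reduceAndLink_run (s₁ := { s2 with time := t2 }) (s₂ := s3) (s₃ := { s5 with time := t5 })
      ?_ c1 ?_
    · simp only [reduceAll, bind_apply, a1, Option.bind_some, b1]
    · simp only [reduceAll, bind_apply, d1, Option.bind_some, e1]
  · exact ((a3.keeps.trans ⟨b3.keeps.key, b3.keeps.next, b3.keeps.root⟩).trans
      ⟨c3.key, c3.next, c3.root⟩).trans ⟨e3.keeps.key, e3.keeps.next, e3.keeps.root⟩
  · exact f18.trans c4
  all_goals dsimp only; omega

end

/-! ### The phases of FindMin with a worst-case strategy -/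

section

variable {α : Type u} [LinearOrder α] {V : Finset ℕ} {s : State α}

/-- In the first strategy, `vA` and `vL` are the potentials at the start of the method. A link of two
roots costs at most `4`, including the reduction of `C[A]` that follows it if it increases `Φ_A`. -/
theorem reduceAndLink_first (hI : Inv s V ∅) {vA vL : ℤ} (hc : (s.rootSet V).card ≤ 2)
    (hA : s.phi .A ≤ vA + 3) (hL : s.phi .L ≤ vL + 5) (hvA : vA ≤ maxRank V.card + 1)
    (hvL : vL ≤ 3 * (maxRank V.card + 1)) :
    ∃ s', reduceAndLink (reduceDown vA vL) (reduceDown vA vL) s = some (s'.roots, s') ∧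
      HeapInv s' V ∧ Keeps V s s' ∧ s'.time ≤ s.time + 4000 ∧
      s'.overhead ≤ s.overhead + 2 * max (s.phi .A - vA) 0 + lossCost (s.phi .L - vL) + 4 := by
  have hg := fun X v => isGuard_exceeds (α := α) X v
  have hv : ∀ X v (s : State α), Inv s V ∅ →
      (!(s.stk X).isEmpty && decide (v < s.phi X)) = true → v < s.phi X :=
    fun X v s h h1 => by simp at h1; exact h1.2
  obtain ⟨s1, t1, a1, a2, a3, a4, a5, a6⟩ := reduceL_loop (hg .L vL) (hv .L vL) hI
  obtain ⟨s2, t2, b1, b2, b3, b4, b5, b6⟩ := reduceA_loop (hg .A vA) (hv .A vA) (a3.inv.with_time t1)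
  obtain ⟨s3, c1, c2, c3, c4, c5, c6, c7, c8, -, -, -, c9⟩ :=
    linkRoots_spec (b3.inv.with_time (t2 + 1))
  have hL3 : (!(s3.stk .L).isEmpty && decide (vL < s3.phi .L)) = false := by
    rw [c6, c7]
    dsimp only
    rw [b3.stk_L, b3.phi_L]
    exact a4
  obtain ⟨t4, ht4, d1⟩ := (hg .L vL).whileLoop_skip hL3 reduceL
  obtain ⟨s5, t5, e1, e2, e3, e4, e5, e6⟩ := reduceA_loop (hg .A vA) (hv .A vA)
    (c2.with_time (s3.time + t4))
  have hL5 : (!(s5.stk .L).isEmpty && decide (vL < s5.phi .L)) = false := by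
    rw [e3.stk_L, e3.phi_L]
    exact hL3
  have f1 := a3.phi_A
  have f2 := a3.time
  have f4 := b3.phi
  have f6 := b3.time
  have f9 := e3.time
  have f13 := b3.red
  have f14 := e3.red
  have f15 := a3.red
  have f16 := Finset.card_le_card (a3.keeps.rootSet_subset)
  have f17 := Finset.card_le_card (b3.keeps.rootSet_subset)
  have f18 := Finset.card_le_card (e3.keeps.rootSet_subset)
  have f19 := a6 hL vA
  simp only [rootSet_with_time] at *
  obtain ⟨g1, g3, g4, -⟩ := c9 (by omega)
  dsimp only at g1 g3 g4
  refine ⟨{ s5 with time := t5 + 1 }, ?_,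
    (e3.inv.with_time _).heapInv (f18.trans c4) ?_ ?_, ?_, ?_, ?_⟩
  · refine reduceAndLink_run (s₁ := { s2 with time := t2 }) (s₂ := s3) (s₃ := { s5 with time := t5 })
      ?_ c1 ?_
    · simp only [reduceDown, bind_apply, a1, Option.bind_some, b1]
    · simp only [reduceDown, bind_apply, d1, Option.bind_some, e1]
  · dsimp only
    rw [Bool.and_eq_false_iff] at hL5
    refine hL5.imp (by simp) fun h => ?_
    simp at h
    omega
  · dsimp only
    rw [Bool.and_eq_false_iff] at e4
    refine e4.imp (by simp) fun h => ?_
    simp at h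
    omega
  · exact ((a3.keeps.trans ⟨b3.keeps.key, b3.keeps.next, b3.keeps.root⟩).trans
      ⟨c3.key, c3.next, c3.root⟩).trans ⟨e3.keeps.key, e3.keeps.next, e3.keeps.root⟩
  all_goals dsimp only at *; omega

/-- In the second strategy, the hypotheses say that there are enough reductions for the potentials to
fall to their bounds. If one of the two roots is not in `R[A]`, then either it gets there by a
reduction, whose overhead is then `1` only, or it is not there when the roots are linked. Both
save `1`. -/
theorem reduceAndLink_second (hI : Inv s V ∅) {mL mA : ℕ} (hc : (s.rootSet V).card ≤ 2)
    (hA : s.phi .A + 3 * mL ≤ maxRank V.card + 1 + mA)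
    (hL : s.phi .L ≤ 3 * (maxRank V.card + 1) + mL) :
    ∃ s', reduceAndLink (reducePlan mL mA) (reducePlan 0 1) s = some (s'.roots, s') ∧
      HeapInv s' V ∧ Keeps V s s' ∧ s'.time ≤ s.time + 72 * (mL + mA) + 200 ∧
      s'.overhead ≤ s.overhead + 3 * mL + 2 * mA + 5 ∧
      ((∃ x ∈ s.rootSet V, ∀ r, s.arr .A r ≠ some x) →
        s'.overhead ≤ s.overhead + 3 * mL + 2 * mA + 4) := by
  obtain ⟨s1, t1, a1, a2, a3, a4, a5⟩ := reduceL_upTo hI mL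
  obtain ⟨s2, t2, b1, b2, b3, b4, b5⟩ := reduceA_upTo (a3.inv.with_time t1) mA
  obtain ⟨s3, c1, c2, c3, c4, c5, c6, c7, c8, -, -, c10, c9⟩ :=
    linkRoots_spec (b3.inv.with_time (t2 + 1))
  obtain ⟨s5, t5, e1, e2, e3, e4, e5⟩ := reduceA_upTo c2 1
  have f1 := a3.phi_A
  have f2 := a3.time
  have f3 := a3.phi_L
  have f4 := b3.phi
  have f5 := e3.phi
  have f6 := b3.time
  have f7 := b3.ovh
  have f8 := e3.ovh
  have f9 := e3.time
  have f10 := a3.ovh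
  have f13 := b3.red
  have f14 := e3.red
  have f15 := a3.red
  have f16 := Finset.card_le_card (a3.keeps.rootSet_subset)
  have f17 := Finset.card_le_card (b3.keeps.rootSet_subset)
  have f18 := Finset.card_le_card (e3.keeps.rootSet_subset)
  have hL1 : s1.stk .L = [] ∨ s1.phi .L ≤ 3 * (maxRank V.card + 1) := by
    rcases a5 with h | h
    · right
      omega
    · exact Or.inl h
  have hL2 : s2.stk .L = [] ∨ s2.phi .L ≤ 3 * (maxRank V.card + 1) := by
    rw [b3.stk_L, b3.phi_L]
    exact hL1
  have hL5 : s5.stk .L = [] ∨ s5.phi .L ≤ 3 * (maxRank V.card + 1) := by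
    rw [e3.stk_L, e3.phi_L, c6, c7]
    exact hL2
  have hA2 : s2.phi .A ≤ maxRank V.card + 1 := by
    refine b3.inv.phi_A_le hL2 ?_
    rcases b5 with h | h
    · right
      dsimp only at *
      omega
    · exact Or.inl h
  have f19 : (∃ x ∈ s.rootSet V, ∀ r, s.arr .A r ≠ some x) → (s2.rootSet V).card = 2 →
      (∃ x ∈ s2.rootSet V, ∀ r, s2.arr .A r ≠ some x) ∨
        s2.overhead + 1 + 2 * s1.reductions ≤ s1.overhead + 2 * s2.reductions := by
    rintro ⟨x, hx, hxa⟩ h2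
    have hx2 : x ∈ s2.rootSet V := by
      rw [Finset.eq_of_subset_of_card_le (b3.keeps.rootSet_subset.trans a3.keeps.rootSet_subset)
        (by omega)]
      exact hx
    by_cases hr : ∀ r, s2.arr .A r ≠ some x
    · exact Or.inl ⟨x, hx2, hr⟩
    · push Not at hr
      obtain ⟨r, hr⟩ := hr
      refine (b3.arr r x hr).imp (fun ⟨r', h3⟩ => ?_) fun h => h
      exact absurd (a3.arr _ _ h3) (hxa _)
  simp only [rootSet_with_time] at *
  obtain ⟨g1, g3, g4, g5⟩ := c9 (by omega)
  simp only [rootSet_with_time] at g1 g3 g4 g5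
  refine ⟨{ s5 with time := t5 + 1 }, ?_,
    (e3.inv.with_time _).heapInv (f18.trans c4) hL5 ?_, ?_, ?_, ?_, ?_⟩
  · refine reduceAndLink_run (s₁ := { s2 with time := t2 }) (s₂ := s3) (s₃ := { s5 with time := t5 })
      ?_ c1 ?_
    · simp only [reducePlan, bind_apply, a1, Option.bind_some, b1]
    · exact e1
  · dsimp only
    rcases e5 with h | h
    · right
      omega
    · exact Or.inl h
  · exact ((a3.keeps.trans ⟨b3.keeps.key, b3.keeps.next, b3.keeps.root⟩).trans
      ⟨c3.key, c3.next, c3.root⟩).trans ⟨e3.keeps.key, e3.keeps.next, e3.keeps.root⟩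
  · dsimp only at *
    omega
  · dsimp only at *
    omega
  · intro h
    have f20 := f19 h
    dsimp only at *
    rcases Nat.lt_or_ge (s2.rootSet V).card 2 with h2 | h2
    · have := c10 (by omega)
      omega
    · rcases f20 (by omega) with h3 | h3
      · have := g5 h3
        omega
      · omega

end

/-! ### FindMin after a change of the tree roots -/

section

variable {α : Type u} [LinearOrder α] {V : Finset ℕ} {s : State α}

theorem findMinWith_run {phase1 phase3 : Prog α Unit} {s₁ s₂ : State α} {o : Option ℕ}
    (h1 : clearRoots s.roots { s with time := s.time + 1 } = some ((), s₁))
    (h2 : reduceAndLink phase1 phase3 s₁ = some (o, s₂)) :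
    findMinWith phase1 phase3 s = some (o, s₂) := by
  rw [findMinWith_eq]
  simp only [bind_apply, getRoots, rd_apply, Option.bind_some, h1, h2]

theorem PreInv.with_time {P : ℕ → Option ℕ} (h : PreInv s V P) (t : ℕ) :
    PreInv { s with time := t } V P :=
  ⟨h.lt_next, h.forest, h.lists, h.viol, h.ranked, h.parent_eq⟩

/-- FindMin with the first strategy, if `k ≤ 1` of at most two roots do not have subtype `A`.
The state `s₀` is the one after phase 0. -/
theorem findMinBy_first {P : ℕ → Option ℕ} (h : PreInv s V P) {vA vL : ℤ} (mL mA mA3 k : ℕ)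
    (hc : (V.filter fun x => P x = none).card ≤ 2)
    (hk : (V.filter fun x => P x = none ∧ s.sub x ≠ .A).card ≤ k)
    (hA : s.phi .A + 2 * k ≤ vA + 3) (hL : s.phi .L ≤ vL + 5) (hvA : vA ≤ maxRank V.card + 1)
    (hvL : vL ≤ 3 * (maxRank V.card + 1)) :
    ∃ (s₀ s' : State α) (o : Option ℕ), findMinBy .first vA vL mL mA mA3 s = some (o, s') ∧
      HeapInv s' V ∧ s'.key = s.key ∧ s'.next = s.next ∧ s'.time ≤ s.time + 4020 ∧
      ClearDelta s s₀ k ∧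
      ((∀ x ∈ V, P x = none → s.sub x = .A ∨ s.sub x = .N) → s₀.phi .L = s.phi .L) ∧
      s'.overhead ≤ s₀.overhead + 2 * max (s₀.phi .A - vA) 0 + lossCost (s₀.phi .L - vL) + 4 := by
  obtain ⟨s0, a1, a2, a3, a4, a5, a6, a7, a8, a9, a10⟩ := clearRoots_spec (h.with_time (s.time + 1))
  have hr := rootSet_eq_filter a6
  have a11 : ClearDelta s s0 k := by
    simp only [ClearDelta] at a9 ⊢
    omega
  have a12 := a11
  simp only [ClearDelta] at a12
  obtain ⟨s', b1, b2, b3, b4, b5⟩ := reduceAndLink_first a2 (vA := vA) (vL := vL) (by rw [hr]; exact hc)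
    (by omega) (by omega) hvA hvL
  dsimp only at a7
  exact ⟨s0, s', _, findMinWith_run a1 b1, b2, b3.key.trans a3, b3.next.trans a4, by omega, a11, a10,
    b5⟩

/-- FindMin with the second strategy, if at most `k` of at most two roots do not have subtype `A`.
The state `s₀` is the one after phase 0. -/
theorem findMinBy_second {P : ℕ → Option ℕ} (h : PreInv s V P) (vA vL : ℤ) (mL mA k : ℕ)
    (hc : (V.filter fun x => P x = none).card ≤ 2)
    (hk : (V.filter fun x => P x = none ∧ s.sub x ≠ .A).card ≤ k)
    (hA : s.phi .A + 2 * k + 3 * mL ≤ maxRank V.card + 1 + mA)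
    (hL : s.phi .L ≤ 3 * (maxRank V.card + 1) + mL) :
    ∃ (s₀ s' : State α) (o : Option ℕ), findMinBy .second vA vL mL mA 1 s = some (o, s') ∧
      HeapInv s' V ∧ s'.key = s.key ∧ s'.next = s.next ∧
      s'.time ≤ s.time + 72 * (mL + mA) + 220 ∧ ClearDelta s s₀ k ∧
      ((∀ x ∈ V, P x = none → s.sub x = .A ∨ s.sub x = .N) → s₀.phi .L = s.phi .L) ∧
      s'.overhead ≤ s₀.overhead + 3 * mL + 2 * mA + 5 ∧
      ((∃ x ∈ V, P x = none ∧ ∀ r, s.arr .A r ≠ some x) →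
        s'.overhead ≤ s₀.overhead + 3 * mL + 2 * mA + 4) := by
  obtain ⟨s0, a1, a2, a3, a4, a5, a6, a7, a8, a9, a10⟩ := clearRoots_spec (h.with_time (s.time + 1))
  have hr := rootSet_eq_filter a6
  have a11 : ClearDelta s s0 k := by
    simp only [ClearDelta] at a9 ⊢
    omega
  have a12 := a11
  simp only [ClearDelta] at a12
  obtain ⟨s', b1, b2, b3, b4, b5, b6⟩ := reduceAndLink_second a2 (mL := mL) (mA := mA)
    (by rw [hr]; exact hc) (by omega) (by omega)
  dsimp only at a7 a8
  refine ⟨s0, s', _, findMinWith_run a1 b1, b2, b3.key.trans a3, b3.next.trans a4, by omega, a11, a10,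
    b5, ?_⟩
  rintro ⟨x, hx, hxP, hxa⟩
  refine b6 ⟨x, ?_, fun r hr => hxa r (a8 r x hr)⟩
  rw [hr]
  exact Finset.mem_filter.2 ⟨hx, hxP⟩

/-! ### FindMin -/

theorem HeapInv.with_time (h : HeapInv s V) (t : ℕ) : HeapInv { s with time := t } V :=
  ⟨h.inv.with_time t, h.root, h.phi_A, h.phi_L⟩

theorem HeapInv.lone_root (h : HeapInv s V) {x : ℕ} (hx : s.roots = some x) :
    s.parent x = none ∧ s.sub x = .A ∧ s.left x = x ∧ s.right x = none := by
  obtain ⟨hxV, hxr⟩ := mem_rootSet.1 (h.inv.mem_rootSet_of_roots hx)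
  obtain ⟨l, h1, h2, h3, h4⟩ := h.inv.lists none (by simp)
  have hl : ∀ y ∈ l, y = x := fun y hy => by
    have h5 := h.root y ((h4 y).1 hy).1 ((h4 y).1 hy).2
    rw [hx] at h5
    exact (Option.some.inj h5).symm
  have hxl := (h4 x).2 ⟨hxV, hxr⟩
  have h5 := hl _ (h2.left_mem hxl)
  have h6 := h2.eq_singleton h3 hxl h5
  rw [h6] at h2
  exact ⟨hxr, h.inv.root_sub x hxV hxr, h5, h2.2.1⟩

/-- With a single root of subtype `A`, the phases 0 and 2 only spend time. -/
theorem findMinWith_skip (h : HeapInv s V) {phase1 phase3 : Prog α Unit}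
    (h1 : ∀ t₀, ∃ t ≤ 4, phase1 { s with time := t₀ } = some ((), { s with time := t₀ + t }))
    (h3 : ∀ t₀, ∃ t ≤ 4, phase3 { s with time := t₀ } = some ((), { s with time := t₀ + t })) :
    ∃ t, findMinWith phase1 phase3 s = some (s.roots, { s with time := t }) ∧ t ≤ s.time + 20 := by
  rcases hr : s.roots with _ | x
  · obtain ⟨t1, ht1, h1⟩ := h1 (s.time + 1)
    obtain ⟨t3, ht3, h3⟩ := h3 (s.time + 1 + t1 + 1)
    refine ⟨s.time + 1 + t1 + 1 + t3 + 1, ?_, by omega⟩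
    refine findMinWith_run (s₁ := { s with time := s.time + 1 }) ?_ ?_
    · rw [hr, clearRoots, loop_eq]
      rfl
    · have := reduceAndLink_run h1 (s₂ := { s with time := s.time + 1 + t1 + 1 }) (by
        dsimp only
        rw [hr]
        rfl) h3
      rw [this]
      dsimp only
      rw [hr]
  · obtain ⟨g1, g2, g3, g4⟩ := h.lone_root hr
    obtain ⟨t1, ht1, h1⟩ := h1 (s.time + 1 + 1 + 1 + 1)
    obtain ⟨t3, ht3, h3⟩ := h3 (s.time + 1 + 1 + 1 + 1 + t1 + 1 + 1)
    refine ⟨s.time + 1 + 1 + 1 + 1 + t1 + 1 + 1 + t3 + 1, ?_, by omega⟩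
    refine findMinWith_run (s₁ := { s with time := s.time + 1 + 1 + 1 + 1 }) ?_ ?_
    · have hp : Function.update s.parent x none = s.parent := by rw [← g1, Function.update_eq_self]
      rw [hr, clearRoots, loop_eq]
      simp only [setParent, wr_apply, bind_apply, getSub, rd_apply, g2, ne_eq, not_true, if_false,
        Option.bind_some, getRight, g4, pure_apply, hp]
      rw [loop_eq]
      rfl
    · have := reduceAndLink_run h1 (s₂ := { s with time := s.time + 1 + 1 + 1 + 1 + t1 + 1 + 1 }) (by
        dsimp only
        rw [hr, linkRoots, loop_eq]
        simp only [getLeft, bind_apply, rd_apply, Option.bind_some, g3, if_true, pure_apply]) h3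
      rw [this]
      dsimp only
      rw [hr]

theorem findMin_spec (h : HeapInv s V) (σ : Strategy) :
    ∃ t, findMin σ s = some (s.roots, { s with time := t }) ∧ t ≤ s.time + 22 := by
  have hp : ∀ X t₀, ∃ t ≤ 2, ∀ body, whileLoop (exceeds X (s.phi X)) body { s with time := t₀ } =
      some ((), { s with time := t₀ + t }) := by
    intro X t₀
    refine ⟨2, le_rfl, fun body => ?_⟩
    rw [whileLoop, loop_eq]
    simp [bind_apply, pure_apply, exceeds, stkNonempty, getPhi, rd_apply]
  have hs : ∀ t₀, ∃ t ≤ 4, (reduceDown (s.phi .A) (s.phi .L) : Prog α Unit) { s with time := t₀ } =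
      some ((), { s with time := t₀ + t }) := by
    intro t₀
    obtain ⟨t1, ht1, h1⟩ := hp .L t₀
    obtain ⟨t2, ht2, h2⟩ := hp .A (t₀ + t1)
    refine ⟨t1 + t2, by omega, ?_⟩
    simp only [reduceDown, bind_apply, h1, h2, Option.bind_some, Nat.add_assoc]
  have hs2 : ∀ t₀, ∃ t ≤ 4, (reducePlan 0 0 : Prog α Unit) { s with time := t₀ } =
      some ((), { s with time := t₀ + t }) := fun t₀ => ⟨0, by simp, rfl⟩
  have h2 := h.with_time (s.time + 1 + 1)
  cases σ
  · obtain ⟨t, h3, h4⟩ := findMinWith_skip h2 hs hs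
    refine ⟨t, ?_, by dsimp only at h4; omega⟩
    simp only [findMin, findMinBy, bind_apply, getPhi, rd_apply, Option.bind_some]
    exact h3
  · obtain ⟨t, h3, h4⟩ := findMinWith_skip h2 hs2 hs2
    refine ⟨t, ?_, by dsimp only at h4; omega⟩
    simp only [findMin, findMinBy, bind_apply, getPhi, rd_apply, Option.bind_some]
    exact h3

end

/-! ### Insert -/

section

variable {α : Type u}

theorem Viol.insert {rank : ℕ → ℕ} {sub : ℕ → Sub} {loss : ℕ → ℕ} {arr : Kind → ℕ → Option ℕ}
    {stk : Kind → List ℕ} {phi : Kind → ℤ} {V : Finset ℕ} {x : ℕ}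
    (h : Viol rank sub loss arr stk phi V ∅) (hx : x ∉ V) :
    Viol (Function.update rank x 0) (Function.update sub x .N) (Function.update loss x 0) arr stk phi
      (Insert.insert x V) ∅ := by
  have hne : ∀ {y}, y ∈ V → y ≠ x := fun hy hyx => hx (hyx ▸ hy)
  have hxa : ∀ X r, arr X r ≠ some x := fun X r h1 => hx (h.arr_spec X r x h1).1
  refine ⟨fun X r y hy => ?_, fun X y hy _ hk => ?_, fun X y hy => ?_, fun y hy => ?_, fun X => ?_⟩
  · obtain ⟨h1, h2⟩ := h.arr_spec X r y hy
    simpa [hne h1, h1] using h2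
  · rcases Finset.mem_insert.1 hy with rfl | hy
    · simp [Sub.kind] at hk
    · simp only [Function.update_of_ne (hne hy)] at hk ⊢
      exact h.on_stk X y hy (by simp) hk
  · by_cases hyx : y = x
    · simp [hyx]
    · simpa [hyx] using h.stk_spec X y hy
  · rcases Finset.mem_insert.1 hy with rfl | hy
    · simp [LossOK]
    · simpa [hne hy] using h.loss_ok y hy
  · rw [h.phi_eq X, Finset.sum_insert hx, inArr_eq_zero (hxa X), Nat.zero_add]
    have h1 : ∑ y ∈ V, inArr arr (Function.update rank x 0) X y = ∑ y ∈ V, inArr arr rank X y :=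
      Finset.sum_congr rfl fun y hy => by simp [inArr, hne hy]
    have h2 : ∑ y ∈ V, (Function.update loss x 0 y - 1) = ∑ y ∈ V, (loss y - 1) :=
      Finset.sum_congr rfl fun y hy => by simp [hne hy]
    rw [h1]
    cases X
    · rfl
    · simp only [excessLoss, Finset.sum_insert hx, h2]
      simp

theorem Ranked.insert {rk val : ℕ → ℕ} {V : Finset ℕ} {rp : ℕ → Option ℕ} {x : ℕ} 
    (h : Ranked rk val V rp) (hx : x ∉ V) (hxp : rp x = none) (hp : ∀ y ∈ V, rp y ≠ some x)
    (hr : rk x = 0) : Ranked rk val (Insert.insert x V) rp where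
  rank_eq p hpV := by
    rw [Finset.filter_insert, if_neg (by simp [hxp])]
    rcases Finset.mem_insert.1 hpV with rfl | hpV
    · rw [hr, eq_comm, Finset.card_eq_zero]
      exact Finset.filter_eq_empty_iff.2 hp
    · exact h.rank_eq p hpV
  hall p hpV i := by
    rw [Finset.filter_insert, if_neg (by simp [hxp])]
    rcases Finset.mem_insert.1 hpV with rfl | hpV
    · rw [Finset.card_eq_zero.2 (Finset.filter_eq_empty_iff.2 fun y hy h1 => hp y hy h1.1)]
      exact Nat.zero_le i
    · exact h.hall p hpV i

variable [LinearOrder α] {V : Finset ℕ} {s : State α}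

theorem KeyBelow.congr {key key' : ℕ → Option α} {p x : ℕ} (h : KeyBelow key p x)
    (hp : key' p = key p) (hx : key' x = key x) : KeyBelow key' p x := by
  unfold KeyBelow
  rw [hp, hx]
  exact h

theorem HeapInv.card_roots_le (h : HeapInv s V) : (s.rootSet V).card ≤ 1 := by
  refine Finset.card_le_one.2 fun x hx y hy => ?_
  have h1 := h.root x (mem_rootSet.1 hx).1 (mem_rootSet.1 hx).2
  rw [h.root y (mem_rootSet.1 hy).1 (mem_rootSet.1 hy).2] at h1
  exact (Option.some.inj h1).symm

theorem insert_spec (h : HeapInv s V) (σ : Strategy) (k : α) :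
    ∃ s', DKHeap.insert σ k s = some (s.next, s') ∧ HeapInv s' (Insert.insert s.next V) ∧
      s'.key = Function.update s.key s.next (some k) ∧ s'.time ≤ s.time + 5000 ∧
      s'.overhead ≤ s.overhead + 9 := by
  obtain ⟨x, hx⟩ : ∃ x, x = s.next := ⟨_, rfl⟩
  have hxV : x ∉ V := fun h1 => (h.inv.lt_next x h1).ne hx
  have hne : ∀ {y}, y ∈ V → y ≠ x := fun hy hyx => hxV (hyx ▸ hy)
  set P := Function.update s.parent x none with hP
  have hPV : ∀ y ∈ V, P y = s.parent y := fun y hy => Function.update_of_ne (hne hy) _ _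
  have hF : Forest (Function.update s.key x (some k)) (Insert.insert x V) P := by
    refine ⟨fun y hy => ?_, fun y hy p hp => ?_, fun y hy p hp => ?_⟩ <;>
      rcases Finset.mem_insert.1 hy with rfl | hy
    · simp
    · simpa [hne hy] using h.inv.forest.key_some y hy
    · simp [hP] at hp
    · rw [hPV y hy] at hp
      exact Finset.mem_insert_of_mem (h.inv.forest.par_mem y hy p hp)
    · simp [hP] at hp
    · rw [hPV y hy] at hp
      exact (h.inv.forest.heap y hy p hp).congr
        (Function.update_of_ne (hne (h.inv.forest.par_mem y hy p hp)) _ _)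
        (Function.update_of_ne (hne hy) _ _)
  have hl : Lists (Function.update s.child x none) s.roots s.left s.right (Insert.insert x V)
      ((Insert.insert x V).erase x) P := by
    rw [Finset.erase_insert hxV]
    intro p hp
    by_cases hpx : p = some x
    · refine ⟨[], by simp [hpx, head], trivial, by simp, fun c => ?_⟩
      simp only [List.not_mem_nil, false_iff, not_and]
      intro hc h1
      rw [hPV c hc, hpx] at h1
      exact hxV (h.inv.forest.par_mem c hc x h1)
    · obtain ⟨l, h1, h2, h3, h4⟩ := h.inv.lists p (fun y hy => by
        refine (Finset.mem_insert.1 (hp y hy)).resolve_left ?_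
        rintro rfl
        exact hpx hy)
      refine ⟨l, ?_, h2, h3, fun c => ?_⟩
      · rw [← h1]
        rcases p with _ | p
        · rfl
        · simp only [head]
          exact Function.update_of_ne (by simpa using hpx) _ _
      · rw [h4]
        exact and_congr_right fun hc => by rw [hPV c hc]
  obtain ⟨child, roots, left, right, t, a1, a2, a3⟩ := addLeftmost_spec (s := { s with
    key := Function.update s.key x (some k)
    rank := Function.update s.rank x 0
    sub := Function.update s.sub x .N
    loss := Function.update s.loss x 0
    parent := P
    child := Function.update s.child x none
    next := s.next + 1
    time := s.time + 1 + 1 + 1 }) (p := none) hl (Finset.mem_insert_self x V) (by simp)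
  dsimp only at a1 a2
  have hPx : Function.update P x none = P := by simp [hP]
  rw [hPx] at a3
  have hpre : PreInv { s with
      key := Function.update s.key x (some k)
      rank := Function.update s.rank x 0
      sub := Function.update s.sub x .N
      loss := Function.update s.loss x 0
      parent := P
      child := child
      roots := roots
      left := left
      right := right
      next := s.next + 1
      time := t } (Insert.insert x V) P := by
    refine ⟨fun y hy => ?_, hF, a3, h.inv.viol.insert hxV, ?_, fun y _ _ => rfl⟩
    · rcases Finset.mem_insert.1 hy with rfl | hy
      · simp [hx]
      · exact (h.inv.lt_next y hy).trans (Nat.lt_succ_self _)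
    · have hrp : ∀ y ∈ V, rankParent (Function.update s.sub x .N) P y = rankParent s.sub s.parent y :=
        fun y hy => by simp [rankParent, hne hy, hPV y hy]
      refine Ranked.insert (h.inv.ranked.congr (fun y hy => ?_) hrp fun y hy _ => ?_) hxV
        (by simp [rankParent, hP]) (fun y hy h1 => ?_) (by simp)
      · exact Function.update_of_ne (hne hy) _ _
      · simp [hne hy]
      · rw [hrp y hy, rankParent_eq_some] at h1
        exact hxV (h.inv.forest.par_mem y hy x h1.2)
  have hroots : ((Insert.insert x V).filter fun y => P y = none) = Insert.insert x (s.rootSet V) := by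
    rw [Finset.filter_insert, if_pos (by simp [hP])]
    congr 1
    exact Finset.filter_congr fun y hy => by rw [hPV y hy]
  have hc : ((Insert.insert x V).filter fun y => P y = none).card ≤ 2 := by
    rw [hroots]
    have := Finset.card_insert_le x (s.rootSet V)
    have := h.card_roots_le
    omega
  have hsub : ∀ y ∈ V, P y = none → Function.update s.sub x .N y = .A := fun y hy hyP => by
    rw [Function.update_of_ne (hne hy)]
    exact h.inv.root_sub y hy (hPV y hy ▸ hyP)
  have hk : ((Insert.insert x V).filter fun y => P y = none ∧ Function.update s.sub x .N y ≠ .A).card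
      ≤ 1 := by
    refine Finset.card_le_one_iff_subset_singleton.2 ⟨x, fun y hy => ?_⟩
    obtain ⟨h1, h2, h3⟩ := Finset.mem_filter.1 hy
    rcases Finset.mem_insert.1 h1 with rfl | h1
    · simp
    · exact absurd (hsub y h1 h2) h3
  have hAN : ∀ y ∈ Insert.insert x V, P y = none →
      Function.update s.sub x .N y = .A ∨ Function.update s.sub x .N y = .N := by
    intro y hy hyP
    rcases Finset.mem_insert.1 hy with rfl | hy
    · simp
    · exact Or.inl (hsub y hy hyP)
  have hm : maxRank V.card ≤ maxRank (Insert.insert x V).card :=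
    maxRank_mono (Finset.card_le_card (Finset.subset_insert x V))
  have hrun : ∀ {s' : State α} {o : Option ℕ} {σ : Strategy},
      findMinBy σ (s.phi .A) (s.phi .L) 0 2 1 { s with
        key := Function.update s.key x (some k)
        rank := Function.update s.rank x 0
        sub := Function.update s.sub x .N
        loss := Function.update s.loss x 0
        parent := P
        child := child
        roots := roots
        left := left
        right := right
        next := s.next + 1
        time := t } = some (o, s') → DKHeap.insert σ k s = some (s.next, s') := by
    intro s' o σ h1
    simp only [DKHeap.insert, bind_apply, getPhi, rd_apply, Option.bind_some, alloc, ← hx, ← hP]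
    simp only [← hx] at a1 h1
    erw [a1]
    simp only [Option.bind_some]
    rw [h1]
    rfl
  have hpA := h.phi_A
  have hpL := h.phi_L
  rw [← hx]
  cases σ
  · obtain ⟨s0, s', o, b1, b2, b3, b4, b5, b6, b7, b8⟩ := findMinBy_first hpre (vA := s.phi .A)
      (vL := s.phi .L) 0 2 1 1 hc hk (by dsimp only; omega) (by dsimp only; omega) (by omega) (by omega)
    have b9 := b7 hAN
    simp only [ClearDelta] at b5 b6 b9
    have h0 : lossCost (s0.phi .L - s.phi .L) = 0 := by simp [b9, lossCost]
    exact ⟨s', hx ▸ hrun b1, b2, b3, by omega, by omega⟩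
  · obtain ⟨s0, s', o, b1, b2, b3, b4, b5, b6, b7, -, b8⟩ := findMinBy_second hpre (s.phi .A)
      (s.phi .L) 0 2 1 hc hk (by dsimp only; omega) (by dsimp only; omega)
    have b9 := b7 hAN
    have b10 := b8 ⟨x, Finset.mem_insert_self x V, by simp [hP],
      fun r h1 => hxV (h.inv.viol.arr_spec _ _ _ h1).1⟩
    simp only [ClearDelta] at b5 b6 b9
    exact ⟨s', hx ▸ hrun b1, b2, b3, by omega, by omega⟩

end

/-! ### DecreaseKey -/

section

variable {α : Type u} [LinearOrder α] {V : Finset ℕ} {s : State α}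

theorem Forest.decreaseKey {key : ℕ → Option α} {P : ℕ → Option ℕ} (h : Forest key V P) {x : ℕ}
    {k₀ k : α} (hx : x ∈ V) (hk₀ : key x = some k₀) (hk : k ≤ k₀) :
    Forest (Function.update key x (some k)) V (Function.update P x none) where
  key_some y hy := by
    by_cases hyx : y = x
    · simp [hyx]
    · simpa [hyx] using h.key_some y hy
  par_mem y hy p hp := by
    by_cases hyx : y = x
    · simp [hyx] at hp
    · exact h.par_mem y hy p (by simpa [hyx] using hp)
  heap y hy p hp := by
    by_cases hyx : y = x
    · simp [hyx] at hp
    · rw [Function.update_of_ne hyx] at hp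
      obtain ⟨a, b, ha, hb, hab⟩ := h.heap y hy p hp
      by_cases hpx : p = x
      · subst hpx
        rw [hk₀] at ha
        obtain rfl := Option.some.inj ha
        refine ⟨k, b, by simp, by rw [Function.update_of_ne hyx, hb], ?_⟩
        rcases hab with h1 | ⟨rfl, h1⟩
        · exact Or.inl (hk.trans_lt h1)
        · rcases hk.lt_or_eq with h2 | rfl
          · exact Or.inl h2
          · exact Or.inr ⟨rfl, h1⟩
      · exact ⟨a, b, by rw [Function.update_of_ne hpx, ha], by rw [Function.update_of_ne hyx, hb], hab⟩

/-- DecreaseKey before its call of FindMin. -/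
theorem cut_and_add_spec (h : HeapInv s V) {x : ℕ} {k₀ k : α} (hx : x ∈ V) (hk₀ : s.key x = some k₀)
    (hk : k ≤ k₀) :
    ∃ s₁, (cutFromParent x >>= fun _ => addLeftmost none x >>= fun _ => setKey x k) s =
        some ((), s₁) ∧ PreInv s₁ V (Function.update s.parent x none) ∧
      s₁.key = Function.update s.key x (some k) ∧ s₁.next = s.next ∧ s₁.time ≤ s.time + 30 ∧
      (∀ y ∈ V, y ≠ x → s.parent y = none → s₁.sub y = .A) ∧
      ((s₁.sub x = .A ∧ s₁.phi = s.phi ∧ s₁.overhead = s.overhead) ∨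
        ((∀ r, s₁.arr .A r ≠ some x) ∧
          DecDelta (s₁.phi .A - s.phi .A) (s₁.phi .L - s.phi .L) s.overhead s₁.overhead)) := by
  have hI := h.inv
  have hF := hI.forest.decreaseKey hx hk₀ hk
  have hpar : ∀ y ∈ V, Function.update s.parent x none y ≠ none →
    Function.update s.parent x none y = Function.update s.parent x none y := fun _ _ _ => rfl
  by_cases hA : s.sub x = .A
  · obtain ⟨child, roots, left, right, t, a1, a2, a3⟩ :=
      cutFromParent_of_A hx hA (hI.forest.par_mem x hx) hI.lists
    obtain ⟨child', roots', left', right', t', b1, b2, b3⟩ := addLeftmost_spec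
      (s := s.withTree (Function.update s.parent x none) child roots left right t) (p := none) a3 hx
      (by simp)
    dsimp only at b1 b2
    rw [Function.update_idem] at b3
    refine ⟨{ s.withTree (Function.update s.parent x none) child' roots' left' right' (t' + 1) with
        key := Function.update s.key x (some k) }, ?_,
      ⟨hI.lt_next, hF, b3, hI.viol, ?_, hpar⟩, rfl, rfl, ?_, ?_, Or.inl ⟨hA, rfl, rfl⟩⟩
    · simp only [bind_apply, a1, Option.bind_some, b1]
      rfl
    · refine hI.ranked.congr (fun _ _ => rfl) (fun y _ => ?_) fun _ _ _ => le_rfl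
      by_cases hyx : y = x
      · simp [rankParent, hyx, hA]
      · simp [rankParent, hyx]
    · dsimp only
      omega
    · exact fun y hy _ hyp => hI.root_sub y hy hyp
  · obtain ⟨q, hq⟩ : ∃ q, s.parent x = some q := by
      rcases hq : s.parent x with _ | q
      · exact absurd (hI.root_sub x hx hq) hA
      · exact ⟨q, rfl⟩
    have hqV := hI.forest.par_mem x hx q hq
    have hqx : q ≠ x := by
      rintro rfl
      exact (hI.forest.heap q hx q hq).irrefl
    obtain ⟨child, roots, left, right, arr, stk, phi, t, o, a1, a2, a3, a4, -, -, a5⟩ :=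
      cutFromParent_of_ne_A hx hA hq hqV (by simp) hI.lists hI.viol
    obtain ⟨child', roots', left', right', t', b1, b2, b3⟩ := addLeftmost_spec
      (s := (s.withViol (Function.update s.rank q (s.rank q - 1))
        (Function.update s.sub q (decSub (s.sub q)))
        (Function.update s.loss q (decLoss (s.sub q) (s.loss q))) arr stk phi t o).withTree
        (Function.update s.parent x none) child roots left right t) (p := none) a3 hx (by simp)
    dsimp only at b1 b2
    rw [Function.update_idem] at b3
    refine ⟨{ (s.withViol (Function.update s.rank q (s.rank q - 1))
        (Function.update s.sub q (decSub (s.sub q)))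
        (Function.update s.loss q (decLoss (s.sub q) (s.loss q))) arr stk phi t o).withTree
        (Function.update s.parent x none) child' roots' left' right' (t' + 1) with
        key := Function.update s.key x (some k) }, ?_,
      ⟨hI.lt_next, hF, b3, a4, ?_, hpar⟩, rfl, rfl, ?_, ?_, Or.inr ⟨fun r h1 => ?_, a5⟩⟩
    · simp only [bind_apply, a1, Option.bind_some, b1]
      rfl
    · have hrpx : rankParent s.sub s.parent x = some q := by simp [rankParent, hA, hq]
      have hpos := hI.ranked.pos hx hqV hrpx
      refine (hI.ranked.remove hx hrpx).congr (fun _ _ => rfl) (fun c _ => ?_) fun c _ hc => ?_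
      · by_cases hcx : c = x
        · simp [rankParent, hcx]
        · simp only [rankParent, hcx, ne_eq, not_false_eq_true, Function.update_of_ne]
          congr 1
          by_cases hcp : c = q
          · subst hcp
            simp only [Function.update_self, eq_iff_iff]
            cases s.sub c <;> simp [decSub]
          · simp [hcp]
      · have hcx : c ≠ x := by
          rintro rfl
          simp at hc
        simp only [Function.update_of_ne hcx] at hc
        by_cases hcp : c = q
        · subst hcp
          have hcA : s.sub c ≠ .A := by
            intro h1
            simp [rankParent, h1] at hc
          simp [decLoss, hcA]
          omega
        · simp [hcp]
    · dsimp only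
      omega
    · intro y hy _ hyp
      have hyA := hI.root_sub y hy hyp
      by_cases hyq : y = q
      · subst hyq
        simp [hyA, decSub]
      · simp [hyq, hyA]
    · have h2 := (a4.arr_spec _ _ _ h1).2.2.2
      rw [Function.update_of_ne hqx.symm] at h2
      cases hs : s.sub x <;> simp_all [Sub.kind]

theorem decreaseKey_spec (h : HeapInv s V) (σ : Strategy) {x : ℕ} {k₀ k : α} (hx : x ∈ V)
    (hk₀ : s.key x = some k₀) (hk : k ≤ k₀) :
    ∃ s', decreaseKey σ x k s = some ((), s') ∧ HeapInv s' V ∧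
      s'.key = Function.update s.key x (some k) ∧ s'.time ≤ s.time + 5000 ∧
      s'.overhead ≤ s.overhead + σ.decreaseKeyOverhead := by
  obtain ⟨s1, a1, a2, a3, a4, a5, a6, a7⟩ := cut_and_add_spec (h.with_time (s.time + 1 + 1)) hx hk₀ hk
  dsimp only at a1 a2 a3 a5 a6 a7
  set P := Function.update s.parent x none with hP
  have hroots : (V.filter fun y => P y = none) ⊆ Insert.insert x (s.rootSet V) := by
    intro y hy
    obtain ⟨h1, h2⟩ := Finset.mem_filter.1 hy
    by_cases hyx : y = x
    · simp [hyx]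
    · rw [hP, Function.update_of_ne hyx] at h2
      exact Finset.mem_insert_of_mem (mem_rootSet.2 ⟨h1, h2⟩)
  have hc : (V.filter fun y => P y = none).card ≤ 2 := by
    have := (Finset.card_le_card hroots).trans (Finset.card_insert_le x (s.rootSet V))
    have := h.card_roots_le
    omega
  have hsub : (V.filter fun y => P y = none ∧ s1.sub y ≠ .A) ⊆ {x} := by
    intro y hy
    obtain ⟨h1, h2, h3⟩ := Finset.mem_filter.1 hy
    by_contra hyx
    have hyx : y ≠ x := by simpa using hyx
    rw [hP, Function.update_of_ne hyx] at h2
    exact h3 (a6 y h1 hyx h2)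
  have hk1 : (V.filter fun y => P y = none ∧ s1.sub y ≠ .A).card ≤ 1 :=
    (Finset.card_le_card hsub).trans (by simp)
  have hk0 : s1.sub x = .A → (V.filter fun y => P y = none ∧ s1.sub y ≠ .A).card ≤ 0 := by
    intro h1
    rw [Nat.le_zero, Finset.card_eq_zero]
    refine Finset.eq_empty_of_forall_notMem fun y hy => ?_
    have h2 := Finset.mem_singleton.1 (hsub hy)
    subst h2
    exact (Finset.mem_filter.1 hy).2.2 h1
  have hrun : ∀ {s' : State α} {o : Option ℕ},
      findMinBy σ (s.phi .A) (s.phi .L) 5 18 1 s1 = some (o, s') →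
        decreaseKey σ x k s = some ((), s') := by
    intro s' o h1
    have h2 : decreaseKey σ x k s =
        ((cutFromParent x >>= fun _ => addLeftmost none x >>= fun _ => setKey x k)
          { s with time := s.time + 1 + 1 }).bind fun r =>
          (findMinBy σ (s.phi .A) (s.phi .L) 5 18 1 r.2).bind fun r => some ((), r.2) := by
      simp only [decreaseKey, bind_apply, getPhi, rd_apply, Option.bind_some, Option.bind_assoc,
        pure_apply]
    rw [h2, a1]
    simp only [Option.bind_some, h1]
  have hpA := h.phi_A
  have hpL := h.phi_L
  rcases a7 with ⟨g1, g2, g3⟩ | ⟨g1, g2⟩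
  · cases σ
    · obtain ⟨s0, s', o, b1, b2, b3, b4, b5, b6, -, b8⟩ := findMinBy_first a2 (vA := s.phi .A)
        (vL := s.phi .L) 5 18 1 0 hc (hk0 g1) (by rw [g2]; omega) (by rw [g2]; omega) (by omega)
        (by omega)
      simp only [ClearDelta] at b6
      rw [g2, g3] at b6
      have h0 : lossCost (s0.phi .L - s.phi .L) = 0 := by
        unfold lossCost
        rw [if_pos (by omega)]
      exact ⟨s', hrun b1, b2, b3.trans a3, by omega, by simp only [Strategy.decreaseKeyOverhead]; omega⟩
    · obtain ⟨s0, s', o, b1, b2, b3, b4, b5, b6, -, b8, -⟩ := findMinBy_second a2 (s.phi .A)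
        (s.phi .L) 5 18 0 hc (hk0 g1) (by rw [g2]; omega) (by rw [g2]; omega)
      simp only [ClearDelta] at b6
      exact ⟨s', hrun b1, b2, b3.trans a3, by omega, by simp only [Strategy.decreaseKeyOverhead]; omega⟩
  · simp only [DecDelta] at g2
    cases σ
    · obtain ⟨s0, s', o, b1, b2, b3, b4, b5, b6, -, b8⟩ := findMinBy_first a2 (vA := s.phi .A)
        (vL := s.phi .L) 5 18 1 1 hc hk1 (by omega) (by omega) (by omega) (by omega)
      simp only [ClearDelta] at b6
      refine ⟨s', hrun b1, b2, b3.trans a3, by omega, ?_⟩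
      simp only [Strategy.decreaseKeyOverhead]
      unfold lossCost at b8
      split_ifs at b8 <;> omega
    · obtain ⟨s0, s', o, b1, b2, b3, b4, b5, b6, -, -, b8⟩ := findMinBy_second a2 (s.phi .A)
        (s.phi .L) 5 18 1 hc hk1 (by push_cast; omega) (by push_cast; omega)
      have b9 := b8 ⟨x, hx, by simp [hP], g1⟩
      simp only [ClearDelta] at b6
      exact ⟨s', hrun b1, b2, b3.trans a3, by omega, by simp only [Strategy.decreaseKeyOverhead]; omega⟩

end

/-! ### DeleteMin -/

section

variable {α : Type u}

theorem Viol.erase {rank : ℕ → ℕ} {sub : ℕ → Sub} {loss : ℕ → ℕ} {arr : Kind → ℕ → Option ℕ}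
    {stk : Kind → List ℕ} {phi : Kind → ℤ} {V : Finset ℕ} {x : ℕ}
    (h : Viol rank sub loss arr stk phi V ∅) (hx : x ∈ V) (hN : sub x = .N) :
    Viol rank sub loss arr stk phi (V.erase x) ∅ := by
  have hxa : ∀ X r, arr X r ≠ some x := fun X r h1 => by
    have := (h.arr_spec X r x h1).2.2.2
    simp [hN, Sub.kind] at this
  refine ⟨fun X r y hy => ?_, fun X y hy hT hk => h.on_stk X y (Finset.mem_of_mem_erase hy) hT hk,
    fun X y hy => ?_, fun y hy => h.loss_ok y (Finset.mem_of_mem_erase hy), fun X => ?_⟩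
  · obtain ⟨h1, h2⟩ := h.arr_spec X r y hy
    refine ⟨Finset.mem_erase.2 ⟨?_, h1⟩, h2⟩
    rintro rfl
    exact hxa X r hy
  · by_cases hyx : y = x
    · exact Or.inr (hyx ▸ hN)
    · exact (h.stk_spec X y hy).imp_left fun h1 => Finset.mem_erase.2 ⟨hyx, h1⟩
  · have hl := h.loss_ok x hx
    rw [hN] at hl
    change loss x = 0 at hl
    have h1 := Finset.add_sum_erase V (inArr arr rank X) hx
    have h2 := Finset.add_sum_erase V (fun y => loss y - 1) hx
    rw [inArr_eq_zero (hxa X), Nat.zero_add] at h1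
    rw [hl, Nat.zero_sub, Nat.zero_add] at h2
    rw [h.phi_eq X, ← h1]
    cases X
    · rfl
    · simp only [excessLoss, ← h2]

theorem Ranked.erase {rk val rk' val' : ℕ → ℕ} {V : Finset ℕ} {rp rp' : ℕ → Option ℕ} {x : ℕ}
    (h : Ranked rk val V rp) (hx : rp x = none)
    (hrp : ∀ p ∈ V.erase x, ∀ c ∈ V.erase x, rp' c = some p ↔ rp c = some p)
    (hrk : ∀ p ∈ V.erase x, rk' p = rk p) (hval : ∀ p ∈ V.erase x, val' p = val p) :
    Ranked rk' val' (V.erase x) rp' where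
  rank_eq p hp := by
    rw [hrk p hp, h.rank_eq p (Finset.mem_of_mem_erase hp)]
    congr 1
    ext c
    by_cases hcx : c = x
    · simp [hcx, hx]
    · simp only [Finset.mem_filter, Finset.mem_erase, hcx, ne_eq, not_false_eq_true, true_and]
      exact and_congr_right fun hc => (hrp p hp c (Finset.mem_erase.2 ⟨hcx, hc⟩)).symm
  hall p hp i := by
    refine (Finset.card_le_card ?_).trans (h.hall p (Finset.mem_of_mem_erase hp) i)
    intro c hc
    obtain ⟨h1, h2, h3⟩ := Finset.mem_filter.1 hc
    rw [hrp p hp c h1] at h2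
    rw [hval c h1] at h3
    exact Finset.mem_filter.2 ⟨Finset.mem_of_mem_erase h1, h2, h3⟩

variable [LinearOrder α] {V : Finset ℕ} {s : State α}

/-- The parents after the root `ρ` has been removed. -/
def orphan (ρ : ℕ) (P : ℕ → Option ℕ) (c : ℕ) : Option ℕ := if P c = some ρ then none else P c

theorem orphan_eq_some {ρ : ℕ} {P : ℕ → Option ℕ} {c p : ℕ} :
    orphan ρ P c = some p ↔ P c = some p ∧ p ≠ ρ := by
  unfold orphan
  split_ifs with h
  · simp [h, eq_comm]
  · refine ⟨fun h1 => ⟨h1, ?_⟩, fun h1 => h1.1⟩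
    rintro rfl
    exact h h1

theorem HeapInv.orphan_eq_none (h : HeapInv s V) {ρ c : ℕ} (hρ : s.roots = some ρ)
    (hc : c ∈ V.erase ρ) : orphan ρ s.parent c = none ↔ s.parent c = some ρ := by
  unfold orphan
  split_ifs with h1
  · simp [h1]
  · refine ⟨fun h2 => ?_, fun h2 => absurd h2 h1⟩
    have h3 := h.root c (Finset.mem_of_mem_erase hc) h2
    rw [hρ] at h3
    exact absurd (Option.some.inj h3).symm (Finset.ne_of_mem_erase hc)

/-- DeleteMin before its call of FindMin. -/
theorem remove_root_spec (h : HeapInv s V) {ρ : ℕ} (hρ : s.roots = some ρ) :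
    ∃ s₁, (getChild ρ >>= fun c => setRoots c >>= fun _ => setViolationSubtype false ρ .N) s =
        some ((), s₁) ∧ PreInv s₁ (V.erase ρ) (orphan ρ s.parent) ∧
      s₁.key = s.key ∧ s₁.next = s.next ∧ s₁.reductions = s.reductions ∧ s₁.time ≤ s.time + 8 ∧
      (∀ y ∈ V.erase ρ, s₁.sub y = s.sub y) ∧ s₁.phi .L ≤ s.phi .L ∧ s₁.phi .A ≤ s.phi .A ∧
      s₁.overhead + s₁.phi .A ≤ s.overhead + s.phi .A := by
  have hI := h.inv
  obtain ⟨hρV, hρr⟩ := mem_rootSet.1 (hI.mem_rootSet_of_roots hρ)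
  have hρA := hI.root_sub ρ hρV hρr
  obtain ⟨arr1, stk1, phi1, t1, o1, q1, a1, a2, a3, a4, -, -, a6, -, -, -, a10, a11, a12⟩ :=
    setViolationSubtype_spec (s := { s with roots := s.child ρ, time := s.time + 1 + 1 })
      (taken := false) (S := .N) hI.viol hρV (by simp [Sub.kind])
  have hq := a6 rfl
  dsimp only at a1 a2 a3 a4 a10 a11 a12
  have hiL : inArr s.arr s.rank .L ρ = 0 := inArr_eq_zero_of_sub hI.viol (by simp [hρA, Sub.kind])
  have hl := hI.viol.loss_ok ρ hρV
  rw [hρA] at hl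
  change s.loss ρ = 0 at hl
  rw [hiL] at a11 a12
  simp [Sub.kind, Sub.startLoss, hl] at a10 a11
  simp only [Set.empty_sdiff] at a3
  refine ⟨{ s with
      sub := Function.update s.sub ρ .N, loss := Function.update s.loss ρ Sub.N.startLoss
      roots := s.child ρ, arr := arr1, stk := stk1, phi := phi1, time := t1, overhead := o1 },
    ?_, ⟨fun x hx => hI.lt_next x (Finset.mem_of_mem_erase hx), ⟨?_, ?_, ?_⟩, ?_,
    a3.erase hρV (by simp), ?_, ?_⟩, rfl, rfl, rfl, ?_, ?_, ?_, ?_, ?_⟩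
  · simp only [bind_apply, getChild, rd_apply, Option.bind_some, setRoots, wr_apply]
    exact a1
  · exact fun x hx => hI.forest.key_some x (Finset.mem_of_mem_erase hx)
  · intro x hx p hp
    obtain ⟨h1, h2⟩ := orphan_eq_some.1 hp
    exact Finset.mem_erase.2 ⟨h2, hI.forest.par_mem x (Finset.mem_of_mem_erase hx) p h1⟩
  · intro x hx p hp
    exact hI.forest.heap x (Finset.mem_of_mem_erase hx) p (orphan_eq_some.1 hp).1
  · intro p hp
    rcases p with _ | p
    · obtain ⟨l, h1, h2, h3, h4⟩ := hI.lists (some ρ) (by simpa using hρV)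
      refine ⟨l, h1, h2, h3, fun c => ?_⟩
      rw [h4]
      constructor
      · rintro ⟨h5, h6⟩
        have h7 : c ∈ V.erase ρ := by
          refine Finset.mem_erase.2 ⟨?_, h5⟩
          rintro rfl
          simp [hρr] at h6
        exact ⟨h7, (h.orphan_eq_none hρ h7).2 h6⟩
      · rintro ⟨h5, h6⟩
        exact ⟨Finset.mem_of_mem_erase h5, (h.orphan_eq_none hρ h5).1 h6⟩
    · have hpV := hp p rfl
      obtain ⟨l, h1, h2, h3, h4⟩ := hI.lists (some p) (by
        simpa using Finset.mem_of_mem_erase hpV)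
      refine ⟨l, h1, h2, h3, fun c => ?_⟩
      rw [h4, orphan_eq_some]
      constructor
      · rintro ⟨h5, h6⟩
        refine ⟨Finset.mem_erase.2 ⟨?_, h5⟩, h6, Finset.ne_of_mem_erase hpV⟩
        rintro rfl
        simp [hρr] at h6
      · rintro ⟨h5, h6, -⟩
        exact ⟨Finset.mem_of_mem_erase h5, h6⟩
  · refine hI.ranked.erase (x := ρ) (by simp [rankParent, hρA]) (fun p hp c hc => ?_)
      (fun _ _ => rfl) fun c hc => ?_
    · dsimp only
      rw [rankParent_eq_some, rankParent_eq_some, orphan_eq_some,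
        Function.update_of_ne (Finset.ne_of_mem_erase hc)]
      simp [Finset.ne_of_mem_erase hp]
    · simp [Finset.ne_of_mem_erase hc]
  · intro c hc hcP
    dsimp only
    rcases hp : orphan ρ s.parent c with _ | p
    · exact absurd hp hcP
    · exact (orphan_eq_some.1 hp).1
  · dsimp only
    omega
  · exact fun y hy => Function.update_of_ne (Finset.ne_of_mem_erase hy) _ _
  all_goals dsimp only; omega

theorem HeapInv.free (h : HeapInv s V) {ρ : ℕ} (hρ : ρ ∉ V) (t : ℕ) :
    HeapInv { s with key := Function.update s.key ρ none, time := t } V := by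
  have hne : ∀ {y}, y ∈ V → y ≠ ρ := fun hy hyx => hρ (hyx ▸ hy)
  refine ⟨⟨h.inv.lt_next, ⟨fun x hx => ?_, h.inv.forest.par_mem, fun x hx p hp => ?_⟩, h.inv.lists,
    h.inv.viol, h.inv.ranked, h.inv.root_sub⟩, h.root, h.phi_A, h.phi_L⟩
  · simpa [hne hx] using h.inv.forest.key_some x hx
  · exact (h.inv.forest.heap x hx p hp).congr
      (Function.update_of_ne (hne (h.inv.forest.par_mem x hx p hp)) _ _)
      (Function.update_of_ne (hne hx) _ _)

/-- Let `R` be the maximal rank. The root has at most `R` rank children, and at most `R` other nodes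
have subtype `A`. Hence there are at most `2 R` new roots, `R` of which are changed to subtype `A`;
each of these adds at most `2` to `Φ_A` and `1` to the overhead, where an overhead of `2` is
compensated by a decrease of `Φ_L`. So three times the overhead is at most `6 (R + 1) + 21 (R + 1)`
for the potentials at the start, plus `15 R` for phase 0 and `18 R` for the links. The number of
reductions is at most the sum `6 R + 4` of the potentials after phase 0. -/
theorem deleteMin_spec (h : HeapInv s V) {ρ : ℕ} (hρ : s.roots = some ρ) :
    ∃ s', deleteMin s = some (some ρ, s') ∧ HeapInv s' (V.erase ρ) ∧
      s'.key = Function.update s.key ρ none ∧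
      s'.reductions ≤ s.reductions + (6 * maxRank V.card + 7) ∧
      s'.time ≤ s.time + 1000 * (maxRank V.card + 1) ∧
      s'.overhead ≤ s.overhead + (20 * maxRank V.card + 9) := by
  have hρV := (mem_rootSet.1 (h.inv.mem_rootSet_of_roots hρ)).1
  have hρr := (mem_rootSet.1 (h.inv.mem_rootSet_of_roots hρ)).2
  obtain ⟨s1, a1, a2, a3, a4, a5, a6, a7, a8, a9, a10⟩ :=
    remove_root_spec (h.with_time (s.time + 1)) hρ
  obtain ⟨s2, b1, b2, b3, b4, b5, b6, b7, -, b8, -⟩ := clearRoots_spec (a2.with_time (s1.time + 1))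
  obtain ⟨s3, c1, c2, c3, c4, c5, c6, c7, c8, c9⟩ := reduceAndLink_reduceAll b2
  have hr := rootSet_eq_filter b6
  dsimp only at a3 a5 a6 a7 a8 a9 a10 b3 b5 b6 b7 b8 hr
  have hk : ((V.erase ρ).filter fun x => orphan ρ s.parent x = none ∧ s1.sub x ≠ .A).card ≤
      maxRank V.card := by
    have h1 := h.inv.rank_le le_rfl h.phi_L ρ hρV
    rw [h.inv.ranked.rank_eq ρ hρV] at h1
    refine (Finset.card_le_card ?_).trans h1
    intro c hc
    obtain ⟨h2, h3, h4⟩ := Finset.mem_filter.1 hc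
    rw [h.orphan_eq_none hρ h2] at h3
    rw [a7 c h2] at h4
    exact Finset.mem_filter.2 ⟨Finset.mem_of_mem_erase h2, rankParent_eq_some.2 ⟨h4, h3⟩⟩
  have hc : ((V.erase ρ).filter fun x => orphan ρ s.parent x = none).card ≤ 2 * maxRank V.card := by
    have h1 : (V.filter fun x => s.sub x = .A).card ≤ maxRank V.card + 1 := by
      have := h.inv.viol.card_A_le
      have := h.phi_A
      omega
    have h2 := Finset.card_erase_add_one (s := V.filter fun x => s.sub x = .A) (a := ρ)
      (by simp [hρV, h.inv.root_sub ρ hρV hρr])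
    have h3 : ((V.erase ρ).filter fun x => orphan ρ s.parent x = none) ⊆
        ((V.erase ρ).filter fun x => orphan ρ s.parent x = none ∧ s1.sub x ≠ .A) ∪
        (V.filter fun x => s.sub x = .A).erase ρ := by
      intro c hc
      obtain ⟨h4, h5⟩ := Finset.mem_filter.1 hc
      obtain ⟨h6, h7⟩ := Finset.mem_erase.1 h4
      rw [Finset.mem_union]
      by_cases hA : s.sub c = .A
      · right
        simp [hA, h6, h7]
      · left
        exact Finset.mem_filter.2 ⟨h4, h5, by rwa [a7 c h4]⟩
    have h8 := (Finset.card_le_card h3).trans (Finset.card_union_le _ _)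
    omega
  have hpA := h.phi_A
  have hpL := h.phi_L
  simp only [ClearDelta] at b8
  rw [hr] at c8 c9
  have hinv := c2.heapInv c4 (Or.inl c6) (Or.inl c5)
  refine ⟨{ s3 with key := Function.update s3.key ρ none, time := s3.time + 1 }, ?_,
    hinv.free (by simp) _, ?_, ?_, ?_, ?_⟩
  · have h1 := findMinWith_run (s := s1) b1 c1
    have h2 : deleteMin s =
        ((getChild ρ >>= fun c => setRoots c >>= fun _ => setViolationSubtype false ρ .N)
          { s with time := s.time + 1 }).bind fun r =>
          (findMinWith reduceAll reduceAll r.2).bind fun r =>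
            some (some ρ, { r.2 with
              key := Function.update r.2.key ρ none, time := r.2.time + 1 }) := by
      simp only [deleteMin, bind_apply, getRoots, rd_apply, hρ, Option.bind_some, Option.bind_assoc,
        pure_apply, DKHeap.free, wr_apply]
    rw [h2, a1]
    simp only [Option.bind_some, h1]
  · dsimp only
    rw [c3.key, b3, a3]
  · dsimp only
    omega
  · dsimp only
    omega
  · dsimp only
    omega

end

/-! ### Histories -/

section

variable {α : Type u} [LinearOrder α] {V : Finset ℕ} {s : State α} {S : Finset (ℕ × α)}

/-- The heap holds the elements in `S`, and `V` is the set of their nodes. -/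
structure Holds (s : State α) (V : Finset ℕ) (S : Finset (ℕ × α)) : Prop where
  inv : HeapInv s V
  mem_iff : ∀ x k, (x, k) ∈ S ↔ x ∈ V ∧ s.key x = some k

theorem Holds.card_eq (h : Holds s V S) : S.card = V.card := by
  refine Finset.card_bij (fun e _ => e.1) (fun e he => ((h.mem_iff e.1 e.2).1 he).1) ?_ ?_
  · rintro ⟨x, k⟩ h1 ⟨y, l⟩ h2 (rfl : x = y)
    have h3 := ((h.mem_iff _ _).1 h1).2
    rw [((h.mem_iff _ _).1 h2).2] at h3
    rw [Option.some.inj h3]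
  · intro x hx
    obtain ⟨k, hk⟩ := h.inv.inv.forest.key_some x hx
    exact ⟨(x, k), (h.mem_iff x k).2 ⟨hx, hk⟩, rfl⟩

theorem Holds.isMinOf (h : Holds s V S) : IsMinOf S s.roots := by
  rcases hr : s.roots with _ | x
  · have hV := h.inv.eq_empty hr
    refine Finset.eq_empty_of_forall_notMem fun e he => ?_
    have := ((h.mem_iff e.1 e.2).1 he).1
    simp [hV] at this
  · have hx := (mem_rootSet.1 (h.inv.inv.mem_rootSet_of_roots hr)).1
    obtain ⟨k, hk⟩ := h.inv.inv.forest.key_some x hx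
    refine ⟨k, (h.mem_iff x k).2 ⟨hx, hk⟩, ?_⟩
    rintro ⟨y, l⟩ he
    obtain ⟨hy, hl⟩ := (h.mem_iff y l).1 he
    by_cases hyx : y = x
    · subst hyx
      rw [hk] at hl
      exact (Option.some.inj hl).le
    · obtain ⟨a, b, ha, hb, hab⟩ := h.inv.keyBelow hr hy hyx
      rw [hk] at ha
      rw [hl] at hb
      obtain rfl := Option.some.inj ha
      obtain rfl := Option.some.inj hb
      exact hab.elim le_of_lt fun h => h.1.le

theorem Holds.insert (h : Holds s V S) {s' : State α} {k : α} (h1 : HeapInv s' (Insert.insert s.next V))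
    (h2 : s'.key = Function.update s.key s.next (some k)) :
    Holds s' (Insert.insert s.next V) (Insert.insert (s.next, k) S) := by
  refine ⟨h1, fun x l => ?_⟩
  rw [h2, Finset.mem_insert, Finset.mem_insert, h.mem_iff, Prod.mk.injEq]
  by_cases hx : x = s.next
  · subst hx
    have : s.next ∉ V := fun h3 => (h.inv.inv.lt_next _ h3).false
    simp [this, eq_comm]
  · simp [hx]

theorem Holds.decreaseKey (h : Holds s V S) {s' : State α} {x : ℕ} {k₀ k : α} (hx : (x, k₀) ∈ S)
    (h1 : HeapInv s' V) (h2 : s'.key = Function.update s.key x (some k)) :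
    Holds s' V (Insert.insert (x, k) (S.erase (x, k₀))) := by
  refine ⟨h1, fun y l => ?_⟩
  obtain ⟨hxV, hk₀⟩ := (h.mem_iff _ _).1 hx
  rw [h2, Finset.mem_insert, Finset.mem_erase, h.mem_iff, Prod.mk.injEq, ne_eq, Prod.mk.injEq]
  by_cases hy : y = x
  · subst hy
    simp only [hxV, hk₀, Function.update_self, true_and, Option.some.injEq]
    constructor
    · rintro (rfl | ⟨h3, rfl⟩)
      · rfl
      · exact absurd rfl h3
    · exact fun h3 => Or.inl h3.symm
  · simp [hy]

theorem Holds.deleteMin (h : Holds s V S) {s' : State α} {x : ℕ} {k : α} (hx : (x, k) ∈ S)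
    (h1 : HeapInv s' (V.erase x)) (h2 : s'.key = Function.update s.key x none) :
    Holds s' (V.erase x) (S.erase (x, k)) := by
  refine ⟨h1, fun y l => ?_⟩
  obtain ⟨hxV, hk⟩ := (h.mem_iff _ _).1 hx
  rw [h2, Finset.mem_erase, Finset.mem_erase, h.mem_iff, ne_eq, Prod.mk.injEq]
  by_cases hy : y = x
  · subst hy
    simp only [hk, not_true, ne_eq, false_and, Function.update_self, reduceCtorEq, and_false,
      Option.some.injEq, true_and, iff_false, not_and]
    exact fun h3 _ h4 => h3 h4.symm
  · simp [hy]

theorem holds_empty : Holds (State.empty α) ∅ ∅ := by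
  refine ⟨⟨⟨by simp, ⟨by simp, by simp, by simp⟩, ?_, ⟨by simp [State.empty], by simp,
    by simp [State.empty], by simp, ?_⟩, ⟨by simp, by simp⟩, by simp⟩, by simp, ?_, ?_⟩, by simp⟩
  · intro p hp
    rcases p with _ | p
    · exact ⟨[], rfl, trivial, by simp, by simp⟩
    · simpa using hp p rfl
  · intro X
    cases X <;> simp [State.empty, excessLoss]
  · change (0 : ℤ) ≤ _
    omega
  · change (0 : ℤ) ≤ _
    omega

theorem Reachable.exists_holds {σ : Strategy} (h : Reachable σ s S) : ∃ V, Holds s V S := by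
  induction h with
  | empty => exact ⟨∅, holds_empty⟩
  | @insert s s' S k x _ hrun ih =>
    obtain ⟨V, hV⟩ := ih
    obtain ⟨s'', h1, h2, h3, -⟩ := insert_spec hV.inv σ k
    rw [h1] at hrun
    obtain ⟨rfl, rfl⟩ := Prod.mk.inj (Option.some.inj hrun)
    exact ⟨_, hV.insert h2 h3⟩
  | @findMin s s' S o _ hrun ih =>
    obtain ⟨V, hV⟩ := ih
    obtain ⟨t, h1, -⟩ := findMin_spec hV.inv σ
    rw [h1] at hrun
    obtain ⟨rfl, rfl⟩ := Prod.mk.inj (Option.some.inj hrun)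
    exact ⟨V, hV.inv.with_time t, hV.mem_iff⟩
  | @decreaseKey s s' S x k₀ k _ hx hk hrun ih =>
    obtain ⟨V, hV⟩ := ih
    obtain ⟨hxV, hk₀⟩ := (hV.mem_iff _ _).1 hx
    obtain ⟨s'', h1, h2, h3, -⟩ := decreaseKey_spec hV.inv σ hxV hk₀ hk
    rw [h1] at hrun
    obtain ⟨-, rfl⟩ := Prod.mk.inj (Option.some.inj hrun)
    exact ⟨V, hV.decreaseKey hx h2 h3⟩
  | @deleteMin s s' S x k _ hrun hx ih =>
    obtain ⟨V, hV⟩ := ih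
    rcases hr : s.roots with _ | ρ
    · simp [DKHeap.deleteMin, bind_apply, getRoots, rd_apply, hr, pure_apply] at hrun
    · obtain ⟨s'', h1, h2, h3, -⟩ := deleteMin_spec hV.inv hr
      rw [h1] at hrun
      obtain ⟨h4, rfl⟩ := Prod.mk.inj (Option.some.inj hrun)
      obtain rfl := Option.some.inj h4
      exact ⟨_, hV.deleteMin hx h2 h3⟩
  | @deleteMinNull s s' S _ hrun ih =>
    obtain ⟨V, hV⟩ := ih
    rcases hr : s.roots with _ | ρ
    · simp only [DKHeap.deleteMin, bind_apply, getRoots, rd_apply, hr, pure_apply, Option.bind_some]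
        at hrun
      obtain ⟨-, rfl⟩ := Prod.mk.inj (Option.some.inj hrun)
      exact ⟨V, by rw [← hr]; exact hV.inv.with_time _, hV.mem_iff⟩
    · obtain ⟨s'', h1, -⟩ := deleteMin_spec hV.inv hr
      rw [h1] at hrun
      simp at hrun

end

end DKHeap

theorem mainTheorem4 :
    (∀ n : ℕ, 1 ≤ n →
      (maxRank n : ℝ) < 4 + 1.2 * Real.logb 2 n ∧
      6 * (maxRank n : ℝ) + 7 ≤ 7.2 * Real.logb 2 n + 31 ∧
      (⌈(41 * (maxRank n : ℝ) + 49) / 2⌉ : ℝ) ≤ 24.6 * Real.logb 2 n + 107) ∧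
    ∃ C : ℕ, ∀ (α : Type u) [LinearOrder α] (σ : DKHeap.Strategy) (s : DKHeap.State α)
      (S : Finset (ℕ × α)), DKHeap.Reachable σ s S →
      -- the ranks
      (∀ (x : ℕ) (k : α), (x, k) ∈ S → s.rank x ≤ maxRank S.card) ∧
      -- Insert
      (∀ k : α, ∃ (x : ℕ) (s' : DKHeap.State α),
        DKHeap.insert σ k s = some (x, s') ∧
        (∀ k' : α, (x, k') ∉ S) ∧
        s'.time ≤ s.time + C ∧
        s'.overhead ≤ s.overhead + 9) ∧
      -- FindMin
      (∃ (o : Option ℕ) (s' : DKHeap.State α),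
        DKHeap.findMin σ s = some (o, s') ∧
        DKHeap.IsMinOf S o ∧
        s'.time ≤ s.time + C ∧
        s'.overhead = s.overhead) ∧
      -- DecreaseKey
      (∀ (x : ℕ) (k₀ k : α), (x, k₀) ∈ S → k ≤ k₀ → ∃ s' : DKHeap.State α,
        DKHeap.decreaseKey σ x k s = some ((), s') ∧
        s'.time ≤ s.time + C ∧
        s'.overhead ≤ s.overhead + σ.decreaseKeyOverhead) ∧
      -- DeleteMin
      (∃ (o : Option ℕ) (s' : DKHeap.State α),
        DKHeap.deleteMin s = some (o, s') ∧
        DKHeap.IsMinOf S o ∧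
        s'.time ≤ s.time + C * (Nat.log 2 S.card + 1) ∧
        s'.reductions ≤ s.reductions + (6 * maxRank S.card + 7) ∧
        (s'.overhead : ℤ) ≤ s.overhead + ⌈(41 * (maxRank S.card : ℝ) + 49) / 2⌉) := by
  refine ⟨fun n hn => ?_, 17000, fun α _ σ s S hS => ?_⟩
  · have h := maxRank_lt hn
    exact ⟨h, by linarith, ceil_overhead_le h⟩
  obtain ⟨V, hV⟩ := hS.exists_holds
  have hI := hV.inv
  refine ⟨fun x k hx => ?_, fun k => ?_, ?_, fun x k₀ k hx hk => ?_, ?_⟩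
  · rw [hV.card_eq]
    exact hI.inv.rank_le le_rfl hI.phi_L x ((hV.mem_iff x k).1 hx).1
  · obtain ⟨s', h1, -, -, h2, h3⟩ := DKHeap.insert_spec hI σ k
    exact ⟨s.next, s', h1, fun k' hk' => (hI.inv.lt_next _ ((hV.mem_iff _ _).1 hk').1).false,
      by omega, h3⟩
  · obtain ⟨t, h1, h2⟩ := DKHeap.findMin_spec hI σ
    exact ⟨_, _, h1, hV.isMinOf, by dsimp only; omega, rfl⟩
  · obtain ⟨hxV, hk₀⟩ := (hV.mem_iff _ _).1 hx
    obtain ⟨s', h1, -, -, h2, h3⟩ := DKHeap.decreaseKey_spec hI σ hxV hk₀ hk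
    exact ⟨s', h1, by omega, h3⟩
  · have hmin := hV.isMinOf
    have hR : ((20 * maxRank S.card + 9 : ℕ) : ℤ) ≤ ⌈(41 * (maxRank S.card : ℝ) + 49) / 2⌉ := by
      rw [← Int.cast_le (R := ℝ)]
      refine le_trans ?_ (Int.le_ceil _)
      push_cast
      have : (0 : ℝ) ≤ maxRank S.card := Nat.cast_nonneg _
      linarith
    rcases hr : s.roots with _ | ρ
    · rw [hr] at hmin
      refine ⟨none, { s with time := s.time + 1 }, ?_, hmin, ?_, by simp, ?_⟩
      · simp only [DKHeap.deleteMin, DKHeap.bind_apply, DKHeap.getRoots, DKHeap.rd_apply, hr,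
          DKHeap.pure_apply, Option.bind_some]
      · dsimp only
        nlinarith [Nat.zero_le (Nat.log 2 S.card)]
      · dsimp only
        omega
    · obtain ⟨s', h1, -, -, h2, h3, h4⟩ := DKHeap.deleteMin_spec hI hr
      rw [← hV.card_eq] at h2 h3 h4
      rw [hr] at hmin
      refine ⟨some ρ, s', h1, hmin, ?_, h2, by omega⟩
      have := maxRank_le_log S.card
      generalize Nat.log 2 S.card = L at *
      nlinarith
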